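/- Let $\mathcal K$ be a complete non-Archimedean field that is either trivially valued ($|\mathcal K^\times|=\{1\}$) or discretely valued ($|\mathcal K^\times|=r^{\mathbf Z}$ for some $r\in(0,1)$), with valuation ring $\mathcal K^\circ$ and $v_{\mathcal K}=-\log|\cdot|$. Let $\mathcal S^+$ be $\operatorname{Spec}\mathcal K^\circ$ with the log structure $\mathcal K^\circ\setminus\{0\}$ (the trivial log scheme $\operatorname{Spec}\mathcal K$ in the trivially-valued case, the divisorial log structure of the closed point in the discretely-valued case). Let $\mathcal X^+=(\mathcal X,\mathcal M)$, $\mathcal M\subseteq\mathcal O_{\mathcal X}$, be a fine and saturated (Zariski) log-regular log scheme over $\mathcal S^+$, where $\mathcal X$ is an integral separated scheme of finite type over $\mathcal K^\circ$. (So $\mathcal X^+$ is a log-regular variety over $\mathcal K$ in the trivially-valued case, and a log-regular model of its generic fibre in the discretely-valued case.) Let $\mathcal X^{\mathrm{an}}$ be the set of pairs $P=(\xi,|\cdot|_P)$, with $\xi=\ker(P)\in\mathcal X$ and $|\cdot|_P$ an absolute value on the residue field of $\xi$ extending that of $\mathcal K$, that admit a centre on $\mathcal X$; it carries the weakest topology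 such that $\ker$ is continuous and $P\mapsto|f(P)|$ is continuous on $\ker^{-1}(U)$ for all open $U\subseteq\mathcal X$ and $f\in\mathcal O(U)$. (This is the $\beth$-analytification, respectively the analytic generic fibre of the formal completion, of $\mathcal X$.) Write $\mathcal C_x=\mathcal M_x/\mathcal O_x^\times$. Let $F_{\mathcal X^+}$ be the Kato fan, i.e. the set of points $x\in\mathcal X$ such that $\mathcal M_x\setminus\mathcal O_x^\times$ generates the maximal ideal of $\mathcal O_{\mathcal X,x}$; these are the generic points of the strata of the divisor where the log structure is non-trivial. For $x\in F_{\mathcal X^+}$ let $\operatorname{Sk}_x(\mathcal X^+)\subseteq\mathcal X^{\mathrm{an}}$ be the set of the points $v_\alpha$, where $\alpha\in\operatorname{Hom}(\mathcal C_x,\mathbf R_{\ge0})$ (with $\alpha(\pi)=v_{\mathcal K}(\pi)$ for a uniformizer $\pi$ if $\mathcal K$ is discretely valued) and $v_\alpha:\mathcal O_{\mathcal X,x}\to[0,\infty]$ is the minimal semivaluation that extends $v_{\mathcal K}$ and satisfies $v_\alpha(f)=\alpha(\overline f)$ for all $f\in\mathcal M_x$. Put $\operatorname{Sk}(\mathcal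 X^+)=\bigcup_{x\in F_{\mathcal X^+}}\operatorname{Sk}_x(\mathcal X^+)$, and let $\overline{\operatorname{Sk}}(\mathcal X^+)$ be its closure in $\mathcal X^{\mathrm{an}}$. For $y\in F_{\mathcal X^+}$ let $\mathcal D_y=\overline{\{y\}}$ with its reduced scheme structure, and let $\mathcal D_y^+$ be $\mathcal D_y$ with the trace log structure, i.e. the one associated with $\{f\in\mathcal M_x: f(y)\ne0\}\to\mathcal O_{\mathcal D_y,x}$, $x\in\mathcal D_y$. Define $\mathcal D_y^{\mathrm{an}}$ and $\operatorname{Sk}(\mathcal D_y^+)\subseteq\mathcal D_y^{\mathrm{an}}$ in the same way; both are empty if $\mathcal D_y$ does not meet the generic fibre of $\mathcal X$. Then, for every $y\in F_{\mathcal X^+}$, the natural map $\mathcal D_y^{\mathrm{an}}\to\mathcal X^{\mathrm{an}}$ is injective, and, regarding $\operatorname{Sk}(\mathcal D_y^+)$ as a subset of $\mathcal X^{\mathrm{an}}$ through it, $$\overline{\operatorname{Sk}}(\mathcal X^+)=\coprod_{y\in F_{\mathcal X^+}}\operatorname{Sk}(\mathcal D_y^+)$$ as a disjoint union of sets. Moreover,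 for every $y\in F_{\mathcal X^+}$, $$\operatorname{Sk}(\mathcal D_y^+)=\overline{\operatorname{Sk}}(\mathcal X^+)\cap\ker^{-1}(y).$$ -/

import Mathlib

open AlgebraicGeometry CategoryTheory TopologicalSpace
open scoped NNReal ENNReal

universe u

namespace LogSkel

noncomputable section

/-! ## Non-Archimedean base fields -/

/-- `K` is trivially valued: `|Kˣ| = {1}`. -/
def IsTriviallyValued (K : Type u) [NormedField K] : Prop :=
  ∀ a : K, a ≠ 0 → ‖a‖ = 1

/-- `K` is discretely valued: `|Kˣ| = r^ℤ` for some `r ∈ (0,1)`. -/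
def IsDiscretelyValued (K : Type u) [NormedField K] : Prop :=
  ∃ r : ℝ, 0 < r ∧ r < 1 ∧
    Set.range (fun a : Kˣ => ‖(a : K)‖) = Set.range (fun n : ℤ => r ^ n)

/-- The valuation ring `K° = {|a| ≤ 1}`. It is `K` itself if `K` is trivially valued. -/
abbrev valRing (K : Type u) [NormedField K] [IsUltrametricDist K] : ValuationSubring K :=
  (NormedField.valuation (K := K)).valuationSubring

/-- The scheme `S = Spec K°`. -/
abbrev base (K : Type u) [NormedField K] [IsUltrametricDist K] : Scheme.{u} :=
  Spec (CommRingCat.of (valRing K))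

/-- The structural map `K° → O_{X,x}` of a scheme over `Spec K°`. -/
def baseStalk {K : Type u} [NormedField K] [IsUltrametricDist K] {X : Scheme.{u}}
    (p : X ⟶ base K) (x : X) : valRing K →+* X.presheaf.stalk x :=
  ((Scheme.ΓSpecIso (CommRingCat.of (valRing K))).inv ≫ p.appTop ≫
    X.presheaf.germ ⊤ x trivial).hom

/-! ## Logarithmic structures -/

/-- A (Zariski) log structure `M ⊆ O_X`: a subsheaf of multiplicative monoids of the structure
sheaf that contains all invertible functions. -/
structure LogStructure (X : Scheme.{u}) where
  /-- the monoid `M(U) ⊆ O_X(U)` -/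
  sections (U : X.Opens) : Submonoid Γ(X, U)
  map_mem {U V : X.Opens} (i : V ⟶ U) {s : Γ(X, U)} (hs : s ∈ sections U) :
    X.presheaf.map i.op s ∈ sections V
  local_mem {U : X.Opens} (s : Γ(X, U))
    (h : ∀ x ∈ U, ∃ (V : X.Opens) (i : V ⟶ U), x ∈ V ∧ X.presheaf.map i.op s ∈ sections V) :
    s ∈ sections U
  unit_mem {U : X.Opens} {s : Γ(X, U)} (hs : IsUnit s) : s ∈ sections U

namespace LogStructure

variable {X : Scheme.{u}} (M : LogStructure X)

/-- The stalk `M_x ⊆ O_{X,x}`: germs of local sections of `M`. -/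
def stalk (x : X) : Submonoid (X.presheaf.stalk x) where
  carrier := {f | ∃ (U : X.Opens) (hx : x ∈ U) (s : Γ(X, U)),
    s ∈ M.sections U ∧ X.presheaf.germ U x hx s = f}
  one_mem' := ⟨⊤, trivial, 1, one_mem _, map_one _⟩
  mul_mem' := by
    rintro _ _ ⟨U, hU, s, hs, rfl⟩ ⟨V, hV, t, ht, rfl⟩
    have hx : x ∈ U ⊓ V := Opens.mem_inf.mpr ⟨hU, hV⟩
    refine ⟨U ⊓ V, hx, X.presheaf.map (homOfLE inf_le_left).op s *
      X.presheaf.map (homOfLE inf_le_right).op t,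
      mul_mem (M.map_mem _ hs) (M.map_mem _ ht), ?_⟩
    rw [map_mul]
    exact congrArg₂ (· * ·)
      (TopCat.Presheaf.germ_res_apply X.presheaf (homOfLE inf_le_left : U ⊓ V ⟶ U) x hx s)
      (TopCat.Presheaf.germ_res_apply X.presheaf (homOfLE inf_le_right : U ⊓ V ⟶ V) x hx t)

/-- The characteristic monoid `C_x = M_x / O_{X,x}^×`. (All units of `O_{X,x}` lie in `M_x`, so
they are the units of the monoid `M_x`.) -/
abbrev charMonoid (x : X) : Type u := Associates (M.stalk x)

/-- The ideal `I_x` of `O_{X,x}` generated by `M_x ∖ O_{X,x}^×`. -/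
def charIdeal (x : X) : Ideal (X.presheaf.stalk x) :=
  Ideal.span {f | f ∈ M.stalk x ∧ ¬ IsUnit f}

end LogStructure

/-- A fine and saturated (fs) monoid: commutative, finitely generated, cancellative, and containing
every element `a / b` of its groupification that has a positive power in the monoid. -/
structure IsFsMonoid (P : Type*) [CommMonoid P] : Prop where
  fg : Monoid.FG P
  cancel : IsCancelMul P
  saturated : ∀ (a b : P) (n : ℕ), 0 < n → (∃ c, a ^ n = b ^ n * c) → ∃ c, a = b * c

namespace LogStructure

variable {X : Scheme.{u}} (M : LogStructure X)

/-- `φ : P → M(U)` is a chart of `M` on `U`: `M|_U` is the log structure associated with `φ`, i.e.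
for every `z ∈ U` the map `P ⊕_{φ_z⁻¹(O_z^×)} O_z^× → M_z`, `(p, u) ↦ u φ(p)`, is bijective. -/
structure IsChart {P : Type*} [CommMonoid P] (U : X.Opens) (φ : P →* Γ(X, U)) : Prop where
  mem : ∀ p, φ p ∈ M.sections U
  surj : ∀ (z : X) (hz : z ∈ U), ∀ m ∈ M.stalk z, ∃ (p : P) (v : X.presheaf.stalk z),
    IsUnit v ∧ m = X.presheaf.germ U z hz (φ p) * v
  inj : ∀ (z : X) (hz : z ∈ U) (p q : P) (v : X.presheaf.stalk z), IsUnit v →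
    X.presheaf.germ U z hz (φ p) * v = X.presheaf.germ U z hz (φ q) →
    ∃ a b : P, IsUnit (X.presheaf.germ U z hz (φ a)) ∧ IsUnit (X.presheaf.germ U z hz (φ b)) ∧
      p * a = q * b ∧ X.presheaf.germ U z hz (φ a) = v * X.presheaf.germ U z hz (φ b)

/-- The log scheme `(X, M)` is fine and saturated: locally it has charts by fs monoids. -/
def IsFineSaturated : Prop :=
  ∀ x : X, ∃ (U : X.Opens) (_ : x ∈ U) (P : Type) (_ : CommMonoid P) (φ : P →* Γ(X, U)),
    IsFsMonoid P ∧ M.IsChart U φ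

/-- Log-regularity at `x`: `O_x / I_x` is a regular local ring and
`dim O_x = dim O_x / I_x + rank C_x^gp`. -/
structure IsLogRegularAt (x : X) : Prop where
  regular : IsRegularLocalRing (X.presheaf.stalk x ⧸ M.charIdeal x)
  dim_eq : ringKrullDim (X.presheaf.stalk x) =
    ringKrullDim (X.presheaf.stalk x ⧸ M.charIdeal x) +
      (Module.finrank ℤ (Additive (Algebra.GrothendieckGroup (M.charMonoid x))) : ℕ)

/-- The log scheme `(X, M)` is log-regular. -/
def IsLogRegular : Prop := ∀ x : X, M.IsLogRegularAt x

/-- (The points of) the Kato fan: those `x` for which `M_x ∖ O_x^×` generates the maximal ideal of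
`O_x`. For a log-regular log scheme these are the generic points of the strata of the divisor on
which the log structure is non-trivial. -/
def katoFan : Set X :=
  {x | M.charIdeal x = IsLocalRing.maximalIdeal (X.presheaf.stalk x)}

/-- `p` is a morphism of log schemes `(X, M) → S⁺`, where `S⁺ = Spec K°` carries the log structure
of nonzero elements of `K°`. For `K` trivially valued, `S⁺` is the trivial log scheme `Spec K` (and
the condition is void); for `K` discretely valued, it is `Spec K°` with the divisorial log structure
of the closed point. -/
def IsOver {K : Type u} [NormedField K] [IsUltrametricDist K] (p : X ⟶ base K) : Prop :=
  ∀ (a : valRing K), a ≠ 0 → ∀ x : X, baseStalk p x a ∈ M.stalk x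

end LogStructure

/-! ## Strata and trace log structures -/

/-- The closed subscheme `D_y = closure {y}` with its reduced structure. -/
def stratum {X : Scheme.{u}} (y : X) : Scheme.{u} :=
  (Scheme.IdealSheafData.vanishingIdeal (⟨closure {y}, isClosed_closure⟩ : Closeds X)).subscheme

/-- The closed immersion `D_y ⟶ X`. -/
def stratumι {X : Scheme.{u}} (y : X) : stratum y ⟶ X :=
  (Scheme.IdealSheafData.vanishingIdeal (⟨closure {y}, isClosed_closure⟩ : Closeds X)).subschemeι

instance {X : Scheme.{u}} (y : X) : IsClosedImmersion (stratumι y) := by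
  unfold stratumι stratum; infer_instance

theorem specializes_stratumι {X : Scheme.{u}} (y : X) (x : stratum y) : y ⤳ stratumι y x := by
  rw [specializes_iff_mem_closure]
  have h : stratumι y x ∈ Set.range (stratumι y) := ⟨x, rfl⟩
  have e : Set.range (stratumι y) = closure {y} :=
    (Scheme.IdealSheafData.range_subschemeι _).trans
      (Scheme.IdealSheafData.coe_support_vanishingIdeal _)
  exact e ▸ h

namespace LogStructure

variable {X : Scheme.{u}} (M : LogStructure X)

/-- For a generization `y` of `x`, the monoid `M_x ∖ I_y = {f ∈ M_x : f(y) ≠ 0}`. -/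
def nonvanishing {x y : X} (h : y ⤳ x) : Submonoid (X.presheaf.stalk x) :=
  M.stalk x ⊓ (IsUnit.submonoid (X.presheaf.stalk y)).comap (X.presheaf.stalkSpecializes h).hom

/-- The stalk at `x ∈ D_y` of the trace log structure: the image of `{f ∈ M_x : f(y) ≠ 0}` in
`O_{D_y,x}`. It contains all units of `O_{D_y,x}`, see `isUnit_mem_traceStalk`. -/
def traceStalk (y : X) (x : stratum y) : Submonoid ((stratum y).presheaf.stalk x) :=
  (M.nonvanishing (specializes_stratumι y x)).map ((stratumι y).stalkMap x).hom

theorem isUnit_mem_stalk {x : X} {f : X.presheaf.stalk x} (hf : IsUnit f) : f ∈ M.stalk x := by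
  obtain ⟨U, hU, s, rfl⟩ := X.presheaf.exists_germ_eq f
  have hx : x ∈ X.basicOpen s := (X.mem_basicOpen s x hU).mpr hf
  refine ⟨X.basicOpen s, hx, X.presheaf.map (homOfLE (X.basicOpen_le s)).op s,
    M.unit_mem (RingedSpace.isUnit_res_basicOpen _ s), ?_⟩
  rw [TopCat.Presheaf.germ_res_apply]

theorem isUnit_mem_traceStalk (y : X) (x : stratum y) {f : (stratum y).presheaf.stalk x}
    (hf : IsUnit f) : f ∈ M.traceStalk y x := by
  obtain ⟨g, rfl⟩ := (stratumι y).stalkMap_surjective x f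
  have hg : IsUnit g := (isUnit_map_iff ((stratumι y).stalkMap x).hom g).mp hf
  exact ⟨g, ⟨M.isUnit_mem_stalk hg, hg.map _⟩, rfl⟩

/-- The trace of `M` on `D_y`: the log structure on `D_y` associated with
`{f ∈ M : f(y) ≠ 0} → O_{D_y}`. A section of `O_{D_y}` belongs to it if and only if all of its
germs are images of germs in `{f ∈ M_x : f(y) ≠ 0}`. -/
def trace (y : X) : LogStructure (stratum y) where
  sections U :=
    { carrier := {s | ∀ (x : stratum y) (hx : x ∈ U),
        (stratum y).presheaf.germ U x hx s ∈ M.traceStalk y x}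
      one_mem' := fun x hx => by rw [map_one]; exact one_mem _
      mul_mem' := fun hs ht x hx => by rw [map_mul]; exact mul_mem (hs x hx) (ht x hx) }
  map_mem i s hs x hx := by
    rw [TopCat.Presheaf.germ_res_apply]; exact hs x _
  local_mem s h x hx := by
    obtain ⟨V, i, hxV, hs⟩ := h x hx
    have := hs x hxV
    rwa [TopCat.Presheaf.germ_res_apply] at this
  unit_mem hs x hx := M.isUnit_mem_traceStalk y x (hs.map _)

end LogStructure

/-! ## Berkovich analytifications -/

section Berkovich

variable {K : Type u} [NormedField K] [IsUltrametricDist K]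

/-- A point of the Berkovich analytification of the generic fibre of a scheme `X` over `Spec K°`:
a point `ker` of `X` and an absolute value on its residue field extending `|·|` on `K°`. (As
`|a| ≠ 0` for `a ≠ 0`, the point `ker` automatically lies in the generic fibre `X_K`; if `K` is
trivially valued, then `X_K = X`.) -/
structure BerkovichPoint {X : Scheme.{u}} (p : X ⟶ base K) where
  /-- the underlying scheme-theoretic point -/
  ker : X
  /-- the absolute value on its residue field -/
  abs : AbsoluteValue (X.residueField ker) ℝ
  abs_base : ∀ a : valRing K, abs (X.residue ker (baseStalk p ker a)) = ‖(a : K)‖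

namespace BerkovichPoint

variable {X : Scheme.{u}} {p : X ⟶ base K}

/-- The weakest topology for which `ker` is continuous and, for every open `U ⊆ X` and every regular
function `f` on `U`, the map `x ↦ |f(x)|` is continuous on `ker⁻¹(U)`. -/
instance : TopologicalSpace (BerkovichPoint p) :=
  TopologicalSpace.generateFrom
    ({W | ∃ U : X.Opens, W = {P | P.ker ∈ U}} ∪
      {W | ∃ (U : X.Opens) (f : Γ(X, U)) (V : Set ℝ), IsOpen V ∧
        W = {P | ∃ h : P.ker ∈ U, P.abs (X.evaluation U P.ker h f) ∈ V}})

/-- `|f(P)|` for `f ∈ O_{X,z}`, where `z` is a specialization of `ker P`. -/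
def stalkAbs (P : BerkovichPoint p) {z : X} (h : P.ker ⤳ z) (f : X.presheaf.stalk z) : ℝ :=
  P.abs (X.residue P.ker (X.presheaf.stalkSpecializes h f))

/-- `z` is a centre of `P` on `X`: the valuation ring of `P` dominates the image of `O_{X,z}` in the
residue field, i.e. the morphism from the spectrum of the residue field to `X` extends to the
spectrum of the valuation ring, with closed point mapping to `z`. -/
def HasCentre (P : BerkovichPoint p) (z : X) : Prop :=
  ∃ h : P.ker ⤳ z, ∀ f : X.presheaf.stalk z,
    P.stalkAbs h f ≤ 1 ∧ (f ∈ IsLocalRing.maximalIdeal (X.presheaf.stalk z) → P.stalkAbs h f < 1)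

theorem baseStalk_comp {Y : Scheme.{u}} (g : Y ⟶ X) (y : Y) (a : valRing K) :
    baseStalk (g ≫ p) y a = g.stalkMap y (baseStalk p (g y) a) := by
  have h := Scheme.Hom.germ_stalkMap g ⊤ y trivial
  simp only [baseStalk, Scheme.Hom.comp_appTop, CommRingCat.hom_comp, RingHom.comp_apply]
  exact (congrArg (fun t => t.hom (p.appTop.hom
    ((Scheme.ΓSpecIso (CommRingCat.of (valRing K))).inv.hom a))) h).symm

/-- Functoriality of the analytification. -/
def map {Y : Scheme.{u}} (g : Y ⟶ X) (P : BerkovichPoint (g ≫ p)) : BerkovichPoint p where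
  ker := g P.ker
  abs := P.abs.comp (f := (g.residueFieldMap P.ker).hom) (RingHom.injective _)
  abs_base a := by
    rw [← P.abs_base a, baseStalk_comp]
    exact congrArg (fun t => P.abs (t.hom (baseStalk p (g P.ker) a)))
      (Scheme.residue_residueFieldMap g P.ker)

theorem stalkAbs_map {Y : Scheme.{u}} (g : Y ⟶ X) (P : BerkovichPoint (g ≫ p)) {z : Y}
    (h : P.ker ⤳ z) (h' : (map g P).ker ⤳ g z) (f : X.presheaf.stalk (g z)) :
    (map g P).stalkAbs h' f = P.stalkAbs h (g.stalkMap z f) := by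
  have h1 := congrArg (fun t => t.hom (X.presheaf.stalkSpecializes h' f))
    (Scheme.residue_residueFieldMap g P.ker)
  have h2 := congrArg (fun t => t.hom f) (Scheme.Hom.stalkSpecializes_stalkMap g P.ker z h)
  exact congrArg P.abs (h1.trans (congrArg (Y.residue P.ker) h2))

theorem HasCentre.map {Y : Scheme.{u}} (g : Y ⟶ X) {P : BerkovichPoint (g ≫ p)} {z : Y}
    (hP : P.HasCentre z) : (BerkovichPoint.map g P).HasCentre (g z) := by
  obtain ⟨h, hz⟩ := hP
  refine ⟨h.map g.continuous, fun f => ?_⟩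
  have e := stalkAbs_map g P h (h.map g.continuous) f
  refine ⟨e.trans_le (hz _).1, fun hf => e.trans_lt ((hz _).2 ?_)⟩
  rw [IsLocalRing.mem_maximalIdeal, mem_nonunits_iff] at hf ⊢
  exact fun hu => hf ((isUnit_map_iff (g.stalkMap z).hom f).mp hu)

end BerkovichPoint

/-- The analytic space `X^an` of a scheme `X` over `Spec K°`: the points of the Berkovich
analytification of `X_K` that admit a centre on `X`, with the subspace topology. It is the
beth-analytification of `X` if `K` is trivially valued, and the analytic generic fibre of the formal
completion of `X` if `K` is discretely valued. -/
def AnSpace {X : Scheme.{u}} (p : X ⟶ base K) : Type u :=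
  {P : BerkovichPoint p // ∃ z, P.HasCentre z}

instance {X : Scheme.{u}} (p : X ⟶ base K) : TopologicalSpace (AnSpace p) :=
  inferInstanceAs (TopologicalSpace {P : BerkovichPoint p // ∃ z, P.HasCentre z})

namespace AnSpace

variable {X : Scheme.{u}} {p : X ⟶ base K}

/-- The kernel map `X^an → X`. -/
def ker (P : AnSpace p) : X := P.1.ker

/-- The map of analytic spaces induced by a morphism of schemes over `Spec K°`. -/
def map {Y : Scheme.{u}} (g : Y ⟶ X) (P : AnSpace (g ≫ p)) : AnSpace p :=
  ⟨P.1.map g, P.2.elim fun z hz => ⟨g z, hz.map g⟩⟩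

end AnSpace

/-! ## Skeletons -/

/-- `t ↦ e^{-t}` for `t ∈ [0, ∞]`, which turns valuations into absolute values. -/
def expNeg (t : ℝ≥0∞) : ℝ := if t = ⊤ then 0 else Real.exp (-t.toReal)

variable {X : Scheme.{u}} (p : X ⟶ base K) (M : LogStructure X)

/-- `w` is a semivaluation `O_{X,x} → [0, ∞]` extending `v_K = -log |·|` on `K°` such that
`w(f) = α(f̄)` for all `f ∈ M_x`. -/
structure IsCompatible (x : X) (α : M.charMonoid x →* Multiplicative ℝ≥0)
    (w : AddValuation (X.presheaf.stalk x) ℝ≥0∞) : Prop where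
  extends_base : ∀ a : valRing K, expNeg (w (baseStalk p x a)) = ‖(a : K)‖
  eq_on_log : ∀ f : M.stalk x, w f = ((α (Associates.mk f)).toAdd : ℝ≥0∞)

/-- `v = v_α` is the minimal semivaluation extending `v_K` with `v(f) = α(f̄)` for `f ∈ M_x`. -/
structure IsMinimalSemivaluation (x : X) (α : M.charMonoid x →* Multiplicative ℝ≥0)
    (v : AddValuation (X.presheaf.stalk x) ℝ≥0∞) : Prop where
  compatible : IsCompatible p M x α v
  minimal : ∀ w, IsCompatible p M x α w → ∀ f, v f ≤ w f

/-- The face `Sk_x(X⁺) = {v_α : α ∈ Hom(C_x, ℝ₊)}` of the skeleton, a subset of `X^an`. If `K` is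
discretely valued with uniformizer `π`, the usual normalization `α(π) = v_K(π)` is implied by the
requirement that `v_α` extends `v_K`. A semivaluation `v` on `O_{X,x}` is regarded as the
point `P` of `X^an` with `|f(P)| = e^{-v(f)}` for all `f ∈ O_{X,x}`. -/
def skeletonFace (x : X) : Set (AnSpace p) :=
  {P | ∃ (α : M.charMonoid x →* Multiplicative ℝ≥0)
      (v : AddValuation (X.presheaf.stalk x) ℝ≥0∞) (h : P.ker ⤳ x),
      IsMinimalSemivaluation p M x α v ∧ ∀ f, P.1.stalkAbs h f = expNeg (v f)}

/-- The skeleton `Sk(X⁺) ⊆ X^an`, the union of the faces over the Kato fan. -/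
def skeleton : Set (AnSpace p) := ⋃ x ∈ M.katoFan, skeletonFace p M x

/-- The inclusion `D_y^an → X^an`. -/
def stratumInclusion (y : X) : AnSpace (stratumι y ≫ p) → AnSpace p :=
  AnSpace.map (stratumι y)

/-- `Sk(D_y⁺)`, for the trace log structure on `D_y`, viewed as a subset of `X^an`. It is empty if
`D_y` is vertical, i.e. does not meet the generic fibre, because then `D_y^an` is empty. -/
def stratumSkeleton (y : X) : Set (AnSpace p) :=
  stratumInclusion p y '' skeleton (stratumι y ≫ p) (M.trace y)

end Berkovich

end

end LogSkel

/-! The heart of the matter is a statement about a noetherian local domain `A` with a log-regular fs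
submonoid `M` and characteristic monoid `C`. For every additive `α : C → [0, ∞]`, infinite values
allowed, let `logVal M α f` be the supremum of the `c` such that `f` lies in the ideal generated by
the elements of `M` of weight at least `c`. This is a valuation with value `α` on `M`, its support
is generated by the elements of `M` of infinite weight, and it depends continuously on `α`. It lies
below every other valuation with these values on `M`, so finite weights give exactly the points
`v_α`.

Multiplicativity is where log-regularity enters. Lifted regular parameters of `A / I` together with
`M` give monomials that generate the maximal ideal, with exponents in a lattice of rank `dim A`. For
a positive injective weight the monomial ideals form a filtration in which each step adds one
monomial. No monomial is redundant (`RegularMonomials.not_J_le`): otherwise all its multiples would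
be, the remaining exponents alone would have to account for the growth of `A / m ^ n`, and adding
back the multiples would give more exponents than the lattice contains. So every nonzero `f` has an
initial exponent, and initial exponents add under multiplication. Arbitrary weights are limits of
positive injective ones, and `tendsto_val` carries the result over.

On the geometric side, a generization `y` of `x` lies in the Kato fan if and only if its prime in
`O_x` is generated by elements of `M_x` (`mem_katoFan_iff`). Hence a point of the skeleton of `D_y`,
pulled back to `O_x`, is `logVal` for a weight that is infinite exactly on the elements of `M_x`
vanishing at `y`. By `mem_stratumSkeleton_iff`, `Sk(D_y)` thus consists of the points with kernel
`y` that are monomial, with weights in `[0, ∞]`, at some point of the fan.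

It remains to see that allowing infinite weights is the same as taking the closure. The fan is
finite, so each face can be treated separately. A weight with infinite values is a limit of finite
weights that agree with it where it is finite (`mem_closure_of_logVal`). Conversely, along an
ultrafilter of points of a face the weights converge by compactness of `[0, ∞]`, and separatedness
shows that a centre of the limit is still a generization of `x` (`specializes_of_tendsto`), so the
limit is monomial at `x` (`exists_logVal_of_mem_closure`). Its kernel is the support of a monomial
valuation, hence a point of the fan. Disjointness holds because the kernel determines the stratum.
-/

set_option linter.unusedSectionVars false

namespace LogSkel

/-! ### Lengths and a lower bound for the Hilbert-Samuel function -/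

section Length

variable {A : Type*} [CommRing A]

theorem length_quotient_anti {I J : Ideal A} (h : I ≤ J) :
    Module.length A (A ⧸ J) ≤ Module.length A (A ⧸ I) :=
  Module.length_le_of_surjective (Submodule.factor h) (Submodule.factor_surjective h)

/-- Multiplication by `x` splits the length of `A / N`. -/
theorem length_quotient_add_le {N L : Ideal A} (x : A) (h : ∀ z, x * z ∈ N → z ∈ L) :
    Module.length A (A ⧸ (N ⊔ Ideal.span {x})) + Module.length A (A ⧸ L) ≤
      Module.length A (A ⧸ N) := by
  let g : A →ₗ[A] A ⧸ N := Submodule.mkQ N ∘ₗ LinearMap.lsmul A A x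
  have hg : ∀ z, g z = Submodule.Quotient.mk (x * z) := fun z => rfl
  let R := LinearMap.range g
  rw [Module.length_eq_add_of_exact R.subtype R.mkQ R.injective_subtype R.mkQ_surjective
    (LinearMap.exact_subtype_mkQ R), add_comm]
  refine add_le_add ?_ ?_
  · have hk : LinearMap.ker g ≤ L := fun z hz => h z (by
      rw [LinearMap.mem_ker, hg, Submodule.Quotient.mk_eq_zero] at hz; exact hz)
    exact (length_quotient_anti hk).trans (g.quotKerEquivRange.length_eq).le
  · have hR : R ≤ LinearMap.ker (Submodule.factor (le_sup_left : N ≤ N ⊔ Ideal.span {x})) := by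
      rintro _ ⟨z, rfl⟩
      rw [LinearMap.mem_ker, hg]
      refine (Submodule.Quotient.mk_eq_zero _).mpr ?_
      exact Ideal.mem_sup_right (Ideal.mul_mem_right _ _ (Ideal.mem_span_singleton_self x))
    refine Module.length_le_of_surjective (R.liftQ _ hR) ?_
    rw [← LinearMap.range_eq_top, Submodule.range_liftQ, LinearMap.range_eq_top]
    exact Submodule.factor_surjective _

/-- A weak form of Artin-Rees for the ideal generated by an element outside a prime. -/
theorem exists_colon_le [IsNoetherianRing A] (I P : Ideal A) [P.IsPrime] {x : A}
    (hx : x ∉ P) : ∃ k, ∀ n z, x * z ∈ P ⊔ I ^ (n + k) → z ∈ P ⊔ I ^ n := by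
  -- Artin-Rees for the cyclic submodule generated by the class of `x` in `A ⧸ P`; primality of `P`
  -- then cancels `x`.
  obtain ⟨k, hk⟩ := I.exists_pow_inf_eq_pow_smul
    (Submodule.span A {(Submodule.Quotient.mk x : A ⧸ P)})
  refine ⟨k, fun n z hz => ?_⟩
  obtain ⟨a, ha, b, hb, hab⟩ := Submodule.mem_sup.mp hz
  have h1 : (Submodule.Quotient.mk (x * z) : A ⧸ P) ∈ I ^ (n + k) • (⊤ : Submodule A (A ⧸ P)) ⊓
      Submodule.span A {(Submodule.Quotient.mk x : A ⧸ P)} := by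
    refine ⟨?_, ?_⟩
    · rw [← hab, Submodule.Quotient.mk_add, (Submodule.Quotient.mk_eq_zero P).mpr ha, zero_add]
      have := Submodule.smul_mem_smul hb
        (Submodule.mem_top (x := (Submodule.Quotient.mk (1 : A) : A ⧸ P)))
      rwa [← Submodule.Quotient.mk_smul, smul_eq_mul, mul_one] at this
    · rw [mul_comm, ← smul_eq_mul, Submodule.Quotient.mk_smul]
      exact Submodule.smul_mem _ _ (Submodule.mem_span_singleton_self _)
  rw [hk (n + k) (Nat.le_add_left _ _), Nat.add_sub_cancel] at h1
  have h2 : (Submodule.Quotient.mk (x * z) : A ⧸ P) ∈ I ^ n • Submodule.span A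
      {(Submodule.Quotient.mk x : A ⧸ P)} :=
    Submodule.smul_mono (le_refl (I ^ n)) inf_le_right h1
  obtain ⟨m, hm, h5⟩ := Submodule.mem_smul_span_singleton.mp h2
  rw [← Submodule.Quotient.mk_smul, smul_eq_mul, mul_comm, eq_comm] at h5
  rw [Submodule.Quotient.eq, ← mul_sub] at h5
  have h6 := (Ideal.IsPrime.mem_or_mem ‹_› h5).resolve_left hx
  rw [← sub_add_cancel z m]
  exact Ideal.add_mem _ (Ideal.mem_sup_left h6) (Ideal.mem_sup_right hm)

/-- Lower bound for the Hilbert-Samuel function in terms of a chain of primes. -/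
theorem exists_choose_le_length [IsLocalRing A] [IsNoetherianRing A] (d : ℕ) :
    ∀ (I : Ideal A) (q : ℕ → PrimeSpectrum A), I ≤ (q 0).asIdeal → (∀ i < d, q i < q (i + 1)) →
    ∃ c, 0 < c ∧ ∀ c' ≥ c, ∀ k : ℕ, (k.choose d : ℕ∞) ≤
      Module.length A (A ⧸ (I ⊔ IsLocalRing.maximalIdeal A ^ (c' * (k + 1)))) := by
  induction d with
  | zero =>
    intro I q hI _
    refine ⟨1, one_pos, fun c' hc' k => ?_⟩
    rw [Nat.choose_zero_right, Nat.cast_one, Order.one_le_iff_ne_zero, ne_eq,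
      Module.length_eq_zero_iff, Submodule.Quotient.subsingleton_iff]
    refine ne_top_of_le_ne_top (IsLocalRing.maximalIdeal.isMaximal A).ne_top (sup_le ?_ ?_)
    · exact hI.trans (IsLocalRing.le_maximalIdeal (q 0).isPrime.ne_top)
    · exact Ideal.pow_le_self (by positivity)
  | succ d ih =>
    intro I q hI hq
    have hlt := hq 0 d.succ_pos
    obtain ⟨x, hx1, hx0⟩ := SetLike.exists_of_lt (show (q 0).asIdeal < (q 1).asIdeal from hlt)
    have hxI : (q 0).asIdeal ⊔ Ideal.span {x} ≤ (q 1).asIdeal :=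
      sup_le hlt.le ((Ideal.span_singleton_le_iff_mem _).mpr hx1)
    obtain ⟨c, hc, H⟩ := ih _ (fun i => q (i + 1)) hxI (fun i hi => hq (i + 1) (by omega))
    -- The bound is claimed for every `c' ≥ c` so that `c'` can also be taken past the Artin-Rees
    -- constant `k₀`; dividing by `x` then loses at most one step of size `c'`.
    obtain ⟨k₀, hk₀⟩ := exists_colon_le (IsLocalRing.maximalIdeal A) (q 0).asIdeal hx0
    refine ⟨max c k₀, lt_max_of_lt_left hc, fun c' hc' => ?_⟩
    set m := IsLocalRing.maximalIdeal A
    -- The lengths satisfy Pascal's recurrence: the quotient by `x` contributes `(k + 1).choose d`,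
    -- from the shorter chain, and the colon ideal contributes the bound already known for `k`.
    have key : ∀ k : ℕ, (((k + 1).choose (d + 1) : ℕ) : ℕ∞) ≤
        Module.length A (A ⧸ ((q 0).asIdeal ⊔ m ^ (c' * (k + 1)))) := by
      intro k
      induction k with
      | zero =>
        have := H c' ((le_max_left _ _).trans hc') 0
        refine le_trans ?_ (this.trans (length_quotient_anti (sup_le_sup_right le_sup_left _)))
        rw [Nat.choose_succ_succ]
        simp
      | succ k ihk =>
        have h1 := length_quotient_add_le (N := (q 0).asIdeal ⊔ m ^ (c' * (k + 1 + 1)))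
          (L := (q 0).asIdeal ⊔ m ^ (c' * (k + 1))) x (fun z hz => by
            refine hk₀ _ z (sup_le_sup_left (α := Ideal A) (Ideal.pow_le_pow_right ?_) _ hz)
            have := (le_max_right c k₀).trans hc'
            rw [mul_add c' (k + 1)]; omega)
        refine le_trans ?_ h1
        rw [Nat.choose_succ_succ, Nat.cast_add]
        refine add_le_add ?_ ihk
        refine (H c' ((le_max_left _ _).trans hc') (k + 1)).trans (le_of_eq ?_)
        rw [sup_right_comm]
    intro k
    refine le_trans ?_ ((key k).trans (length_quotient_anti (sup_le_sup_right hI _)))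
    exact_mod_cast Nat.choose_le_succ k (d + 1)

theorem exists_choose_le_length_of_le_ringKrullDim [IsLocalRing A] [IsNoetherianRing A] {d : ℕ}
    (hd : (d : WithBot ℕ∞) ≤ ringKrullDim A) :
    ∃ c, 0 < c ∧ ∀ c' ≥ c, ∀ k : ℕ, (k.choose d : ℕ∞) ≤
      Module.length A (A ⧸ IsLocalRing.maximalIdeal A ^ (c' * (k + 1))) := by
  obtain ⟨l, hl⟩ := Order.le_krullDim_iff.mp hd
  obtain ⟨c, hc, H⟩ := exists_choose_le_length d (⊥ : Ideal A)
    (fun i => l ⟨min i d, by omega⟩) bot_le (fun i hi => l.strictMono (by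
      rw [Fin.lt_def]; simp; omega))
  exact ⟨c, hc, fun c' h k => (H c' h k).trans (length_quotient_anti le_sup_right)⟩

/-- Adjoining one generator that is killed by the maximal ideal raises the length by at most one. -/
theorem length_quotient_le_add_one [IsLocalRing A] {I J : Ideal A} {x : A}
    (hJ : J ≤ I ⊔ Ideal.span {x})
    (hx : ∀ a ∈ IsLocalRing.maximalIdeal A, x * a ∈ I) :
    Module.length A (A ⧸ I) ≤ Module.length A (A ⧸ J) + 1 := by
  refine le_trans ?_ (add_le_add_left (length_quotient_anti hJ) 1)
  let g : A →ₗ[A] A ⧸ I := Submodule.mkQ I ∘ₗ LinearMap.lsmul A A x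
  have hg : ∀ z, g z = Submodule.Quotient.mk (x * z) := fun z => rfl
  let R := LinearMap.range g
  rw [Module.length_eq_add_of_exact R.subtype R.mkQ R.injective_subtype R.mkQ_surjective
    (LinearMap.exact_subtype_mkQ R), add_comm]
  refine add_le_add ?_ ?_
  · have hR : Function.Surjective (R.mkQ ∘ₗ Submodule.mkQ I) :=
      R.mkQ_surjective.comp (Submodule.mkQ_surjective I)
    have hker : I ⊔ Ideal.span {x} ≤ LinearMap.ker (R.mkQ ∘ₗ Submodule.mkQ I) := by
      refine sup_le (fun z hz => ?_) ((Ideal.span_singleton_le_iff_mem _).mpr ?_)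
      · rw [LinearMap.mem_ker, LinearMap.comp_apply, Submodule.mkQ_apply, Submodule.mkQ_apply,
          (Submodule.Quotient.mk_eq_zero I).mpr hz, Submodule.Quotient.mk_zero]
      · rw [LinearMap.mem_ker, LinearMap.comp_apply, Submodule.mkQ_apply, Submodule.mkQ_apply,
          Submodule.Quotient.mk_eq_zero]
        exact ⟨1, by rw [hg, mul_one]⟩
    refine Module.length_le_of_surjective (Submodule.liftQ _ _ hker) ?_
    rw [← LinearMap.range_eq_top, Submodule.range_liftQ, LinearMap.range_eq_top]
    exact hR
  · have hk : IsLocalRing.maximalIdeal A ≤ LinearMap.ker g := fun z hz => by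
      rw [LinearMap.mem_ker, hg, Submodule.Quotient.mk_eq_zero]; exact hx z hz
    refine (g.quotKerEquivRange.length_eq.symm.le).trans ((length_quotient_anti hk).trans ?_)
    have : IsSimpleModule A (A ⧸ IsLocalRing.maximalIdeal A) :=
      isSimpleModule_iff_isCoatom.mpr (IsLocalRing.maximalIdeal.isMaximal A).out
    rw [Module.length_eq_one]

end Length

end LogSkel

namespace LogSkel

/-! ### Gordan's theorem and rational spans of monoids -/

section Gordan

/-- **Gordan's theorem**: finitely many vectors without a nontrivial nonnegative relation lie in an
open half space. -/
theorem exists_functional_pos {𝕜 ι : Type*} [Field 𝕜] [LinearOrder 𝕜] [IsStrictOrderedRing 𝕜]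
    (s : Finset ι) : ∀ (V : Type u) [AddCommGroup V] [Module 𝕜 V] (v : ι → V),
    (∀ c : ι → 𝕜, (∀ i ∈ s, 0 ≤ c i) → ∑ i ∈ s, c i • v i = 0 → ∀ i ∈ s, c i = 0) →
    ∃ l : V →ₗ[𝕜] 𝕜, ∀ i ∈ s, 0 < l (v i) := by
  classical
  induction s using Finset.induction_on with
  | empty => exact fun V _ _ v _ => ⟨0, by simp⟩
  | insert i s his ih =>
    intro V _ _ v h
    have hne : ∀ {j}, j ∈ s → j ≠ i := fun hj e => his (e ▸ hj)
    have hext : ∀ (c : ι → 𝕜) (a : 𝕜), (∀ j ∈ s, 0 ≤ c j) → 0 ≤ a →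
        ∑ j ∈ s, c j • v j + a • v i = 0 → a = 0 ∧ ∀ j ∈ s, c j = 0 := by
      intro c a hc ha e
      have hs : ∀ j ∈ s, Function.update c i a j = c j := fun j hj =>
        Function.update_of_ne (hne hj) _ _
      have := h (Function.update c i a) (by
        intro j hj
        obtain rfl | hj := Finset.mem_insert.mp hj
        · simpa using ha
        · rw [hs j hj]; exact hc j hj) (by
        rw [Finset.sum_insert his, Function.update_self, Finset.sum_congr rfl
          (fun j hj => by rw [hs j hj]), add_comm, e])
      refine ⟨by simpa using this i (Finset.mem_insert_self _ _), fun j hj => ?_⟩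
      rw [← hs j hj]; exact this j (Finset.mem_insert_of_mem hj)
    -- If the other vectors stay free of nonnegative relations modulo `v i`, a functional `l`
    -- positive on their images is scaled up by `N` and corrected by some `m` with `m (v i) > 0`.
    by_cases H : ∀ c : ι → 𝕜, (∀ j ∈ s, 0 ≤ c j) →
        ∑ j ∈ s, c j • (Submodule.span 𝕜 {v i}).mkQ (v j) = 0 → ∀ j ∈ s, c j = 0
    · obtain ⟨l, hl⟩ := ih (V ⧸ Submodule.span 𝕜 {v i}) (fun j => Submodule.mkQ _ (v j)) H
      have hvi : v i ≠ 0 := fun e => one_ne_zero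
        (hext 0 1 (by simp) zero_le_one (by simp [e])).1
      obtain ⟨m, hm⟩ : ∃ m : V →ₗ[𝕜] 𝕜, m (v i) ≠ 0 := by
        by_contra! hm
        exact hvi ((Module.forall_dual_apply_eq_zero_iff 𝕜 _).mp hm)
      obtain ⟨m, hm⟩ : ∃ m : V →ₗ[𝕜] 𝕜, 0 < m (v i) := by
        obtain hm | hm := lt_or_gt_of_ne hm
        · exact ⟨-m, by simpa using hm⟩
        · exact ⟨m, hm⟩
      let N : 𝕜 := ∑ j ∈ s, |m (v j)| / l (Submodule.mkQ _ (v j)) + 1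
      refine ⟨N • (l ∘ₗ Submodule.mkQ _) + m, fun j hj => ?_⟩
      obtain rfl | hj := Finset.mem_insert.mp hj
      · have : (Submodule.span 𝕜 {v j}).mkQ (v j) = 0 :=
          (Submodule.Quotient.mk_eq_zero _).mpr (Submodule.mem_span_singleton_self _)
        rw [LinearMap.add_apply, LinearMap.smul_apply, LinearMap.comp_apply, this]
        simpa using hm
      · have h1 : |m (v j)| / l (Submodule.mkQ _ (v j)) < N := by
          refine lt_of_le_of_lt ?_ (lt_add_one _)
          exact Finset.single_le_sum
            (f := fun j => |m (v j)| / l ((Submodule.span 𝕜 {v i}).mkQ (v j)))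
            (fun k hk => div_nonneg (abs_nonneg _) (hl k hk).le) hj
        rw [div_lt_iff₀ (hl j hj)] at h1
        have h2 := neg_abs_le (m (v j))
        simp only [LinearMap.add_apply, LinearMap.smul_apply, LinearMap.comp_apply, smul_eq_mul]
        linarith
    -- Otherwise `a • v i` is a nonnegative combination of the other vectors, with `a > 0` since
    -- there is no relation in `V`. A functional positive on those vectors is then automatically
    -- positive on `v i`.
    · push Not at H
      obtain ⟨c, hc, hsum, j₀, hj₀, hcj₀⟩ := H
      obtain ⟨a, ha⟩ : ∃ a : 𝕜, a • v i = ∑ j ∈ s, c j • v j := by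
        simp_rw [← map_smul, ← map_sum] at hsum
        exact Submodule.mem_span_singleton.mp ((Submodule.Quotient.mk_eq_zero _).mp hsum)
      have hapos : 0 < a := by
        by_contra! hle
        exact hcj₀ ((hext c (-a) hc (by simpa using hle) (by rw [← ha]; simp)).2 j₀ hj₀)
      obtain ⟨l, hl⟩ := ih V v (fun c hc e => (hext c 0 hc le_rfl (by simpa using e)).2)
      refine ⟨l, fun j hj => ?_⟩
      obtain rfl | hj := Finset.mem_insert.mp hj
      · have h1 : a * l (v j) = ∑ k ∈ s, c k * l (v k) := by
          rw [← smul_eq_mul, ← map_smul, ha, map_sum]; simp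
        have h2 : 0 < ∑ k ∈ s, c k * l (v k) :=
          Finset.sum_pos' (fun k hk => mul_nonneg (hc k hk) (hl k hk).le)
            ⟨j₀, hj₀, mul_pos ((hc j₀ hj₀).lt_of_ne' hcj₀) (hl j₀ hj₀)⟩
        exact pos_of_mul_pos_right (h1 ▸ h2) hapos.le
      · exact hl j hj

/-- Clearing denominators and sorting coefficients by sign; this turns rational relations into
relations inside the monoid. -/
theorem exists_smul_eq_sub_of_mem_span {W : Type*} [AddCommGroup W] [Module ℚ W]
    (T : AddSubmonoid W) {x : W} (hx : x ∈ Submodule.span ℚ (T : Set W)) :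
    ∃ N : ℕ, 0 < N ∧ ∃ a ∈ T, ∃ b ∈ T, N • x = a - b := by
  induction hx using Submodule.span_induction with
  | mem x hx => exact ⟨1, one_pos, x, hx, 0, zero_mem _, by simp⟩
  | zero => exact ⟨1, one_pos, 0, zero_mem _, 0, zero_mem _, by simp⟩
  | add x y _ _ hx hy =>
    obtain ⟨N, hN, a, ha, b, hb, e⟩ := hx
    obtain ⟨N', hN', a', ha', b', hb', e'⟩ := hy
    refine ⟨N * N', by positivity, N' • a + N • a', add_mem (nsmul_mem ha _) (nsmul_mem ha' _),
      N' • b + N • b', add_mem (nsmul_mem hb _) (nsmul_mem hb' _), ?_⟩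
    rw [smul_add, mul_comm N N', mul_smul, e, mul_comm N' N, mul_smul, e', smul_sub, smul_sub]
    abel
  | smul r x _ hx =>
    obtain ⟨N, hN, a, ha, b, hb, e⟩ := hx
    have h1 : (r.den * N) • r • x = r.num • (a - b) := by
      rw [← e, ← Nat.cast_smul_eq_nsmul ℚ, ← Int.cast_smul_eq_zsmul ℚ, ← Nat.cast_smul_eq_nsmul ℚ,
        smul_smul, smul_smul]
      congr 1
      push_cast
      have := r.den_mul_eq_num
      linear_combination (N : ℚ) * this
    obtain ⟨n, hn | hn⟩ := r.num.eq_nat_or_neg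
    · exact ⟨r.den * N, mul_pos r.den_pos hN, n • a, nsmul_mem ha _, n • b, nsmul_mem hb _, by
        rw [h1, hn, natCast_zsmul, smul_sub]⟩
    · exact ⟨r.den * N, mul_pos r.den_pos hN, n • b, nsmul_mem hb _, n • a, nsmul_mem ha _, by
        rw [h1, hn, neg_smul, natCast_zsmul, smul_sub, neg_sub]⟩

end Gordan

/-! ### Real-valued additive functions on submonoids of lattices -/

section Monoid

variable {P κ : Type*} [AddCommMonoid P]

/-- The embedding of a monoid into a rational vector space induced by an embedding in a lattice. -/
noncomputable def rationalEmbedding (ι : P →+ (κ → ℤ)) : P →+ (κ → ℚ) :=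
  ((Int.castAddHom ℚ).compLeft κ).comp ι

theorem rationalEmbedding_injective {ι : P →+ (κ → ℤ)} (hι : Function.Injective ι) :
    Function.Injective (rationalEmbedding ι) := by
  intro p q h
  refine hι (funext fun i => ?_)
  have := congrFun h i
  simpa [rationalEmbedding] using this

/-- A face of a finitely generated submonoid of a lattice is cut out by a nonnegative additive
function. -/
theorem exists_eq_zero_iff_mem_face (hfg : AddMonoid.FG P) {ι : P →+ (κ → ℤ)}
    (hι : Function.Injective ι) (F : AddSubmonoid P) (hF : ∀ p q, p + q ∈ F → p ∈ F) :
    ∃ l : P →+ ℝ, (∀ p, 0 ≤ l p) ∧ ∀ p, l p = 0 ↔ p ∈ F := by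
  classical
  obtain ⟨S, hS⟩ := hfg.fg_top
  let T : AddSubmonoid (κ → ℚ) := F.map (rationalEmbedding ι)
  let W := Submodule.span ℚ (T : Set (κ → ℚ))
  -- Gordan is applied to the generators outside `F`, modulo the span of `F`. A nonnegative relation
  -- there, with denominators cleared by `N` and `D`, puts a sum containing a positive multiple of
  -- `p₀` into `F`, so the face property would put `p₀` into `F`.
  obtain ⟨l, hl⟩ := exists_functional_pos (𝕜 := ℚ) (S.filter (· ∉ F)) ((κ → ℚ) ⧸ W)
    (fun p => W.mkQ (rationalEmbedding ι p)) (by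
      intro c hc e p₀ hp₀
      have hmem : ∑ p ∈ S.filter (· ∉ F), c p • rationalEmbedding ι p ∈ W := by
        simp_rw [← map_smul, ← map_sum] at e
        exact (Submodule.Quotient.mk_eq_zero _).mp e
      obtain ⟨N, hN, _, ⟨a, ha, rfl⟩, _, ⟨b, hb, rfl⟩, e⟩ := exists_smul_eq_sub_of_mem_span T hmem
      let D : ℕ := ∏ p ∈ S.filter (· ∉ F), (c p).den
      have hD : 0 < D := Finset.prod_pos fun p _ => (c p).den_pos
      have hn : ∀ p ∈ S.filter (· ∉ F), ∃ n : ℕ, (n : ℚ) = D * c p := by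
        intro p hp
        obtain ⟨k, hk⟩ := Finset.dvd_prod_of_mem (fun p => (c p).den) hp
        refine ⟨k * (c p).num.toNat, ?_⟩
        have h1 : (((c p).num.toNat : ℤ) : ℚ) = (c p).num := by
          rw [Int.toNat_of_nonneg (Rat.num_nonneg.mpr (hc p hp))]
        have h2 := (c p).den_mul_eq_num
        have h3 : (D : ℚ) = (c p).den * k := by exact_mod_cast hk
        push_cast at h1 ⊢
        rw [h1, h3, ← h2]; ring
      choose! n hn using hn
      have e2 : rationalEmbedding ι (∑ p ∈ S.filter (· ∉ F), (N * n p) • p + D • b) =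
          rationalEmbedding ι (D • a) := by
        rw [map_add, map_sum, map_nsmul, map_nsmul, ← eq_sub_iff_add_eq, ← smul_sub, ← e,
          Finset.smul_sum, Finset.smul_sum]
        refine Finset.sum_congr rfl fun p hp => ?_
        rw [map_nsmul, ← Nat.cast_smul_eq_nsmul ℚ, ← Nat.cast_smul_eq_nsmul ℚ,
          ← Nat.cast_smul_eq_nsmul ℚ, smul_smul, smul_smul]
        congr 1
        push_cast
        rw [hn p hp]; ring
      have e3 := rationalEmbedding_injective hι e2
      have h4 : ∑ p ∈ S.filter (· ∉ F), (N * n p) • p ∈ F :=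
        hF _ (D • b) (e3 ▸ nsmul_mem ha D)
      rw [← Finset.add_sum_erase _ _ hp₀] at h4
      have h5 := hF _ _ h4
      by_contra hne
      have hn0 : N * n p₀ ≠ 0 := by
        refine mul_ne_zero hN.ne' fun h0 => ?_
        have := hn p₀ hp₀
        rw [h0, Nat.cast_zero, eq_comm, mul_eq_zero] at this
        exact this.elim (fun h => hD.ne' (by exact_mod_cast h)) hne
      obtain ⟨m, hm⟩ := Nat.exists_eq_succ_of_ne_zero hn0
      rw [hm, succ_nsmul'] at h5
      exact (Finset.mem_filter.mp hp₀).2 (hF _ _ h5))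
  let L : P →+ ℝ := (Rat.castHom ℝ).toAddMonoidHom.comp
    ((l ∘ₗ W.mkQ).toAddMonoidHom.comp (rationalEmbedding ι))
  have hLF : ∀ p ∈ F, L p = 0 := by
    intro p hp
    have : W.mkQ (rationalEmbedding ι p) = 0 :=
      (Submodule.Quotient.mk_eq_zero _).mpr (Submodule.subset_span ⟨p, hp, rfl⟩)
    change ((l (W.mkQ (rationalEmbedding ι p)) : ℚ) : ℝ) = 0
    rw [this]; simp
  have hLS : ∀ p ∈ S, p ∉ F → 0 < L p := fun p hp hpF => by
    have := hl p (Finset.mem_filter.mpr ⟨hp, hpF⟩)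
    change 0 < ((l (W.mkQ (rationalEmbedding ι p)) : ℚ) : ℝ)
    exact_mod_cast this
  have key : ∀ p, 0 ≤ L p ∧ (L p = 0 → p ∈ F) := by
    intro p
    have hp : p ∈ AddSubmonoid.closure (S : Set P) := hS ▸ AddSubmonoid.mem_top p
    induction hp using AddSubmonoid.closure_induction with
    | mem p hp =>
      by_cases hpF : p ∈ F
      · exact ⟨(hLF p hpF).ge, fun _ => hpF⟩
      · exact ⟨(hLS p hp hpF).le, fun h => absurd h (hLS p hp hpF).ne'⟩
    | zero => exact ⟨by simp, fun _ => zero_mem _⟩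
    | add p q _ _ hp hq =>
      refine ⟨by rw [map_add]; exact add_nonneg hp.1 hq.1, fun h => ?_⟩
      rw [map_add, add_eq_zero_iff_of_nonneg hp.1 hq.1] at h
      exact add_mem (hp.2 h.1) (hq.2 h.2)
  exact ⟨L, fun p => (key p).1, fun p => ⟨(key p).2, hLF p⟩⟩

/-- An additive real function on a submonoid of a cancellative torsion-free monoid extends. -/
theorem exists_extension {ι : P →+ (κ → ℤ)} (hι : Function.Injective ι) (F : AddSubmonoid P)
    (a : F →+ ℝ) : ∃ b : P →+ ℝ, ∀ p : F, b p = a p := by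
  -- `G` is the span of the graph of `a`. As `a` is single-valued, `ℝ` still embeds in the quotient
  -- by `G`. A retraction `r` of the quotient onto `ℝ` sends the class of `(p, 0)` to `-a p` for `p
  -- ∈ F`, hence the sign in the witness.
  let j : F →+ (κ → ℚ) × ℝ := ((rationalEmbedding ι).comp F.subtype).prod a
  let T : AddSubmonoid ((κ → ℚ) × ℝ) := AddMonoidHom.mrange j
  let G := Submodule.span ℚ (T : Set ((κ → ℚ) × ℝ))
  have hinj : Function.Injective (G.mkQ ∘ₗ LinearMap.inr ℚ (κ → ℚ) ℝ) := by
    rw [← LinearMap.ker_eq_bot, LinearMap.ker_eq_bot']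
    intro s hs
    obtain ⟨N, hN, _, ⟨x, rfl⟩, _, ⟨y, rfl⟩, e⟩ :=
      exists_smul_eq_sub_of_mem_span T ((Submodule.Quotient.mk_eq_zero _).mp hs)
    have h1 := congrArg Prod.fst e
    have h2 := congrArg Prod.snd e
    simp only [LinearMap.inr_apply, Prod.smul_fst, smul_zero, Prod.fst_sub, j,
      AddMonoidHom.prod_apply, AddMonoidHom.comp_apply] at h1
    have h3 : x = y := Subtype.ext (rationalEmbedding_injective hι (sub_eq_zero.mp h1.symm))
    simpa [h3, hN.ne'] using h2
  obtain ⟨r, hr⟩ := LinearMap.exists_leftInverse_of_injective _ (LinearMap.ker_eq_bot.mpr hinj)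
  refine ⟨-((r ∘ₗ G.mkQ ∘ₗ LinearMap.inl ℚ (κ → ℚ) ℝ).toAddMonoidHom.comp
    (rationalEmbedding ι)), fun p => ?_⟩
  have h1 : G.mkQ (rationalEmbedding ι p, a p) = 0 :=
    (Submodule.Quotient.mk_eq_zero _).mpr (Submodule.subset_span ⟨p, rfl⟩)
  have h2 := LinearMap.congr_fun hr (a p)
  have h3 : ((rationalEmbedding ι p, a p) : (κ → ℚ) × ℝ) =
      LinearMap.inl ℚ (κ → ℚ) ℝ (rationalEmbedding ι p) + LinearMap.inr ℚ (κ → ℚ) ℝ (a p) := by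
    simp
  rw [h3, map_add] at h1
  have h4 := congrArg r h1
  rw [map_add, map_zero] at h4
  simp only [LinearMap.comp_apply, LinearMap.id_apply] at h2
  rw [h2] at h4
  simp only [AddMonoidHom.neg_apply, AddMonoidHom.comp_apply, LinearMap.toAddMonoidHom_coe,
    LinearMap.comp_apply]
  linarith

/-- `ℝ` has infinite dimension over `ℚ`, so it contains a copy of the finite-dimensional space `κ →
ℚ`. -/
theorem exists_injective_real [Finite κ] {ι : P →+ (κ → ℤ)} (hι : Function.Injective ι) :
    ∃ g : P →+ ℝ, Function.Injective g := by
  have : Fintype κ := Fintype.ofFinite κ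
  obtain ⟨f, hf⟩ : ∃ f : (κ → ℚ) →ₗ[ℚ] ℝ, Function.Injective f := by
    rw [← lift_rank_le_iff_exists_linearMap, Real.rank_rat_real, rank_fun']
    simpa using (Cardinal.natCast_lt_aleph0.le.trans Cardinal.aleph0_le_continuum)
  exact ⟨f.toAddMonoidHom.comp (rationalEmbedding ι), hf.comp (rationalEmbedding_injective hι)⟩

/-- Each pair `p ≠ q` excludes a single `t`, and there are only countably many pairs. -/
theorem exists_add_mul_injective [Countable P] (u w : P →+ ℝ) (hw : Function.Injective w)
    {a b : ℝ} (hab : a < b) : ∃ t ∈ Set.Ioo a b, Function.Injective fun p => u p + t * w p := by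
  let B : Set ℝ := Set.range fun pq : P × P => -(u pq.1 - u pq.2) / (w pq.1 - w pq.2)
  have hB : B.Countable := Set.countable_range _
  obtain ⟨t, ht, htB⟩ := (hB.dense_compl ℝ).exists_mem_open isOpen_Ioo (Set.nonempty_Ioo.mpr hab)
  refine ⟨t, htB, fun p q h => ?_⟩
  by_contra hpq
  have hne : w p - w q ≠ 0 := sub_ne_zero.mpr (hw.ne hpq)
  refine ht ⟨(p, q), ?_⟩
  simp only at h ⊢
  rw [div_eq_iff hne]
  linarith

variable [Finite κ] {ι : P →+ (κ → ℤ)}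

theorem countable_of_injective (hι : Function.Injective ι) : Countable P := hι.countable

/-- A sharp finitely generated submonoid of a lattice has an injective positive real function. -/
theorem exists_injective_pos (hfg : AddMonoid.FG P) (hι : Function.Injective ι)
    (hsharp : ∀ p q : P, p + q = 0 → p = 0) :
    ∃ g : P →+ ℝ, Function.Injective g ∧ ∀ p ≠ 0, 0 < g p := by
  classical
  have := countable_of_injective hι
  obtain ⟨l, hl0, hl⟩ := exists_eq_zero_iff_mem_face hfg hι ⊥
    (fun p q h => AddSubmonoid.mem_bot.mpr (hsharp p q (AddSubmonoid.mem_bot.mp h)))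
  obtain ⟨w, hw⟩ := exists_injective_real hι
  obtain ⟨S, hS⟩ := hfg.fg_top
  have hlpos : ∀ p ≠ 0, 0 < l p := fun p hp =>
    (hl0 p).lt_of_ne' fun h => hp (AddSubmonoid.mem_bot.mp ((hl p).mp h))
  -- `ε` limits how much of `w` can be added to `l` while keeping it nonnegative on the generators.
  -- Injectivity of the perturbed function then makes it positive off `0`.
  obtain ⟨ε, hε, hεS⟩ : ∃ ε > 0, ∀ p ∈ S, ε * |w p| ≤ l p := by
    refine ⟨(1 + ∑ p ∈ S.filter (fun p => p ≠ 0), |w p| / l p)⁻¹, ?_, fun p hp => ?_⟩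
    · have : 0 ≤ ∑ p ∈ S.filter (fun p => p ≠ 0), |w p| / l p :=
        Finset.sum_nonneg fun p _ => div_nonneg (abs_nonneg _) (hl0 p)
      positivity
    · have h0 : ∀ q ∈ S.filter (fun p => p ≠ 0), 0 ≤ |w q| / l q :=
        fun q _ => div_nonneg (abs_nonneg _) (hl0 q)
      have hpos : 0 < 1 + ∑ p ∈ S.filter (fun p => p ≠ 0), |w p| / l p :=
        add_pos_of_pos_of_nonneg one_pos (Finset.sum_nonneg h0)
      rw [inv_mul_le_iff₀ hpos]
      by_cases hp0 : p = 0
      · simp [hp0]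
      · have := Finset.single_le_sum h0 (Finset.mem_filter.mpr ⟨hp, hp0⟩)
        rw [← div_le_iff₀ (hlpos p hp0)]
        linarith
  obtain ⟨t, ⟨ht0, htε⟩, hinj⟩ := exists_add_mul_injective l w hw hε
  let g : P →+ ℝ := l + (AddMonoidHom.mulLeft t).comp w
  have hg : ∀ p, g p = l p + t * w p := fun p => rfl
  have hgS : ∀ p ∈ S, 0 ≤ g p := fun p hp => by
    rw [hg]
    have h1 := hεS p hp
    have h2 := mul_le_mul_of_nonneg_right htε.le (abs_nonneg (w p))
    have h3 : t * |w p| = |t * w p| := by rw [abs_mul, abs_of_pos ht0]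
    have h4 := neg_abs_le (t * w p)
    linarith
  have hg0 : ∀ p, 0 ≤ g p := by
    intro p
    have hp : p ∈ AddSubmonoid.closure (S : Set P) := hS ▸ AddSubmonoid.mem_top p
    induction hp using AddSubmonoid.closure_induction with
    | mem p hp => exact hgS p hp
    | zero => simp
    | add p q _ _ hp hq => rw [map_add]; exact add_nonneg hp hq
  have hginj : Function.Injective g := hinj
  exact ⟨g, hginj, fun p hp => (hg0 p).lt_of_ne' fun h => hp (hginj (h.trans (map_zero g).symm))⟩

/-- A positive additive function dominates the coordinates. -/
theorem exists_coord_le (hfg : AddMonoid.FG P) (ι : P →+ (κ → ℤ)) {a : P →+ ℝ}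
    (ha : ∀ p ≠ 0, 0 < a p) : ∃ D : ℕ, ∀ p i, |(ι p i : ℝ)| ≤ D * a p := by
  have : Fintype κ := Fintype.ofFinite κ
  obtain ⟨S, hS⟩ := hfg.fg_top
  have ha0 : ∀ p, 0 ≤ a p := fun p => by
    by_cases h : p = 0
    · simp [h]
    · exact (ha p h).le
  have hb : ∀ p i, 0 ≤ |(ι p i : ℝ)| / a p := fun p i => div_nonneg (abs_nonneg _) (ha0 p)
  obtain ⟨D, hD⟩ := exists_nat_ge (∑ p ∈ S, ∑ i, |(ι p i : ℝ)| / a p)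
  refine ⟨D, fun p i => ?_⟩
  have hp : p ∈ AddSubmonoid.closure (S : Set P) := hS ▸ AddSubmonoid.mem_top p
  induction hp using AddSubmonoid.closure_induction with
  | mem p hp =>
    by_cases hp0 : p = 0
    · simp [hp0]
    · rw [← div_le_iff₀ (ha p hp0)]
      refine le_trans ?_ hD
      exact (Finset.single_le_sum (f := fun i => |(ι p i : ℝ)| / a p)
          (fun i _ => hb p i) (Finset.mem_univ i)).trans
        (Finset.single_le_sum (f := fun p => ∑ i, |(ι p i : ℝ)| / a p)
          (fun p _ => Finset.sum_nonneg fun i _ => hb p i) hp)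
  | zero => simp
  | add p q _ _ hp hq =>
    rw [map_add, map_add, Pi.add_apply, Int.cast_add, mul_add]
    exact (abs_add_le _ _).trans (add_le_add hp hq)

/-- Polynomial growth of the number of monoid elements of bounded size. -/
theorem exists_ncard_le (hfg : AddMonoid.FG P) {ι : P →+ (κ → ℤ)} (hι : Function.Injective ι)
    {a : P →+ ℝ} (ha : ∀ p ≠ 0, 0 < a p) :
    (∀ c : ℝ, {p | a p < c}.Finite) ∧
    ∃ C : ℕ, ∀ n : ℕ, 0 < n → {p | a p < n}.ncard ≤ (C * n) ^ Nat.card κ := by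
  classical
  have : Fintype κ := Fintype.ofFinite κ
  obtain ⟨D, hD⟩ := exists_coord_le hfg ι ha
  -- Weight below `n` confines the lattice point to the box with coordinates in `[-D n, D n]`.
  have key : ∀ n : ℕ, Set.MapsTo ι {p | a p < n}
      ((Fintype.piFinset fun _ : κ => Finset.Icc (-((D * n : ℕ) : ℤ)) ((D * n : ℕ) : ℤ) :
        Finset (κ → ℤ)) : Set (κ → ℤ)) := by
    intro n p hp
    rw [Finset.mem_coe, Fintype.mem_piFinset]
    intro i
    rw [Finset.mem_Icc, ← abs_le]
    have h1 := (hD p i).trans (mul_le_mul_of_nonneg_left (le_of_lt hp) (Nat.cast_nonneg D))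
    exact_mod_cast h1
  have hfin : ∀ n : ℕ, {p | a p < n}.Finite := fun n =>
    Set.Finite.of_injOn (key n) hι.injOn (Finset.finite_toSet _)
  refine ⟨fun c => ?_, 2 * D + 1, fun n hn => ?_⟩
  · obtain ⟨n, hn⟩ := exists_nat_ge c
    exact (hfin n).subset fun p hp => lt_of_lt_of_le hp hn
  · have h1 := Set.ncard_le_ncard_of_injOn ι (key n) hι.injOn (Finset.finite_toSet _)
    rw [Set.ncard_coe_finset, Fintype.card_piFinset] at h1
    refine h1.trans ?_
    rw [Finset.prod_const, Int.card_Icc, Finset.card_univ, Nat.card_eq_fintype_card]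
    refine Nat.pow_le_pow_left ?_ _
    have h2 : ((D * n : ℕ) : ℤ) + 1 - -((D * n : ℕ) : ℤ) = ((2 * (D * n) + 1 : ℕ) : ℤ) := by
      push_cast; ring
    rw [h2, Int.toNat_natCast]
    nlinarith

end Monoid

end LogSkel

namespace LogSkel

/-! ### Approximation of weights by finite and by injective ones -/

section Approximation

open Filter Topology

variable {P κ : Type*} [AddCommMonoid P] [Finite κ] {ι : P →+ (κ → ℤ)}

/-- An additive function with values in `[0, ∞]` is a limit of finite ones that agree with it
wherever it is finite. -/
theorem exists_finite_approximation (hfg : AddMonoid.FG P) (hι : Function.Injective ι)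
    (α : P →+ ℝ≥0∞) : ∃ b : ℕ → (P →+ ℝ≥0), (∀ n p, α p ≠ ⊤ → (b n p : ℝ≥0∞) = α p) ∧
      ∀ p, Tendsto (fun n => (b n p : ℝ≥0∞)) atTop (𝓝 (α p)) := by
  classical
  let F : AddSubmonoid P :=
    { carrier := {p | α p ≠ ⊤}
      zero_mem' := by simp
      add_mem' := fun {p q} hp hq => by
        rw [Set.mem_ofPred_eq, map_add]; exact ENNReal.add_ne_top.mpr ⟨hp, hq⟩ }
  have hF : ∀ p q, p + q ∈ F → p ∈ F := fun p q h =>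
    (ENNReal.add_ne_top.mp ((map_add α p q) ▸ h : α p + α q ≠ ⊤)).1
  -- The locus `F` of finite values is a face. With `e` extending `α` from `F` and `l` vanishing
  -- exactly on `F`, the approximants are `e + (N + n) l`: `N` makes them nonnegative, and off `F`
  -- they tend to infinity.
  obtain ⟨l, hl0, hl⟩ := exists_eq_zero_iff_mem_face hfg hι F hF
  let a : F →+ ℝ :=
    { toFun := fun p => (α p).toReal
      map_zero' := by simp
      map_add' := fun p q => by simp [ENNReal.toReal_add p.2 q.2] }
  obtain ⟨e, he⟩ := exists_extension hι F a
  obtain ⟨S, hS⟩ := hfg.fg_top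
  obtain ⟨N, hN⟩ : ∃ N : ℕ, ∀ p ∈ S, p ∉ F → |e p| / l p ≤ N := by
    obtain ⟨N, hN⟩ := exists_nat_ge (∑ p ∈ S, |e p| / l p)
    exact ⟨N, fun p hp _ => (Finset.single_le_sum (f := fun p => |e p| / l p)
      (fun p _ => div_nonneg (abs_nonneg _) (hl0 p)) hp).trans hN⟩
  have hpos : ∀ p, 0 ≤ e p + N * l p := by
    intro p
    have hp : p ∈ AddSubmonoid.closure (S : Set P) := hS ▸ AddSubmonoid.mem_top p
    induction hp using AddSubmonoid.closure_induction with
    | mem p hp =>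
      by_cases hpF : p ∈ F
      · rw [he ⟨p, hpF⟩, (hl p).mpr hpF, mul_zero, add_zero]; exact ENNReal.toReal_nonneg
      · have h1 := hN p hp hpF
        rw [div_le_iff₀ ((hl0 p).lt_of_ne' fun h => hpF ((hl p).mp h))] at h1
        linarith [neg_abs_le (e p)]
    | zero => simp
    | add p q _ _ hp hq => rw [map_add, map_add]; linarith
  have hpos' : ∀ (n : ℕ) p, 0 ≤ e p + N * l p + n * l p := fun n p =>
    add_nonneg (hpos p) (mul_nonneg n.cast_nonneg (hl0 p))
  let b : ℕ → (P →+ ℝ≥0) := fun n =>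
    { toFun := fun p => (e p + N * l p + n * l p).toNNReal
      map_zero' := by simp
      map_add' := fun p q => by
        rw [← Real.toNNReal_add (hpos' n p) (hpos' n q), map_add, map_add]; ring_nf }
  have hb : ∀ n p, ((b n p : ℝ≥0) : ℝ) = e p + N * l p + n * l p := fun n p =>
    Real.coe_toNNReal _ (hpos' n p)
  have hbF : ∀ n p, α p ≠ ⊤ → (b n p : ℝ≥0∞) = α p := by
    intro n p hp
    have h1 : ((b n p : ℝ≥0) : ℝ) = (α p).toReal := by
      rw [hb, (hl p).mpr hp, he ⟨p, hp⟩, mul_zero, mul_zero, add_zero, add_zero]; rfl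
    rw [← ENNReal.coe_toNNReal hp, ENNReal.coe_inj]
    exact NNReal.coe_injective h1
  refine ⟨b, hbF, fun p => ?_⟩
  by_cases hp : α p = ⊤
  · rw [hp, ENNReal.tendsto_coe_nhds_top, ← NNReal.tendsto_coe_atTop]
    simp_rw [hb]
    refine tendsto_atTop_add_const_left _ _ (Tendsto.atTop_mul_const ?_ tendsto_natCast_atTop_atTop)
    exact (hl0 p).lt_of_ne' fun h => (hl p).mp h hp
  · exact tendsto_const_nhds.congr fun n => (hbF n p hp).symm

/-- A finite additive function is a limit of injective positive ones. -/
theorem exists_injective_approximation (hfg : AddMonoid.FG P) (hι : Function.Injective ι)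
    (hsharp : ∀ p q : P, p + q = 0 → p = 0) (β : P →+ ℝ≥0) :
    ∃ g : ℕ → (P →+ ℝ), (∀ n, Function.Injective (g n) ∧ ∀ p ≠ 0, 0 < g n p) ∧
      ∀ p, Tendsto (fun n => g n p) atTop (𝓝 (β p)) := by
  obtain ⟨w, hwi, hw⟩ := exists_injective_pos hfg hι hsharp
  have := countable_of_injective hι
  let u : P →+ ℝ := NNReal.toRealHom.toAddMonoidHom.comp β
  choose t ht hti using fun n : ℕ =>
    exists_add_mul_injective u w hwi (Nat.one_div_pos_of_nat (α := ℝ) (n := n))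
  refine ⟨fun n => u + (AddMonoidHom.mulLeft (t n)).comp w, fun n => ⟨hti n, fun p hp => ?_⟩,
    fun p => ?_⟩
  · exact add_pos_of_nonneg_of_pos (β p).2 (mul_pos (ht n).1 (hw p hp))
  · have h1 : Tendsto t atTop (𝓝 0) := squeeze_zero (fun n => (ht n).1.le) (fun n => (ht n).2.le)
      tendsto_one_div_add_atTop_nhds_zero_nat
    have h2 := (h1.mul_const (w p)).const_add (u p)
    rw [zero_mul, add_zero] at h2
    exact h2

end Approximation

/-- The degrees in `n` are `r + 1` and `r`. The contradiction is found at `n = 2 m`, where `2 m - r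
≥ m` and `m > (r + 1)! (2 C) ^ r`. -/
theorem not_forall_choose_le (r C : ℕ) : ¬ ∀ n : ℕ, 0 < n → n.choose (r + 1) ≤ (C * n) ^ r := by
  intro h
  let m := (r + 1).factorial * (2 * C) ^ r + (r + 1)
  have h1 := h (2 * m) (by positivity)
  have h2 : (2 * m + 1 - (r + 1)) ^ (r + 1) ≤ (r + 1).factorial * (2 * m).choose (r + 1) := by
    have := Nat.pow_le_choose (α := ℚ) (r + 1) (2 * m)
    rw [div_le_iff₀ (by positivity)] at this
    have h3 : (2 * m + 1 - (r + 1)) ^ (r + 1) ≤ (2 * m).choose (r + 1) * (r + 1).factorial := by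
      exact_mod_cast this
    linarith
  have h3 : m ^ (r + 1) ≤ (2 * m + 1 - (r + 1)) ^ (r + 1) :=
    Nat.pow_le_pow_left (by omega) _
  have h4 : m ^ (r + 1) ≤ ((r + 1).factorial * (2 * C) ^ r) * m ^ r := by
    refine h3.trans (h2.trans ((Nat.mul_le_mul_left _ h1).trans (le_of_eq ?_)))
    rw [mul_assoc, ← mul_pow]; ring
  rw [pow_succ'] at h4
  have h5 := Nat.le_of_mul_le_mul_right h4 (by positivity)
  omega

/-- A family of principal ideals indexed by a sharp toric monoid `P` (embedded in the lattice
`κ → ℤ`), that generates the maximal ideal of a local ring of dimension at least the rank of the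
lattice. -/
structure RegularMonomials (A : Type*) [CommRing A] [IsLocalRing A] (P κ : Type*)
    [AddCommMonoid P] where
  /-- the principal ideal generated by the monomials of exponent `p` -/
  J : P → Ideal A
  J_zero : J 0 = ⊤
  J_add : ∀ p q, J (p + q) = J p * J q
  principal : ∀ p, ∃ x, J p = Ideal.span {x}
  span : ⨆ p ∈ {p : P | p ≠ 0}, J p = IsLocalRing.maximalIdeal A
  fg : AddMonoid.FG P
  sharp : ∀ p q : P, p + q = 0 → p = 0
  /-- the embedding in a lattice -/
  ι : P →+ (κ → ℤ)
  ι_injective : Function.Injective ι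
  card_le : (Nat.card κ : WithBot ℕ∞) ≤ ringKrullDim A

/-! ### Monomial ideals and independence of monomials -/

namespace RegularMonomials

variable {A : Type*} [CommRing A] [IsLocalRing A] {P κ : Type*} [AddCommMonoid P]
  (S : RegularMonomials A P κ)

/-- The ideal generated by the monomials with exponents in `E`. -/
def ideal (E : Set P) : Ideal A := ⨆ p ∈ E, S.J p

variable {S}

theorem J_le_ideal {E : Set P} {p : P} (hp : p ∈ E) : S.J p ≤ S.ideal E :=
  le_iSup₂_of_le p hp le_rfl

theorem ideal_le {E : Set P} {I : Ideal A} : S.ideal E ≤ I ↔ ∀ p ∈ E, S.J p ≤ I :=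
  iSup₂_le_iff

theorem ideal_mono {E E' : Set P} (h : E ⊆ E') : S.ideal E ≤ S.ideal E' :=
  ideal_le.mpr fun _ hp => J_le_ideal (h hp)

theorem mul_ideal_le {E E' : Set P} {I : Ideal A} (h : ∀ p ∈ E, ∀ q ∈ E', S.J (p + q) ≤ I) :
    S.ideal E * S.ideal E' ≤ I := by
  simp only [ideal, Ideal.iSup_mul, Ideal.mul_iSup, iSup_le_iff]
  intro q hq p hp
  rw [← S.J_add]
  exact h p hp q hq

theorem J_eq_ideal (p : P) : S.J p = S.ideal {p} := by simp [ideal]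

theorem span_eq : S.ideal {p : P | p ≠ 0} = IsLocalRing.maximalIdeal A := S.span

theorem J_le_maximalIdeal {p : P} (hp : p ≠ 0) : S.J p ≤ IsLocalRing.maximalIdeal A :=
  span_eq (S := S) ▸ J_le_ideal (show p ∈ {p : P | p ≠ 0} from hp)

theorem add_right_cancel' {p q r : P} (S : RegularMonomials A P κ) (h : p + r = q + r) : p = q := by
  refine S.ι_injective ?_
  have := congrArg S.ι h
  rwa [map_add, map_add, add_left_inj] at this

section Positive

variable {g : P →+ ℝ}

theorem nonneg_of_pos (hg : ∀ p ≠ 0, 0 < g p) (p : P) : 0 ≤ g p := by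
  by_cases h : p = 0
  · simp [h]
  · exact (hg p h).le

/-- The generators have bounded weight, so an exponent of large weight is a sum of many nonzero
generators, each contributing a factor of the maximal ideal. -/
theorem exists_J_le_pow (S : RegularMonomials A P κ) (hg : ∀ p ≠ 0, 0 < g p) :
    ∃ B : ℕ, 0 < B ∧ ∀ (N : ℕ) p, (B : ℝ) * N ≤ g p → S.J p ≤ IsLocalRing.maximalIdeal A ^ N := by
  obtain ⟨T, hT⟩ := S.fg.fg_top
  obtain ⟨B, hB⟩ := exists_nat_ge (∑ p ∈ T, g p)
  have key : ∀ p, ∃ n : ℕ, S.J p ≤ IsLocalRing.maximalIdeal A ^ n ∧ g p ≤ (B + 1 : ℕ) * n := by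
    intro p
    have hp : p ∈ AddSubmonoid.closure (T : Set P) := hT ▸ AddSubmonoid.mem_top p
    induction hp using AddSubmonoid.closure_induction with
    | mem p hp =>
      by_cases h : p = 0
      · exact ⟨0, by simp, by simp [h]⟩
      · refine ⟨1, by simpa using J_le_maximalIdeal h, ?_⟩
        have := (Finset.single_le_sum (f := g) (fun p _ => nonneg_of_pos hg p) hp).trans hB
        push_cast; linarith
    | zero => exact ⟨0, by simp, by simp⟩
    | add p q _ _ hp hq =>
      obtain ⟨n, hn, hn'⟩ := hp
      obtain ⟨m, hm, hm'⟩ := hq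
      refine ⟨n + m, ?_, ?_⟩
      · rw [S.J_add, pow_add]; exact Ideal.mul_mono hn hm
      · rw [map_add]; push_cast at *; linarith
  refine ⟨B + 1, B.succ_pos, fun N p h => ?_⟩
  obtain ⟨n, hn, hn'⟩ := key p
  refine hn.trans (Ideal.pow_le_pow_right ?_)
  have := le_of_mul_le_mul_left (h.trans hn') (by positivity)
  exact_mod_cast this

variable [Finite κ]

theorem finite_lt (S : RegularMonomials A P κ) (hg : ∀ p ≠ 0, 0 < g p) (c : ℝ) :
    {p | g p < c}.Finite :=
  (exists_ncard_le S.fg S.ι_injective hg).1 c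

theorem ideal_le_eq (S : RegularMonomials A P κ) (hi : Function.Injective g) (p : P) :
    S.ideal {q | g p ≤ g q} = S.ideal {q | g p < g q} ⊔ S.J p := by
  refine le_antisymm (ideal_le.mpr fun q hq => ?_) (sup_le (ideal_mono fun q (hq : g p < g q) =>
    hq.le) (J_le_ideal (Set.mem_ofPred.mpr le_rfl)))
  obtain h | h := (show g p ≤ g q from hq).lt_or_eq
  · exact le_sup_of_le_left (J_le_ideal (Set.mem_ofPred.mpr h))
  · rw [hi h]; exact le_sup_right

/-- The exponents of weight below `c` are removed one at a time, heaviest first. By injectivity each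
weight belongs to one monomial, which the maximal ideal pushes to higher weight, so each removal
costs at most one unit of length; it costs nothing for exponents in `D`. -/
theorem length_quotient_ideal_le (hi : Function.Injective g) (hg : ∀ p ≠ 0, 0 < g p) {D : Set P}
    (hD : ∀ p ∈ D, S.J p ≤ S.ideal {q | g p < g q}) (c : ℝ) :
    Module.length A (A ⧸ S.ideal {q | c ≤ g q}) ≤ {p | g p < c ∧ p ∉ D}.ncard := by
  induction hn : {p | g p < c}.ncard using Nat.strong_induction_on generalizing c with
  | _ n ih =>
  have hfin := S.finite_lt hg c
  obtain he | hne := {p | g p < c}.eq_empty_or_nonempty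
  · have h0 : S.ideal {q | c ≤ g q} = ⊤ := by
      refine top_unique (S.J_zero ▸ J_le_ideal ?_)
      by_contra h
      exact (he ▸ (Set.mem_ofPred.mpr (not_le.mp h)) : (0 : P) ∈ (∅ : Set P))
    have : Subsingleton (A ⧸ S.ideal {q | c ≤ g q}) := by
      rw [h0]; exact Ideal.Quotient.subsingleton_iff.mpr rfl
    rw [Module.length_eq_zero]; exact zero_le
  · obtain ⟨p, hp, hmax⟩ := hfin.exists_maximalFor g _ hne
    have hmax' : ∀ q, g p < g q → c ≤ g q := fun q hq => by
      by_contra! h; exact absurd (hmax h hq.le) (not_le.mpr hq)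
    have hc : {q | c ≤ g q} = {q | g p < g q} :=
      Set.ext fun q => ⟨fun h => Set.mem_ofPred.mpr (lt_of_lt_of_le (Set.mem_ofPred.mp hp) (Set.mem_ofPred.mp h)),
        hmax' q⟩
    have hss : {q | g q < g p} ⊂ {q | g q < c} :=
      ⟨fun q (hq : g q < g p) => Set.mem_ofPred.mpr (hq.trans hp), fun h => lt_irrefl (g p) (h hp)⟩
    have hI := ih _ (hn ▸ Set.ncard_lt_ncard hss hfin) (g p) rfl
    have hsub : {q | g q < g p ∧ q ∉ D} ⊆ {q | g q < c ∧ q ∉ D} := fun q hq =>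
      ⟨hq.1.trans hp, hq.2⟩
    have hfin' : {q | g q < c ∧ q ∉ D}.Finite := hfin.subset fun q hq => hq.1
    rw [ideal_le_eq S hi] at hI
    rw [hc]
    by_cases hpD : p ∈ D
    · rw [sup_eq_left.mpr (hD p hpD)] at hI
      exact hI.trans (by exact_mod_cast Set.ncard_le_ncard hsub hfin')
    · obtain ⟨x, hx⟩ := S.principal p
      have h1 := length_quotient_le_add_one (I := S.ideal {q | g p < g q})
        (J := S.ideal {q | g p < g q} ⊔ S.J p) (x := x) (by rw [hx]) (by
          intro a ha
          rw [← span_eq (S := S)] at ha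
          have hx' : x ∈ S.ideal {p} := by
            rw [← J_eq_ideal, hx]; exact Ideal.mem_span_singleton_self x
          refine mul_ideal_le ?_ (Ideal.mul_mem_mul hx' ha)
          rintro _ rfl q hq
          refine J_le_ideal ?_
          rw [Set.mem_ofPred_eq, map_add]
          linarith [hg q hq])
      refine h1.trans ((add_le_add_left hI 1).trans ?_)
      have hnot : p ∉ {q | g q < g p ∧ q ∉ D} := fun h => lt_irrefl _ h.1
      have h2 := Set.ncard_insert_of_notMem hnot (hfin'.subset hsub)
      have h3 : insert p {q | g q < g p ∧ q ∉ D} ⊆ {q | g q < c ∧ q ∉ D} :=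
        Set.insert_subset ⟨hp, hpD⟩ hsub
      have h4 := Set.ncard_le_ncard h3 hfin'
      rw [h2] at h4
      exact_mod_cast h4

/-- Independence of monomials: this is where the dimension enters. -/
theorem not_J_le [IsNoetherianRing A] (S : RegularMonomials A P κ) (hi : Function.Injective g)
    (hg : ∀ p ≠ 0, 0 < g p) (p₀ : P) : ¬ S.J p₀ ≤ S.ideal {q | g p₀ < g q} := by
  intro h
  -- Redundancy of the monomial `p₀` propagates to all its multiples.
  let D : Set P := Set.range (· + p₀)
  have hD : ∀ p ∈ D, S.J p ≤ S.ideal {q | g p < g q} := by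
    rintro _ ⟨p, rfl⟩
    simp only [S.J_add]
    refine (Ideal.mul_mono (J_eq_ideal p).le h).trans (mul_ideal_le ?_)
    rintro _ rfl q hq
    refine J_le_ideal ?_
    simp only [Set.mem_ofPred_eq, map_add] at hq ⊢
    linarith
  obtain ⟨B, hB, hBJ⟩ := S.exists_J_le_pow hg
  obtain ⟨c, hc, H⟩ := exists_choose_le_length_of_le_ringKrullDim S.card_le
  obtain ⟨e, he⟩ := exists_nat_ge (g p₀)
  obtain ⟨C, hC⟩ := (exists_ncard_le S.fg S.ι_injective hg).2
  -- `B` converts weights into powers of the maximal ideal, `c` is the Hilbert-Samuel constant, and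
  -- `e ≥ g p₀` ensures that translation by `p₀` raises weights by at most `R`.
  let R : ℕ := B * (c + e)
  have hR : 0 < R := Nat.mul_pos hB (by omega)
  have heR : g p₀ ≤ R := he.trans (by exact_mod_cast (show e ≤ R by
    calc e ≤ 1 * (c + e) := by omega
      _ ≤ R := Nat.mul_le_mul_right _ hB))
  let N : ℕ → ℕ := fun k => {p | g p < ((R * k : ℕ) : ℝ)}.ncard
  -- Two disjoint families of exponents of weight below `R (k + 1)`: those outside `D`, whose number
  -- bounds a length from above, and the `p₀`-translates of those of weight below `R k`.
  have step : ∀ k : ℕ, k.choose (Nat.card κ) + N k ≤ N (k + 1) := by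
    intro k
    have h1 : k.choose (Nat.card κ) ≤ {p | g p < ((R * (k + 1) : ℕ) : ℝ) ∧ p ∉ D}.ncard := by
      have h2 := (H (c + e) (by omega) k).trans ((length_quotient_anti (I :=
        S.ideal {q | ((R * (k + 1) : ℕ) : ℝ) ≤ g q}) (ideal_le.mpr fun p hp => hBJ _ p (by
          refine le_trans (le_of_eq ?_) hp
          simp only [R]; push_cast; ring))).trans
        (length_quotient_ideal_le hi hg hD _))
      exact_mod_cast h2
    have h3 : Set.InjOn (· + p₀) {p | g p < ((R * k : ℕ) : ℝ)} := fun p _ q _ h =>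
      S.add_right_cancel' h
    have hfin := S.finite_lt hg ((R * (k + 1) : ℕ) : ℝ)
    have h4 : N k = ((· + p₀) '' {p | g p < ((R * k : ℕ) : ℝ)}).ncard :=
      h3.ncard_image.symm
    have hsub1 : (· + p₀) '' {p | g p < ((R * k : ℕ) : ℝ)} ⊆
        {p | g p < ((R * (k + 1) : ℕ) : ℝ)} := by
      rintro _ ⟨p, hp, rfl⟩
      simp only [Set.mem_ofPred_eq, map_add] at hp ⊢
      push_cast at hp ⊢
      linarith
    have hdisj : Disjoint {p | g p < ((R * (k + 1) : ℕ) : ℝ) ∧ p ∉ D}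
        ((· + p₀) '' {p | g p < ((R * k : ℕ) : ℝ)}) := by
      rw [Set.disjoint_left]
      rintro _ ⟨_, h⟩ ⟨p, _, rfl⟩
      exact h ⟨p, rfl⟩
    have hsub2 : {p | g p < ((R * (k + 1) : ℕ) : ℝ) ∧ p ∉ D} ⊆
        {p | g p < ((R * (k + 1) : ℕ) : ℝ)} := fun p hp => hp.1
    have h5 := Set.ncard_union_eq hdisj (hfin.subset hsub2) (hfin.subset hsub1)
    have h6 := Set.ncard_le_ncard (Set.union_subset hsub2 hsub1) hfin
    rw [h5] at h6
    rw [h4]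
    exact (Nat.add_le_add_right h1 _).trans h6
  -- Summation over `k` gives growth of degree one more than the rank of the lattice permits.
  have total : ∀ n : ℕ, n.choose (Nat.card κ + 1) ≤ N n := by
    intro n
    induction n with
    | zero => simp
    | succ n ih =>
      rw [Nat.choose_succ_succ]
      exact (Nat.add_le_add_left ih _).trans (step n)
  exact not_forall_choose_le (Nat.card κ) (C * R) fun n hn => (total n).trans (by
    rw [mul_assoc]; exact hC (R * n) (Nat.mul_pos hR hn))

end Positive

end RegularMonomials

end LogSkel

namespace LogSkel

/-! ### Monomial valuations -/

namespace RegularMonomials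

open Filter Topology

variable {A : Type*} [CommRing A] [IsLocalRing A] {P κ : Type*} [AddCommMonoid P]

/-- The monomial valuation with weights `α`: the supremum of all `c` such that `f` lies in the ideal
generated by the monomials of weight at least `c`. -/
noncomputable def val (S : RegularMonomials A P κ) (α : P →+ ℝ≥0∞) (f : A) : ℝ≥0∞ :=
  sSup {c | f ∈ S.ideal {p | c ≤ α p}}

variable {S : RegularMonomials A P κ} {α : P →+ ℝ≥0∞}

theorem le_val {f : A} {c : ℝ≥0∞} (h : f ∈ S.ideal {p | c ≤ α p}) : c ≤ S.val α f :=
  le_sSup h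

theorem mem_ideal_of_lt_val {f : A} {c : ℝ≥0∞} (h : c < S.val α f) :
    ∃ c' > c, f ∈ S.ideal {p | c' ≤ α p} := by
  obtain ⟨c', h1, h2⟩ := lt_sSup_iff.mp h
  exact ⟨c', h2, h1⟩

theorem min_val_le (f h : A) : min (S.val α f) (S.val α h) ≤ S.val α (f + h) := by
  refine le_of_forall_lt fun c hc => ?_
  obtain ⟨c₁, h1, hf⟩ := mem_ideal_of_lt_val (lt_of_lt_of_le hc (min_le_left _ _))
  obtain ⟨c₂, h2, hh⟩ := mem_ideal_of_lt_val (lt_of_lt_of_le hc (min_le_right _ _))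
  refine (lt_min h1 h2).trans_le (le_val (add_mem ?_ ?_))
  · exact ideal_mono (fun p (hp : c₁ ≤ α p) => (min_le_left c₁ c₂).trans hp) hf
  · exact ideal_mono (fun p (hp : c₂ ≤ α p) => (min_le_right c₁ c₂).trans hp) hh

theorem val_zero : S.val α 0 = ⊤ := top_unique (le_val (zero_mem _))

/-- The exponents whose monomials are not in a given power of the maximal ideal. -/
theorem finite_not_le_pow [Finite κ] (S : RegularMonomials A P κ) (N : ℕ) :
    {p | ¬ S.J p ≤ IsLocalRing.maximalIdeal A ^ N}.Finite := by
  obtain ⟨g, -, hg⟩ := exists_injective_pos S.fg S.ι_injective S.sharp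
  obtain ⟨B, -, hB⟩ := S.exists_J_le_pow hg
  refine (S.finite_lt hg (B * N)).subset fun p hp => ?_
  by_contra h
  exact hp (hB N p (not_lt.mp h))

/-- Krull's intersection theorem in `A ⧸ I`. Modulo a power of the maximal ideal only finitely many
exponents matter, which is what makes the limit arguments below work. -/
theorem exists_notMem_sup_pow [IsNoetherianRing A] {I : Ideal A} {f : A} (hf : f ∉ I) :
    ∃ N, f ∉ I ⊔ IsLocalRing.maximalIdeal A ^ N := by
  by_contra! h
  have h1 : (Submodule.Quotient.mk f : A ⧸ I) ∈
      (⨅ i : ℕ, IsLocalRing.maximalIdeal A ^ i • ⊤ : Submodule A (A ⧸ I)) := by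
    rw [Submodule.mem_iInf]
    intro N
    obtain ⟨a, ha, b, hb, rfl⟩ := Submodule.mem_sup.mp (h N)
    rw [Submodule.Quotient.mk_add, (Submodule.Quotient.mk_eq_zero I).mpr ha, zero_add]
    have := Submodule.smul_mem_smul hb
      (Submodule.mem_top (x := (Submodule.Quotient.mk (1 : A) : A ⧸ I)))
    rwa [← Submodule.Quotient.mk_smul, smul_eq_mul, mul_one] at this
  rw [Ideal.iInf_pow_smul_eq_bot_of_isLocalRing _
    (IsLocalRing.maximalIdeal.isMaximal A).ne_top, Submodule.mem_bot,
    Submodule.Quotient.mk_eq_zero] at h1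
  exact hf h1

theorem exists_finset_of_mem_ideal {E : Set P} {f : A} (hf : f ∈ S.ideal E) :
    ∃ T : Finset P, (T : Set P) ⊆ E ∧ f ∈ S.ideal (T : Set P) := by
  classical
  rw [ideal, iSup_subtype'] at hf
  obtain ⟨s, hs⟩ := Submodule.mem_iSup_iff_exists_finset.mp hf
  refine ⟨s.image Subtype.val, by simp, ?_⟩
  refine (iSup₂_le fun i hi => J_le_ideal ?_ : _ ≤ S.ideal _) hs
  simp only [Finset.coe_image]
  exact ⟨i, hi, rfl⟩

variable [IsNoetherianRing A] [Finite κ]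

/-- The monomial valuation of a given element depends continuously on the weights. -/
theorem tendsto_val {ι' : Type*} {l : Filter ι'} {a : ι' → (P →+ ℝ≥0∞)}
    (h : ∀ p, Tendsto (fun i => a i p) l (𝓝 (α p))) (f : A) :
    Tendsto (fun i => S.val (a i) f) l (𝓝 (S.val α f)) := by
  refine tendsto_order.mpr ⟨fun c hc => ?_, fun c hc => ?_⟩
  -- Lower bound: membership in a monomial ideal involves finitely many exponents, whose weights
  -- stay above `b`.
  · obtain ⟨c', hcc', hf⟩ := mem_ideal_of_lt_val hc
    obtain ⟨b, hcb, hbc⟩ := exists_between hcc'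
    obtain ⟨T, hT, hfT⟩ := exists_finset_of_mem_ideal hf
    have hev : ∀ᶠ i in l, ∀ p ∈ T, b < a i p := (Finset.eventually_all T).mpr fun p hp =>
      (tendsto_order.mp (h p)).1 b (hbc.trans_le (hT hp))
    filter_upwards [hev] with i hi
    exact hcb.trans_le (le_val (ideal_mono (fun p hp => Set.mem_ofPred.mpr (hi p hp).le) hfT))
  -- Upper bound: `f` is outside the ideal of weight at least `b` even modulo some `m ^ N`. Only
  -- finitely many exponents survive modulo `m ^ N`, and among them those of weight below `b` keep
  -- weight below `b'`.
  · obtain ⟨b, hb, hbc⟩ := exists_between hc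
    obtain ⟨b', hbb', hb'c⟩ := exists_between hbc
    obtain ⟨N, hN⟩ := exists_notMem_sup_pow (fun hf => not_le.mpr hb (le_val hf))
    have hev : ∀ᶠ i in l, ∀ p ∈ {p | ¬ S.J p ≤ IsLocalRing.maximalIdeal A ^ N},
        α p < b → a i p < b' :=
      (S.finite_not_le_pow N).eventually_all.mpr fun p _ => by
        by_cases hp : α p < b
        · filter_upwards [(tendsto_order.mp (h p)).2 b' (hp.trans hbb')] with i hi _ using hi
        · exact Eventually.of_forall fun i h => absurd h hp
    filter_upwards [hev] with i hi
    refine lt_of_le_of_lt (sSup_le fun d hd => ?_) hb'c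
    by_contra! hlt
    refine hN ((ideal_le.mpr fun p hp => ?_ : S.ideal {p | d ≤ a i p} ≤ _) hd)
    by_cases hpN : S.J p ≤ IsLocalRing.maximalIdeal A ^ N
    · exact le_sup_of_le_right hpN
    · refine le_sup_of_le_left (J_le_ideal (Set.mem_ofPred.mpr ?_))
      by_contra! hpb
      exact absurd (hi p hpN hpb) (not_lt.mpr (hlt.le.trans hp))

theorem val_eq_top_iff {f : A} : S.val α f = ⊤ ↔ f ∈ S.ideal {p | α p = ⊤} := by
  refine ⟨fun h => ?_, fun h => top_unique (le_val (ideal_mono (fun p hp => ?_) h))⟩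
  · by_contra hf
    obtain ⟨N, hN⟩ := exists_notMem_sup_pow hf
    let T := (S.finite_not_le_pow N).toFinset
    have hT : ∀ p, ¬ S.J p ≤ IsLocalRing.maximalIdeal A ^ N → p ∈ T := fun p hp =>
      (Set.Finite.mem_toFinset _).mpr hp
    classical
    -- The sum serves as a common finite upper bound: an exponent of larger weight has infinite
    -- weight or a monomial in `m ^ N`.
    let c : ℝ≥0∞ := ∑ p ∈ T.filter (fun p => α p ≠ ⊤), α p
    have hc : c < S.val α f := by
      rw [h]
      exact (ENNReal.sum_ne_top.mpr fun p hp => (Finset.mem_filter.mp hp).2).lt_top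
    obtain ⟨c', hc', hf'⟩ := mem_ideal_of_lt_val hc
    refine hN ((ideal_le.mpr fun p hp => ?_ : S.ideal {p | c' ≤ α p} ≤ _) hf')
    by_cases hpN : S.J p ≤ IsLocalRing.maximalIdeal A ^ N
    · exact le_sup_of_le_right hpN
    · refine le_sup_of_le_left (J_le_ideal (Set.mem_ofPred.mpr ?_))
      by_contra hpt
      have hpT : p ∈ T.filter (fun p => α p ≠ ⊤) := Finset.mem_filter.mpr ⟨hT p hpN, hpt⟩
      have := Finset.single_le_sum (f := α) (fun p _ => zero_le) hpT
      exact absurd (hc'.trans_le ((Set.mem_ofPred.mp hp).trans this)) (lt_irrefl _)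
  · exact Set.mem_ofPred.mpr (Set.mem_ofPred.mp hp).ge

section Positive

variable {g : P →+ ℝ}

/-- `f` has initial exponent `p` with respect to `g`. -/
def IsInitial (S : RegularMonomials A P κ) (g : P →+ ℝ) (f : A) (p : P) : Prop :=
  f ∈ S.ideal {q | g p ≤ g q} ∧ f ∉ S.ideal {q | g p < g q}

/-- Since `f ∉ m ^ N` for some `N`, and weights are discrete, there is a largest weight whose ideal
contains `f`. If no larger weight exists at all, the strict ideal is zero. -/
theorem exists_isInitial (hg : ∀ p ≠ 0, 0 < g p) {f : A}
    (hf : f ≠ 0) : ∃ p, S.IsInitial g f p := by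
  obtain ⟨N, hN⟩ := exists_notMem_sup_pow (I := (⊥ : Ideal A)) (f := f) (by simpa using hf)
  rw [bot_sup_eq] at hN
  let X : Set P := {p | f ∈ S.ideal {q | g p ≤ g q}}
  have hXT : ∀ p ∈ X, ∃ q ∈ {q | ¬ S.J q ≤ IsLocalRing.maximalIdeal A ^ N}, g p ≤ g q := by
    intro p hp
    by_contra! h
    refine hN ((ideal_le.mpr fun q hq => ?_ : S.ideal {q | g p ≤ g q} ≤ _) hp)
    by_contra hq'
    exact absurd (h q hq') (not_lt.mpr hq)
  obtain ⟨b, hb⟩ := ((S.finite_not_le_pow N).image g).bddAbove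
  have hX : X.Finite := (S.finite_lt hg (b + 1)).subset fun p hp => by
    obtain ⟨q, hq, hpq⟩ := hXT p hp
    have := hb ⟨q, hq, rfl⟩
    exact Set.mem_ofPred.mpr (by linarith)
  have h0 : (0 : P) ∈ X := by
    refine Set.mem_ofPred.mpr ((J_le_ideal (S := S) (p := 0) ?_) ?_)
    · exact Set.mem_ofPred.mpr le_rfl
    · rw [S.J_zero]; trivial
  obtain ⟨p, hp, hmax⟩ := hX.exists_maximalFor g _ ⟨0, h0⟩
  refine ⟨p, hp, fun hf' => ?_⟩
  obtain he | ⟨q₀, hq₀⟩ := {q | g p < g q}.eq_empty_or_nonempty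
  · rw [he] at hf'
    simp only [ideal, Set.mem_empty_iff_false, iSup_false, iSup_bot, Submodule.mem_bot] at hf'
    exact hf hf'
  · have hfin : {q | g p < g q ∧ g q < g q₀ + 1}.Finite :=
      (S.finite_lt hg (g q₀ + 1)).subset fun q hq => (Set.mem_ofPred.mp hq).2
    obtain ⟨q, hq, hmin⟩ := hfin.exists_minimalFor g _
      ⟨q₀, Set.mem_ofPred.mpr ⟨hq₀, lt_add_one _⟩⟩
    have hq1 := (Set.mem_ofPred.mp hq).1
    have hqX : q ∈ X := by
      refine Set.mem_ofPred.mpr (ideal_mono (fun q' hq' => Set.mem_ofPred.mpr ?_) hf')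
      by_contra! hlt
      have := hmin (Set.mem_ofPred.mpr ⟨hq', hlt.trans (Set.mem_ofPred.mp hq).2⟩) hlt.le
      linarith
    have := hmax hqX hq1.le
    linarith

-- By injectivity a single monomial carries the initial weight; were its coefficient in the maximal
-- ideal, that term would have larger weight.
omit [IsNoetherianRing A] in
theorem IsInitial.exists_eq (hi : Function.Injective g) (hg : ∀ p ≠ 0, 0 < g p) {f : A} {p : P}
    (h : S.IsInitial g f p) {x : A} (hx : S.J p = Ideal.span {x}) :
    ∃ u, IsUnit u ∧ ∃ r ∈ S.ideal {q | g p < g q}, f = u * x + r := by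
  have h1 := h.1
  rw [ideal_le_eq S hi, hx, sup_comm] at h1
  obtain ⟨y, hy, r, hr, hf⟩ := Submodule.mem_sup.mp h1
  obtain ⟨u, rfl⟩ := Ideal.mem_span_singleton'.mp hy
  refine ⟨u, ?_, r, hr, hf.symm⟩
  by_contra hu
  refine h.2 (hf ▸ add_mem ?_ hr)
  have hu' : u ∈ S.ideal {p : P | p ≠ 0} := by
    rw [span_eq]; exact (IsLocalRing.mem_maximalIdeal u).mpr hu
  have hx' : x ∈ S.ideal {p} := by
    rw [← J_eq_ideal, hx]; exact Ideal.mem_span_singleton_self x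
  refine mul_ideal_le ?_ (Ideal.mul_mem_mul hu' hx')
  rintro q hq _ rfl
  refine J_le_ideal (Set.mem_ofPred.mpr ?_)
  rw [map_add]
  linarith [hg q hq]

/-- The product of the two initial terms is a unit times a monomial, which `not_J_le` keeps out of
the ideal of larger weight; all other terms lie in it. -/
theorem IsInitial.mul (hi : Function.Injective g) (hg : ∀ p ≠ 0, 0 < g p) {f h : A} {p q : P}
    (hf : S.IsInitial g f p) (hh : S.IsInitial g h q) : S.IsInitial g (f * h) (p + q) := by
  refine ⟨mul_ideal_le (fun p' hp' q' hq' => J_le_ideal (Set.mem_ofPred.mpr ?_))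
    (Ideal.mul_mem_mul hf.1 hh.1), fun hmem => ?_⟩
  · rw [map_add, map_add]; exact add_le_add hp' hq'
  · obtain ⟨x, hx⟩ := S.principal p
    obtain ⟨y, hy⟩ := S.principal q
    obtain ⟨u, hu, r, hr, ef⟩ := hf.exists_eq hi hg hx
    obtain ⟨v, hv, s, hs, eh⟩ := hh.exists_eq hi hg hy
    have hxm : u * x ∈ S.ideal {p} := by
      rw [← J_eq_ideal, hx]; exact Ideal.mul_mem_left _ _ (Ideal.mem_span_singleton_self x)
    have h1 : (u * x) * s ∈ S.ideal {q' | g (p + q) < g q'} := by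
      refine mul_ideal_le ?_ (Ideal.mul_mem_mul hxm hs)
      rintro _ rfl q' hq'
      refine J_le_ideal (Set.mem_ofPred.mpr ?_)
      rw [map_add, map_add]
      linarith [Set.mem_ofPred.mp hq']
    have h2 : r * h ∈ S.ideal {q' | g (p + q) < g q'} := by
      refine mul_ideal_le ?_ (Ideal.mul_mem_mul hr hh.1)
      rintro p' hp' q' hq'
      refine J_le_ideal (Set.mem_ofPred.mpr ?_)
      rw [map_add, map_add]
      linarith [Set.mem_ofPred.mp hq', Set.mem_ofPred.mp hp']
    have h3 : (u * v) * (x * y) ∈ S.ideal {q' | g (p + q) < g q'} := by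
      have e : (u * v) * (x * y) = f * h - (r * h + (u * x) * s) := by
        rw [show f * h = (u * x) * h + r * h by rw [ef]; ring]
        rw [show (u * x) * h = (u * x) * (v * y + s) by rw [← eh]]
        ring
      rw [e]
      exact sub_mem hmem (add_mem h2 h1)
    refine S.not_J_le hi hg (p + q) ?_
    rw [S.J_add, hx, hy, Ideal.span_singleton_mul_span_singleton,
      Ideal.span_singleton_le_iff_mem]
    exact (Ideal.unit_mul_mem_iff_mem _ (hu.mul hv)).mp h3

omit [IsNoetherianRing A] [Finite κ] in
theorem IsInitial.val_eq (hg : ∀ p ≠ 0, 0 < g p) (hα : ∀ p, α p = ENNReal.ofReal (g p))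
    {f : A} {p : P} (h : S.IsInitial g f p) : S.val α f = α p := by
  have h0 := nonneg_of_pos hg
  refine le_antisymm (sSup_le fun c hc => ?_) (le_val (ideal_mono (fun q hq => ?_) h.1))
  · by_contra! hlt
    refine h.2 (ideal_mono (fun q hq => Set.mem_ofPred.mpr ?_) hc)
    have := hlt.trans_le (Set.mem_ofPred.mp hq)
    rw [hα, hα] at this
    exact (ENNReal.ofReal_lt_ofReal_iff').mp this |>.1
  · rw [Set.mem_ofPred_eq, hα, hα]; exact ENNReal.ofReal_le_ofReal hq

end Positive

/-- The monomial valuation with weights `α` is multiplicative and has the value `α p` on monomials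
of exponent `p`. -/
def IsMultiplicative (S : RegularMonomials A P κ) (α : P →+ ℝ≥0∞) : Prop :=
  (∀ f h, S.val α (f * h) = S.val α f + S.val α h) ∧
    ∀ p x, S.J p = Ideal.span {x} → S.val α x = α p

theorem isMultiplicative_of_injective {g : P →+ ℝ} (hi : Function.Injective g)
    (hg : ∀ p ≠ 0, 0 < g p) (hα : ∀ p, α p = ENNReal.ofReal (g p)) : S.IsMultiplicative α := by
  refine ⟨fun f h => ?_, fun p x hx => ?_⟩
  · by_cases hf : f = 0
    · rw [hf, zero_mul, val_zero, top_add]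
    by_cases hh : h = 0
    · rw [hh, mul_zero, val_zero, add_top]
    obtain ⟨p, hp⟩ := exists_isInitial (S := S) hg hf
    obtain ⟨q, hq⟩ := exists_isInitial (S := S) hg hh
    rw [hp.val_eq hg hα, hq.val_eq hg hα, (hp.mul hi hg hq).val_eq hg hα, map_add]
  · refine IsInitial.val_eq hg hα ⟨?_, fun h => S.not_J_le hi hg p ?_⟩
    · have hp : p ∈ {q | g p ≤ g q} := Set.mem_ofPred.mpr le_rfl
      exact J_le_ideal hp (hx ▸ Ideal.mem_span_singleton_self x)
    · rwa [hx, Ideal.span_singleton_le_iff_mem]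

theorem IsMultiplicative.of_tendsto {a : ℕ → (P →+ ℝ≥0∞)} (ha : ∀ n, S.IsMultiplicative (a n))
    (h : ∀ p, Tendsto (fun n => a n p) atTop (𝓝 (α p))) : S.IsMultiplicative α := by
  refine ⟨fun f k => ?_, fun p x hx => ?_⟩
  · refine tendsto_nhds_unique (tendsto_val h (f * k)) ?_
    simp_rw [(ha _).1]
    exact (tendsto_val h f).add (tendsto_val h k)
  · refine tendsto_nhds_unique (tendsto_val h x) ?_
    simp_rw [(ha _).2 p x hx]
    exact h p

/-- Two limits: from positive injective weights to finite ones, and from finite weights to weights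
in `[0, ∞]`. -/
theorem isMultiplicative (S : RegularMonomials A P κ) (α : P →+ ℝ≥0∞) : S.IsMultiplicative α := by
  have key : ∀ β : P →+ ℝ≥0, S.IsMultiplicative (ENNReal.ofNNRealHom.toAddMonoidHom.comp β) := by
    intro β
    obtain ⟨g, hg, hlim⟩ := exists_injective_approximation S.fg S.ι_injective S.sharp β
    have h0 : ∀ n p, 0 ≤ g n p := fun n => nonneg_of_pos (hg n).2
    let a : ℕ → (P →+ ℝ≥0∞) := fun n =>
      { toFun := fun p => ENNReal.ofReal (g n p)
        map_zero' := by simp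
        map_add' := fun p q => by rw [map_add, ENNReal.ofReal_add (h0 n p) (h0 n q)] }
    refine IsMultiplicative.of_tendsto (a := a)
      (fun n => isMultiplicative_of_injective (hg n).1 (hg n).2 fun p => rfl) fun p => ?_
    have := (ENNReal.continuous_ofReal.tendsto _).comp (hlim p)
    rw [ENNReal.ofReal_coe_nnreal] at this
    exact this
  obtain ⟨b, -, hb⟩ := exists_finite_approximation S.fg S.ι_injective α
  exact IsMultiplicative.of_tendsto (fun n => key (b n)) hb

end RegularMonomials

end LogSkel

namespace LogSkel

/-! ### Monomial valuations on log-regular local rings -/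

section LogRegularMonoid

open Filter Topology

variable {A : Type*} [CommRing A] [IsLocalRing A]

/-- A log-regular submonoid of a local ring with fine and saturated characteristic monoid. -/
structure IsLogRegularSubmonoid (M : Submonoid A) : Prop where
  isUnit_mem : ∀ {f : A}, IsUnit f → f ∈ M
  zero_notMem : (0 : A) ∉ M
  fg : Monoid.FG (Associates M)
  saturated : ∀ (a b : Associates M) (n : ℕ), 0 < n → b ^ n ∣ a ^ n → b ∣ a
  regular : IsRegularLocalRing (A ⧸ Ideal.span {f | f ∈ M ∧ ¬ IsUnit f})
  dim_eq : ringKrullDim A = ringKrullDim (A ⧸ Ideal.span {f | f ∈ M ∧ ¬ IsUnit f}) +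
    (Module.finrank ℤ (Additive (Algebra.GrothendieckGroup (Associates M))) : ℕ)

variable {M : Submonoid A}

/-- The exponent of an element of `M`. -/
def exponent (m : M) : Additive (Associates M) := Additive.ofMul (Associates.mk m)

theorem exponent_mul (m n : M) : exponent (m * n) = exponent m + exponent n := rfl

theorem exponent_one : exponent (1 : M) = 0 := rfl

theorem exists_exponent_eq (p : Additive (Associates M)) : ∃ m : M, exponent m = p :=
  Associates.mk_surjective p.toMul

theorem span_eq_of_exponent_eq {m n : M} (h : exponent m = exponent n) :
    Ideal.span {(m : A)} = Ideal.span {(n : A)} := by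
  obtain ⟨u, rfl⟩ := Associates.mk_eq_mk_iff_associated.mp h
  exact (Ideal.span_singleton_mul_right_unit (u.isUnit.map M.subtype) (m : A)).symm

namespace IsLogRegularSubmonoid

variable (hM : IsLogRegularSubmonoid M)
include hM

theorem isUnit_iff {m : M} : IsUnit m ↔ IsUnit (m : A) := by
  refine ⟨fun h => h.map M.subtype, fun h => ?_⟩
  obtain ⟨u, hu⟩ := h
  have hm := hM.isUnit_mem u⁻¹.isUnit
  exact IsUnit.of_mul_eq_one (⟨_, hm⟩ : M) (Subtype.ext (by
    rw [Submonoid.coe_mul, ← hu, Units.mul_inv]; rfl))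

theorem exponent_eq_zero_iff {m : M} : exponent m = 0 ↔ IsUnit (m : A) := by
  rw [← hM.isUnit_iff]; exact Associates.mk_eq_one

theorem sharp (p q : Additive (Associates M)) (h : p + q = 0) : p = 0 := by
  obtain ⟨m, rfl⟩ := exists_exponent_eq p
  obtain ⟨n, rfl⟩ := exists_exponent_eq q
  rw [← exponent_mul, hM.exponent_eq_zero_iff, Submonoid.coe_mul] at h
  rw [hM.exponent_eq_zero_iff]
  exact isUnit_of_mul_isUnit_left h

variable [IsDomain A]

theorem isCancelMul : IsCancelMul (Associates M) := by
  have : IsLeftCancelMul (Associates M) := ⟨fun a b c h => by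
    obtain ⟨a, rfl⟩ := Associates.mk_surjective a
    obtain ⟨b, rfl⟩ := Associates.mk_surjective b
    obtain ⟨c, rfl⟩ := Associates.mk_surjective c
    simp only [Associates.mk_mul_mk] at h
    obtain ⟨u, hu⟩ := Associates.mk_eq_mk_iff_associated.mp h
    refine Associates.mk_eq_mk_iff_associated.mpr ⟨u, Subtype.ext ?_⟩
    have ha : (a : A) ≠ 0 := fun h0 => hM.zero_notMem (h0 ▸ a.2)
    have := congrArg Subtype.val hu
    simp only [Submonoid.coe_mul, mul_assoc] at this ⊢
    exact mul_left_cancel₀ ha this⟩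
  exact { this, CommMagma.IsLeftCancelMul.toIsCancelMul (Associates M) with }

/-- The characteristic monoid embeds in a lattice of the right rank. -/
theorem exists_embedding : ∃ ι : Additive (Associates M) →+
    (Fin (Module.finrank ℤ (Additive (Algebra.GrothendieckGroup (Associates M)))) → ℤ),
    Function.Injective ι := by
  have := hM.isCancelMul
  have := hM.fg
  let _ : CancelCommMonoid (Associates M) :=
    { (inferInstance : CommMonoid (Associates M)) with
      mul_left_cancel := fun a => IsLeftCancelMul.mul_left_cancel a }
  -- From `a ^ n = b ^ n`, saturation gives divisibility both ways, and cancellation with sharpness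
  -- makes the quotients trivial.
  have htf : IsMulTorsionFree (Associates M) := ⟨fun n hn a b h => by
    have h' : a ^ n = b ^ n := h
    obtain ⟨c, hc⟩ := hM.saturated b a n (Nat.pos_of_ne_zero hn) (h' ▸ dvd_rfl)
    obtain ⟨d, hd⟩ := hM.saturated a b n (Nat.pos_of_ne_zero hn) (h' ▸ dvd_rfl)
    have hcd : a * (c * d) = a * 1 := by rw [← mul_assoc, ← hc, ← hd, mul_one]
    have h1 : c * d = 1 := IsLeftCancelMul.mul_left_cancel a hcd
    have h2 : c = 1 := congrArg Additive.toMul (hM.sharp (Additive.ofMul c) (Additive.ofMul d) h1)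
    rw [hc, h2, mul_one]⟩
  have : IsMulTorsionFree (Algebra.GrothendieckGroup (Associates M)) := inferInstance
  have : Module.Finite ℤ (Additive (Algebra.GrothendieckGroup (Associates M))) := by
    rw [Module.Finite.iff_addGroup_fg, AddGroup.fg_iff_addMonoid_fg]
    infer_instance
  let b := Module.finBasis ℤ (Additive (Algebra.GrothendieckGroup (Associates M)))
  refine ⟨b.equivFun.toLinearMap.toAddMonoidHom.comp
    (MonoidHom.toAdditive (Algebra.GrothendieckGroup.of (M := Associates M))), ?_⟩
  exact b.equivFun.injective.comp (Algebra.GrothendieckGroup.of_injective (M := Associates M))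

variable [IsNoetherianRing A]

/-- Lifts of a minimal system of generators of the maximal ideal of the regular ring `A ⧸ I`. -/
theorem exists_parameters : ∃ (d : ℕ) (t : Fin d → A),
    ringKrullDim (A ⧸ Ideal.span {f | f ∈ M ∧ ¬ IsUnit f}) = d ∧
    Ideal.span {f | f ∈ M ∧ ¬ IsUnit f} ⊔ Ideal.span (Set.range t) =
      IsLocalRing.maximalIdeal A := by
  set I := Ideal.span {f | f ∈ M ∧ ¬ IsUnit f}
  have := hM.regular
  obtain ⟨s, hs, hspan⟩ := Submodule.FG.exists_span_finset_card_eq_spanFinrank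
    (IsNoetherian.noetherian (IsLocalRing.maximalIdeal (A ⧸ I)))
  choose l hl using Ideal.Quotient.mk_surjective (I := I)
  refine ⟨s.card, fun i => l (s.equivFin.symm i), ?_, ?_⟩
  · rw [hs, IsRegularLocalRing.spanFinrank_maximalIdeal]
  · have h1 : (IsLocalRing.maximalIdeal (A ⧸ I)).comap (Ideal.Quotient.mk I) =
        IsLocalRing.maximalIdeal A :=
      IsLocalRing.eq_maximalIdeal (Ideal.comap_isMaximal_of_surjective _
        Ideal.Quotient.mk_surjective)
    have h2 : (Ideal.span (Set.range fun i => l (s.equivFin.symm i))).map (Ideal.Quotient.mk I) =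
        IsLocalRing.maximalIdeal (A ⧸ I) := by
      rw [Ideal.map_span, ← Set.range_comp]
      have : (Ideal.Quotient.mk I ∘ fun i => l (s.equivFin.symm i)) =
          fun i => ((s.equivFin.symm i : s) : A ⧸ I) := funext fun i => hl _
      rw [this, Set.range_comp' (fun i : s => (i : A ⧸ I)), s.equivFin.symm.range_eq_univ,
        Set.image_univ, Subtype.range_coe_subtype]
      exact hspan
    rw [← h1, ← h2, Ideal.comap_map_of_surjective _ Ideal.Quotient.mk_surjective, sup_comm]
    congr 1
    exact (Ideal.mk_ker (I := I)).symm

/-- Monomials are products of an element of `M` and powers of the parameters. The dimension formula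
of log-regularity is exactly the required bound on the lattice rank. Working with principal ideals
avoids a multiplicative section of `M → C`. -/
theorem exists_regularMonomials : ∃ (d : ℕ) (κ : Type) (_ : Finite κ)
    (S : RegularMonomials A (Additive (Associates M) × (Fin d → ℕ)) κ),
    ∀ m : M, S.J (exponent m, 0) = Ideal.span {(m : A)} := by
  classical
  obtain ⟨d, t, hd, ht⟩ := hM.exists_parameters
  obtain ⟨ι, hι⟩ := hM.exists_embedding
  choose o ho using exists_exponent_eq (M := M)
  have hfg := hM.fg
  have ht' : ∀ i, t i ∈ IsLocalRing.maximalIdeal A := fun i => ht ▸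
    Ideal.mem_sup_right (Ideal.subset_span ⟨i, rfl⟩)
  let J : Additive (Associates M) × (Fin d → ℕ) → Ideal A := fun p =>
    Ideal.span {(o p.1 : A)} * ∏ i, Ideal.span {t i} ^ p.2 i
  have hJ : ∀ (m : M) n, J (exponent m, n) = Ideal.span {(m : A)} * ∏ i, Ideal.span {t i} ^ n i :=
    fun m n => congrArg (· * _) (span_eq_of_exponent_eq (ho _))
  have hJ0 : ∀ m : M, J (exponent m, 0) = Ideal.span {(m : A)} := fun m => by
    rw [hJ]; simp [-Ideal.one_eq_top]
  let ι' : Additive (Associates M) × (Fin d → ℕ) →+ (Fin _ ⊕ Fin d → ℤ) :=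
    { toFun := fun p => Sum.elim (ι p.1) (fun i => (p.2 i : ℤ))
      map_zero' := by ext (i | i) <;> simp
      map_add' := fun p q => by ext (i | i) <;> simp }
  refine ⟨d, Fin _ ⊕ Fin d, inferInstance,
    { J := J
      J_zero := by
        change J (exponent 1, 0) = ⊤
        rw [hJ0]; simp
      J_add := ?_
      principal := ?_
      span := ?_
      fg := ?_
      sharp := ?_
      ι := ι'
      ι_injective := ?_
      card_le := ?_ }, hJ0⟩
  · rintro ⟨p, n⟩ ⟨q, n'⟩
    obtain ⟨m, rfl⟩ := exists_exponent_eq p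
    obtain ⟨m', rfl⟩ := exists_exponent_eq q
    rw [Prod.mk_add_mk, ← exponent_mul, hJ, hJ, hJ, Submonoid.coe_mul,
      ← Ideal.span_singleton_mul_span_singleton]
    simp only [Pi.add_apply, pow_add, Finset.prod_mul_distrib]
    exact mul_mul_mul_comm _ _ _ _
  · intro p
    refine ⟨(o p.1 : A) * ∏ i, t i ^ p.2 i, ?_⟩
    rw [← Ideal.span_singleton_mul_span_singleton, ← Ideal.prod_span_singleton]
    simp only [J, Ideal.span_singleton_pow]
  · refine le_antisymm (iSup₂_le ?_) ?_
    · rintro ⟨p, n⟩ hpn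
      obtain ⟨m, rfl⟩ := exists_exponent_eq p
      rw [hJ]
      by_cases hm : exponent m = 0
      · have hn : n ≠ 0 := fun hn => hpn (by rw [hm, hn]; rfl)
        obtain ⟨i, hi⟩ := Function.ne_iff.mp hn
        refine Ideal.mul_le_right.trans ?_
        rw [← Finset.mul_prod_erase _ _ (Finset.mem_univ i)]
        refine Ideal.mul_le_left.trans ((Ideal.pow_le_self hi).trans ?_)
        exact (Ideal.span_singleton_le_iff_mem _).mpr (ht' i)
      · refine Ideal.mul_le_left.trans ((Ideal.span_singleton_le_iff_mem _).mpr ?_)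
        rw [IsLocalRing.mem_maximalIdeal, mem_nonunits_iff]
        exact fun h => hm (hM.exponent_eq_zero_iff.mpr h)
    · rw [← ht]
      refine sup_le (Ideal.span_le.mpr ?_) (Ideal.span_le.mpr ?_)
      · rintro f ⟨hf, hfu⟩
        have h1 : ((exponent ⟨f, hf⟩, 0) : Additive (Associates M) × (Fin d → ℕ)) ≠ 0 := fun h =>
          hfu (hM.exponent_eq_zero_iff.mp (congrArg Prod.fst h))
        have h2 : J (exponent ⟨f, hf⟩, 0) ≤ ⨆ p ∈ {p | p ≠ 0}, J p :=
          le_iSup₂_of_le _ h1 le_rfl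
        rw [hJ0] at h2
        exact h2 (Ideal.mem_span_singleton_self f)
      · rintro _ ⟨i, rfl⟩
        have h1 : ((0, Pi.single i 1) : Additive (Associates M) × (Fin d → ℕ)) ≠ 0 := fun h => by
          have := congrFun (congrArg Prod.snd h) i
          simp at this
        have h2 : J (exponent 1, Pi.single i 1) ≤ ⨆ p ∈ {p | p ≠ 0}, J p :=
          le_iSup₂_of_le _ h1 le_rfl
        rw [hJ, Finset.prod_eq_single i (fun j _ hj => by simp [hj]) (by simp)] at h2
        refine h2 ?_
        simp [Ideal.mem_span_singleton_self (t i)]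
  · have h1 : Module.Finite ℕ (Additive (Associates M)) :=
      Module.Finite.iff_addMonoid_fg.mpr inferInstance
    exact Module.Finite.iff_addMonoid_fg.mp inferInstance
  · rintro ⟨p, n⟩ ⟨q, n'⟩ h
    have h1 := congrArg Prod.fst h
    have h2 := congrArg Prod.snd h
    refine Prod.ext (hM.sharp p q h1) (funext fun i => ?_)
    have := congrFun h2 i
    simp only [Prod.snd_add, Pi.add_apply, Prod.snd_zero, Pi.zero_apply] at this ⊢
    omega
  · rintro ⟨p, n⟩ ⟨q, n'⟩ h
    refine Prod.ext (hι (funext fun i => ?_)) (funext fun i => ?_)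
    · exact congrFun h (Sum.inl i)
    · exact Int.ofNat_inj.mp (congrFun h (Sum.inr i))
  · rw [hM.dim_eq, hd]
    simp only [Nat.card_eq_fintype_card, Fintype.card_sum, Fintype.card_fin]
    push_cast
    rw [add_comm]

end IsLogRegularSubmonoid

/-- The monomial valuation on `A` given by weights on the characteristic monoid of `M`. -/
noncomputable def logVal (M : Submonoid A) (α : Additive (Associates M) →+ ℝ≥0∞) (f : A) : ℝ≥0∞ :=
  sSup {c | f ∈ Ideal.span {x | ∃ m : M, c ≤ α (exponent m) ∧ (m : A) = x}}

/-- A bound on generators passes to the ideal they generate. This is the source of the minimality of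
`v_α`. -/
theorem logVal_le (α : Additive (Associates M) →+ ℝ≥0∞) {w : A → ℝ≥0∞} (hw0 : w 0 = ⊤)
    (hadd : ∀ f h, min (w f) (w h) ≤ w (f + h))
    (hmul : ∀ f h, w (f * h) = w f + w h) (hw : ∀ m : M, α (exponent m) ≤ w m) (f : A) :
    logVal M α f ≤ w f := by
  refine sSup_le fun c hc => ?_
  refine Submodule.span_induction (p := fun x _ => c ≤ w x) ?_ ?_ ?_ ?_ hc
  · rintro _ ⟨m, hm, rfl⟩
    exact hm.trans (hw m)
  · rw [hw0]; exact le_top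
  · exact fun x y _ _ hx hy => (le_min hx hy).trans (hadd x y)
  · exact fun a x _ hx => by rw [smul_eq_mul, hmul]; exact hx.trans le_add_self

/-- Parameters get weight zero, so the exponents without parameters already generate; the auxiliary
choice of parameters thus drops out of the valuation. -/
theorem RegularMonomials.ideal_prod_eq {P κ : Type*} [AddCommMonoid P]
    (S : RegularMonomials A (Additive (Associates M) × P) κ)
    (hS : ∀ m : M, S.J (exponent m, 0) = Ideal.span {(m : A)}) (E : Set (Additive (Associates M))) :
    S.ideal {p | p.1 ∈ E} = Ideal.span {x | ∃ m : M, exponent m ∈ E ∧ (m : A) = x} := by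
  refine le_antisymm (ideal_le.mpr ?_) (Ideal.span_le.mpr ?_)
  · rintro ⟨p, n⟩ hp
    obtain ⟨m, rfl⟩ := exists_exponent_eq p
    have h1 : ((exponent m, n) : Additive (Associates M) × P) = (exponent m, 0) + (0, n) := by simp
    rw [h1, S.J_add, hS]
    refine Ideal.mul_le_left.trans ((Ideal.span_singleton_le_iff_mem _).mpr
      (Ideal.subset_span ⟨m, hp, rfl⟩))
  · rintro _ ⟨m, hm, rfl⟩
    have h1 : S.J (exponent m, 0) ≤ S.ideal {p | p.1 ∈ E} := J_le_ideal (Set.mem_ofPred.mpr hm)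
    rw [hS] at h1
    exact h1 (Ideal.mem_span_singleton_self _)

theorem RegularMonomials.val_comp_fst {P κ : Type*} [AddCommMonoid P]
    (S : RegularMonomials A (Additive (Associates M) × P) κ)
    (hS : ∀ m : M, S.J (exponent m, 0) = Ideal.span {(m : A)})
    (α : Additive (Associates M) →+ ℝ≥0∞) (f : A) :
    S.val (α.comp (AddMonoidHom.fst _ P)) f = logVal M α f := by
  have h : ∀ c, S.ideal {p | c ≤ α.comp (AddMonoidHom.fst _ P) p} =
      Ideal.span {x | ∃ m : M, c ≤ α (exponent m) ∧ (m : A) = x} := fun c =>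
    S.ideal_prod_eq hS {p | c ≤ α p}
  simp only [val, h, logVal]

namespace IsLogRegularSubmonoid

variable [IsDomain A] [IsNoetherianRing A] (hM : IsLogRegularSubmonoid M)
  (α : Additive (Associates M) →+ ℝ≥0∞)
include hM

theorem logVal_exponent (m : M) : logVal M α m = α (exponent m) := by
  obtain ⟨d, κ, _, S, hS⟩ := hM.exists_regularMonomials
  rw [← S.val_comp_fst hS]
  exact (S.isMultiplicative _).2 _ _ (hS m)

theorem logVal_mul (f h : A) : logVal M α (f * h) = logVal M α f + logVal M α h := by
  obtain ⟨d, κ, _, S, hS⟩ := hM.exists_regularMonomials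
  simp only [← S.val_comp_fst hS]
  exact (S.isMultiplicative _).1 f h

theorem min_logVal_le (f h : A) : min (logVal M α f) (logVal M α h) ≤ logVal M α (f + h) := by
  obtain ⟨d, κ, _, S, hS⟩ := hM.exists_regularMonomials
  simp only [← S.val_comp_fst hS]
  exact RegularMonomials.min_val_le f h

theorem logVal_zero : logVal M α 0 = ⊤ := by
  obtain ⟨d, κ, _, S, hS⟩ := hM.exists_regularMonomials
  simp only [← S.val_comp_fst hS]
  exact RegularMonomials.val_zero

theorem logVal_one : logVal M α 1 = 0 := by
  have := hM.logVal_exponent α 1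
  rwa [exponent_one, map_zero] at this

/-- The monomial valuation as a valuation. -/
noncomputable def valuation : AddValuation A ℝ≥0∞ :=
  AddValuation.of (logVal M α) (hM.logVal_zero α) (hM.logVal_one α) (hM.min_logVal_le α)
    (hM.logVal_mul α)

theorem valuation_apply (f : A) : hM.valuation α f = logVal M α f := rfl

/-- The support is a monomial ideal. This is what ties kernels of monomial points to the Kato fan.
-/
theorem logVal_eq_top_iff {f : A} : logVal M α f = ⊤ ↔
    f ∈ Ideal.span {x | ∃ m : M, α (exponent m) = ⊤ ∧ (m : A) = x} := by
  obtain ⟨d, κ, _, S, hS⟩ := hM.exists_regularMonomials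
  rw [← S.val_comp_fst hS, RegularMonomials.val_eq_top_iff]
  exact (S.ideal_prod_eq hS {p | α p = ⊤}) ▸ Iff.rfl

theorem tendsto_logVal {ι' : Type*} {l : Filter ι'} {a : ι' → (Additive (Associates M) →+ ℝ≥0∞)}
    (h : ∀ p, Tendsto (fun i => a i p) l (𝓝 (α p))) (f : A) :
    Tendsto (fun i => logVal M (a i) f) l (𝓝 (logVal M α f)) := by
  obtain ⟨d, κ, _, S, hS⟩ := hM.exists_regularMonomials
  simp only [← S.val_comp_fst hS]
  exact RegularMonomials.tendsto_val (fun p => h p.1) f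

theorem exists_finite_approximation : ∃ b : ℕ → (Additive (Associates M) →+ ℝ≥0),
    (∀ n p, α p ≠ ⊤ → (b n p : ℝ≥0∞) = α p) ∧
      ∀ p, Tendsto (fun n => (b n p : ℝ≥0∞)) atTop (𝓝 (α p)) := by
  obtain ⟨ι, hι⟩ := hM.exists_embedding
  have := hM.fg
  exact LogSkel.exists_finite_approximation inferInstance hι α

end IsLogRegularSubmonoid

end LogRegularMonoid

end LogSkel

namespace LogSkel

/-! ### Generization maps between stalks -/

section Stalks

variable {X : Scheme.{u}}

/-- The generization map on stalks. -/
noncomputable def generize {x y : X} (h : y ⤳ x) : X.presheaf.stalk x →+* X.presheaf.stalk y :=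
  (X.presheaf.stalkSpecializes h).hom

theorem generize_germ {x y : X} (h : y ⤳ x) (U : X.Opens) (hx : x ∈ U) (s : Γ(X, U)) :
    generize h (X.presheaf.germ U x hx s) = X.presheaf.germ U y (h.mem_open U.2 hx) s :=
  congrArg (fun t => t.hom s) (TopCat.Presheaf.germ_stalkSpecializes X.presheaf hx h)

theorem generize_generize {x y z : X} (h : y ⤳ x) (h' : z ⤳ y) (f : X.presheaf.stalk x) :
    generize h' (generize h f) = generize (h'.trans h) f := by
  obtain ⟨U, hU, s, rfl⟩ := X.presheaf.exists_germ_eq f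
  rw [generize_germ, generize_germ, generize_germ]

/-- The prime ideal of a generization. -/
noncomputable def primeOf {x y : X} (h : y ⤳ x) : Ideal (X.presheaf.stalk x) :=
  (IsLocalRing.maximalIdeal (X.presheaf.stalk y)).comap (generize h)

instance {x y : X} (h : y ⤳ x) : (primeOf h).IsPrime := by
  unfold primeOf; infer_instance

theorem mem_primeOf {x y : X} {h : y ⤳ x} {f : X.presheaf.stalk x} :
    f ∈ primeOf h ↔ ¬ IsUnit (generize h f) := Iff.rfl

/-- The stalk at `y` is a localization of the ring of an affine open containing `x`, so fractions at
`y` have numerators and denominators defined at `x`. -/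
theorem exists_generize_mul_eq {x y : X} (h : y ⤳ x) (g : X.presheaf.stalk y) :
    ∃ a b : X.presheaf.stalk x, IsUnit (generize h b) ∧ g * generize h b = generize h a := by
  obtain ⟨_, ⟨U, hU, rfl⟩, hxU, -⟩ :=
    X.isBasis_affineOpens.exists_subset_of_mem_open (Set.mem_univ x) isOpen_univ
  have hyU : y ∈ U := h.mem_open U.2 hxU
  let := X.presheaf.algebra_section_stalk ⟨y, hyU⟩
  have := hU.isLocalization_stalk ⟨y, hyU⟩
  obtain ⟨⟨a, b⟩, e⟩ := IsLocalization.surj (hU.primeIdealOf ⟨y, hyU⟩).asIdeal.primeCompl g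
  have hb := IsLocalization.map_units (X.presheaf.stalk y) b
  refine ⟨X.presheaf.germ U x hxU a, X.presheaf.germ U x hxU b, ?_, ?_⟩
  · rw [generize_germ]; exact hb
  · rw [generize_germ, generize_germ]; exact e

theorem generize_injective [AlgebraicGeometry.IsIntegral X] {x y : X} (h : y ⤳ x) :
    Function.Injective (generize h) := by
  rw [injective_iff_map_eq_zero]
  intro f hf
  obtain ⟨U, hU, s, rfl⟩ := X.presheaf.exists_germ_eq f
  rw [generize_germ] at hf
  rw [(injective_iff_map_eq_zero _).mp (germ_injective_of_isIntegral X y (h.mem_open U.2 hU)) s hf,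
    map_zero]

theorem fromSpecStalk_primeOf {x y : X} (h : y ⤳ x) :
    X.fromSpecStalk x ⟨primeOf h, inferInstance⟩ = y := by
  have e := Scheme.SpecMap_stalkSpecializes_fromSpecStalk h
  have := congrArg (fun t => t (IsLocalRing.closedPoint (X.presheaf.stalk y))) e
  simp only [Scheme.fromSpecStalk_closedPoint] at this
  exact this

/-- A generization is determined by its prime ideal. -/
theorem specializes_of_primeOf_le {x y z : X} (h : y ⤳ x) (h' : z ⤳ x)
    (hle : primeOf h ≤ primeOf h') : y ⤳ z := by
  rw [← fromSpecStalk_primeOf h, ← fromSpecStalk_primeOf h']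
  refine Specializes.map ?_ (X.fromSpecStalk x).continuous
  exact (PrimeSpectrum.le_iff_specializes _ _).mp hle

theorem eq_of_primeOf_eq {x y z : X} (h : y ⤳ x) (h' : z ⤳ x)
    (he : primeOf h = primeOf h') : y = z :=
  (specializes_of_primeOf_le h h' he.le).antisymm (specializes_of_primeOf_le h' h he.ge) |>.eq

end Stalks

/-! ### Stalks of fs log structures and the primes of the Kato fan -/

namespace LogStructure

variable {X : Scheme.{u}} {M : LogStructure X}

theorem generize_mem_stalk {x y : X} (h : y ⤳ x) {m : X.presheaf.stalk x} (hm : m ∈ M.stalk x) :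
    generize h m ∈ M.stalk y := by
  obtain ⟨U, hU, s, hs, rfl⟩ := hm
  exact ⟨U, h.mem_open U.2 hU, s, hs, (generize_germ h U hU s).symm⟩

theorem germ_mem_stalk {U : X.Opens} {x : X} (hx : x ∈ U) {s : Γ(X, U)} (hs : s ∈ M.sections U) :
    X.presheaf.germ U x hx s ∈ M.stalk x := ⟨U, hx, s, hs, rfl⟩

variable (hfs : M.IsFineSaturated)
include hfs

/-- If `φ p` vanished at `x`, the chart would identify `p` with `p * p` up to elements that become
units; cancelling `p` then makes the germ of `φ p` a unit. -/
theorem zero_notMem_stalk (x : X) : (0 : X.presheaf.stalk x) ∉ M.stalk x := by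
  intro h0
  obtain ⟨U, hU, P, _, φ, hP, hφ⟩ := hfs x
  have := hP.cancel
  obtain ⟨p, v, hv, e⟩ := hφ.surj x hU 0 h0
  have hp : X.presheaf.germ U x hU (φ p) = 0 := (hv.mul_left_eq_zero.mp e.symm)
  obtain ⟨a, b, ha, hb, hab, -⟩ := hφ.inj x hU p (p * p) 1 isUnit_one (by
    rw [map_mul, map_mul, hp, zero_mul, zero_mul])
  rw [mul_assoc] at hab
  rw [mul_left_cancel hab, map_mul, map_mul] at ha
  exact not_isUnit_zero (hp ▸ isUnit_of_mul_isUnit_left ha)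

/-- A chart around `x` is also a chart at `y`. -/
theorem exists_generize_eq_mul {x y : X} (h : y ⤳ x) {m : X.presheaf.stalk y}
    (hm : m ∈ M.stalk y) : ∃ m' ∈ M.stalk x, ∃ v, IsUnit v ∧ m = generize h m' * v := by
  obtain ⟨U, hU, P, _, φ, hP, hφ⟩ := hfs x
  obtain ⟨p, v, hv, e⟩ := hφ.surj y (h.mem_open U.2 hU) m hm
  exact ⟨_, M.germ_mem_stalk hU (hφ.mem p), v, hv, by rw [generize_germ, e]⟩

theorem fg_charMonoid (x : X) : Monoid.FG (M.charMonoid x) := by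
  obtain ⟨U, hU, P, _, φ, hP, hφ⟩ := hfs x
  have := hP.fg
  let f : P →* M.stalk x := (((X.presheaf.germ U x hU).hom : _ →* _).comp φ).codRestrict (M.stalk x)
    fun p => M.germ_mem_stalk hU (hφ.mem p)
  refine Monoid.fg_of_surjective (Associates.mkMonoidHom.comp f) fun c => ?_
  obtain ⟨m, rfl⟩ := Associates.mk_surjective c
  obtain ⟨p, v, hv, e⟩ := hφ.surj x hU m m.2
  refine ⟨p, Associates.mk_eq_mk_iff_associated.mpr ?_⟩
  obtain ⟨v, rfl⟩ := hv
  refine ⟨⟨⟨v, M.isUnit_mem_stalk v.isUnit⟩, ⟨(v⁻¹ : _ˣ), M.isUnit_mem_stalk v⁻¹.isUnit⟩,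
    Subtype.ext v.mul_inv, Subtype.ext v.inv_mul⟩, Subtype.ext e.symm⟩

theorem saturated_charMonoid (x : X) (a b : M.charMonoid x) (n : ℕ) (hn : 0 < n)
    (h : b ^ n ∣ a ^ n) : b ∣ a := by
  obtain ⟨U, hU, P, _, φ, hP, hφ⟩ := hfs x
  let g : P →* X.presheaf.stalk x := ((X.presheaf.germ U x hU).hom : _ →* _).comp φ
  have hg : ∀ p, g p ∈ M.stalk x := fun p => M.germ_mem_stalk hU (hφ.mem p)
  have key : ∀ c : M.charMonoid x, ∃ p, Associates.mk (⟨g p, hg p⟩ : M.stalk x) = c := by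
    intro c
    obtain ⟨m, rfl⟩ := Associates.mk_surjective c
    obtain ⟨p, v, hv, e⟩ := hφ.surj x hU m m.2
    refine ⟨p, Associates.mk_eq_mk_iff_associated.mpr ?_⟩
    obtain ⟨v, rfl⟩ := hv
    exact ⟨⟨⟨v, M.isUnit_mem_stalk v.isUnit⟩, ⟨(v⁻¹ : _ˣ), M.isUnit_mem_stalk v⁻¹.isUnit⟩,
      Subtype.ext v.mul_inv, Subtype.ext v.inv_mul⟩, Subtype.ext e.symm⟩
  obtain ⟨p, rfl⟩ := key a
  obtain ⟨q, rfl⟩ := key b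
  obtain ⟨c, hc⟩ := h
  obtain ⟨s, rfl⟩ := key c
  rw [← Associates.mk_pow, ← Associates.mk_pow, Associates.mk_mul_mk,
    Associates.mk_eq_mk_iff_associated] at hc
  obtain ⟨u, hu⟩ := hc
  have hu' : g (p ^ n) * ((u : M.stalk x) : X.presheaf.stalk x) = g (q ^ n * s) := by
    have := congrArg Subtype.val hu
    simpa only [map_mul, map_pow, Submonoid.coe_mul, SubmonoidClass.coe_pow] using this
  obtain ⟨a', b', ha', hb', e, -⟩ := hφ.inj x hU (p ^ n) (q ^ n * s) _
    (u.isUnit.map (M.stalk x).subtype) hu'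
  -- The relation in the characteristic monoid lifts to `P` only up to `a'` and `b'`, which become
  -- units at `x`. The factor `a' ^ (n - 1)` completes `p ^ n * a'` to the `n`-th power of `p * a'`.
  obtain ⟨c', hc'⟩ := hP.saturated (p * a') q n hn ⟨s * b' * a' ^ (n - 1), by
    obtain ⟨k, rfl⟩ := Nat.exists_eq_succ_of_ne_zero hn.ne'
    rw [Nat.succ_sub_one, mul_pow, pow_succ' a', ← mul_assoc, e]
    simp only [mul_assoc]⟩
  have ha'' : IsUnit (⟨g a', hg a'⟩ : M.stalk x) := by
    obtain ⟨w, hw⟩ := (show IsUnit (g a') from ha')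
    refine IsUnit.of_mul_eq_one (⟨_, M.isUnit_mem_stalk w⁻¹.isUnit⟩ : M.stalk x) (Subtype.ext ?_)
    rw [Submonoid.coe_mul]
    exact (congrArg (· * ((w⁻¹ : _ˣ) : X.presheaf.stalk x)) hw.symm).trans w.mul_inv
  have e2 : Associates.mk (⟨g p, hg p⟩ : M.stalk x) =
      Associates.mk (⟨g q, hg q⟩ : M.stalk x) * Associates.mk (⟨g c', hg c'⟩ : M.stalk x) := by
    rw [Associates.mk_mul_mk, Associates.mk_eq_mk_iff_associated]
    refine ⟨ha''.unit, Subtype.ext ?_⟩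
    simp only [Submonoid.coe_mul, IsUnit.unit_spec]
    rw [← map_mul, ← map_mul, hc']
  exact ⟨_, e2⟩

theorem isLogRegularSubmonoid (hreg : M.IsLogRegular) (x : X) :
    IsLogRegularSubmonoid (M.stalk x) where
  isUnit_mem := M.isUnit_mem_stalk
  zero_notMem := zero_notMem_stalk hfs x
  fg := fg_charMonoid hfs x
  saturated := saturated_charMonoid hfs x
  regular := (hreg x).regular
  dim_eq := (hreg x).dim_eq

section KatoFan

variable [AlgebraicGeometry.IsIntegral X] [IsLocallyNoetherian X] (hreg : M.IsLogRegular)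
include hreg

open Classical in
/-- The ideal generated by the elements of `M_x` that vanish at a generization is prime. -/
theorem isPrime_span_primeOf {x y : X} (h : y ⤳ x) :
    (Ideal.span {f | f ∈ M.stalk x ∧ f ∈ primeOf h}).IsPrime := by
  have hM := isLogRegularSubmonoid hfs hreg x
  let F : M.charMonoid x → Prop := fun c => ∀ m : M.stalk x, Associates.mk m = c →
    IsUnit (generize h m)
  have hF : ∀ m : M.stalk x, F (Associates.mk m) ↔ IsUnit (generize h m) := by
    refine fun m => ⟨fun H => H m rfl, fun H m' e => ?_⟩
    obtain ⟨u, rfl⟩ := Associates.mk_eq_mk_iff_associated.mp e.symm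
    rw [Submonoid.coe_mul, map_mul]
    exact H.mul ((u.isUnit.map (M.stalk x).subtype).map _)
  -- Weight `0` on what is invertible at `y` and `∞` on the rest: the ideal in question is the
  -- support of the associated monomial valuation.
  let α : Additive (M.charMonoid x) →+ ℝ≥0∞ :=
    { toFun := fun p => if F p.toMul then 0 else ⊤
      map_zero' := if_pos ((hF 1).mpr (by simp))
      map_add' := fun p q => by
        obtain ⟨m, rfl⟩ := exists_exponent_eq p
        obtain ⟨n, rfl⟩ := exists_exponent_eq q
        have e1 := hF (m * n)
        have e2 := hF m
        have e3 := hF n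
        rw [Submonoid.coe_mul, map_mul, IsUnit.mul_iff, ← e2, ← e3] at e1
        change (if F (Associates.mk (m * n)) then (0 : ℝ≥0∞) else ⊤) =
          (if F (Associates.mk m) then 0 else ⊤) + if F (Associates.mk n) then 0 else ⊤
        by_cases h1 : F (Associates.mk m) <;> by_cases h2 : F (Associates.mk n) <;>
          simp [h1, h2, e1] }
  have hα : ∀ m : M.stalk x, α (exponent m) = ⊤ ↔ (m : X.presheaf.stalk x) ∈ primeOf h := by
    intro m
    change (if F (Associates.mk m) then (0 : ℝ≥0∞) else ⊤) = ⊤ ↔ _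
    rw [mem_primeOf, ← hF]
    by_cases h1 : F (Associates.mk m) <;> simp [h1]
  have hset : {x_1 | ∃ m : M.stalk x, α (exponent m) = ⊤ ∧ (m : X.presheaf.stalk x) = x_1} =
      {f | f ∈ M.stalk x ∧ f ∈ primeOf h} := by
    ext f
    refine ⟨?_, fun hf => ⟨⟨f, hf.1⟩, (hα _).mpr hf.2, rfl⟩⟩
    rintro ⟨m, hm, rfl⟩
    exact ⟨m.2, (hα m).mp hm⟩
  have htop : ∀ f, f ∈ Ideal.span {f | f ∈ M.stalk x ∧ f ∈ primeOf h} ↔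
      logVal (M.stalk x) α f = ⊤ := fun f => by rw [hM.logVal_eq_top_iff, hset]
  refine ⟨fun e => ?_, fun {f g} hfg => ?_⟩
  · have := (htop 1).mp (e ▸ Submodule.mem_top)
    rw [hM.logVal_one] at this
    exact ENNReal.zero_ne_top this
  · rw [htop, hM.logVal_mul] at hfg
    rw [htop, htop]
    exact ENNReal.add_eq_top.mp hfg

/-- The elements of `M_x` vanishing at `y` generate an ideal that extends to the characteristic
ideal at `y`. Being prime, it is recovered from this extension by contraction. -/
theorem mem_katoFan_iff {x y : X} (h : y ⤳ x) :
    y ∈ M.katoFan ↔ primeOf h = Ideal.span {f | f ∈ M.stalk x ∧ f ∈ primeOf h} := by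
  have hle : Ideal.span {f | f ∈ M.stalk x ∧ f ∈ primeOf h} ≤ primeOf h :=
    Ideal.span_le.mpr fun f hf => hf.2
  have hmap : (Ideal.span {f | f ∈ M.stalk x ∧ f ∈ primeOf h}).map (generize h) =
      M.charIdeal y := by
    refine le_antisymm (Ideal.map_le_iff_le_comap.mpr (Ideal.span_le.mpr ?_)) (Ideal.span_le.mpr ?_)
    · exact fun f hf => Ideal.subset_span ⟨generize_mem_stalk h hf.1, hf.2⟩
    · rintro f ⟨hf, hfu⟩
      obtain ⟨m, hm, v, hv, rfl⟩ := exists_generize_eq_mul hfs h hf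
      refine Ideal.mul_mem_right _ _ (Ideal.mem_map_of_mem _ (Ideal.subset_span ⟨hm, ?_⟩))
      exact fun hu => hfu (hu.mul hv)
  have hfrac : ∀ g : X.presheaf.stalk y, g ∈ IsLocalRing.maximalIdeal (X.presheaf.stalk y) →
      g ∈ (primeOf h).map (generize h) := by
    intro g hg
    obtain ⟨a, b, hb, e⟩ := exists_generize_mul_eq h g
    refine (Ideal.mul_unit_mem_iff_mem _ hb).mp (e ▸ Ideal.mem_map_of_mem _ ?_)
    rw [mem_primeOf, ← e]
    exact fun hu => hg (isUnit_of_mul_isUnit_left hu)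
  constructor
  · intro hy
    refine le_antisymm (fun f hf => ?_) hle
    have h1 : generize h f ∈ (Ideal.span {f | f ∈ M.stalk x ∧ f ∈ primeOf h}).map
        (generize h) := by
      rw [hmap]; exact hy ▸ hf
    have h2 : ∀ g ∈ (Ideal.span {f | f ∈ M.stalk x ∧ f ∈ primeOf h}).map (generize h),
        ∃ a ∈ Ideal.span {f | f ∈ M.stalk x ∧ f ∈ primeOf h}, ∃ b, IsUnit (generize h b) ∧
          g * generize h b = generize h a := by
      intro g hg
      refine Submodule.span_induction ?_ ?_ ?_ ?_ hg
      · rintro _ ⟨a, ha, rfl⟩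
        exact ⟨a, ha, 1, by simp, by simp⟩
      · exact ⟨0, zero_mem _, 1, by simp, by simp⟩
      · rintro g g' - - ⟨a, ha, b, hb, e⟩ ⟨a', ha', b', hb', e'⟩
        refine ⟨a * b' + a' * b, add_mem (Ideal.mul_mem_right _ _ ha)
          (Ideal.mul_mem_right _ _ ha'), b * b', by rw [map_mul]; exact hb.mul hb', ?_⟩
        rw [map_add, map_mul, map_mul, map_mul, ← e, ← e']; ring
      · rintro c g - ⟨a, ha, b, hb, e⟩
        obtain ⟨a', b', hb', e'⟩ := exists_generize_mul_eq h c
        refine ⟨a' * a, Ideal.mul_mem_left _ _ ha, b' * b, by rw [map_mul]; exact hb'.mul hb, ?_⟩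
        rw [map_mul, map_mul, ← e, ← e', smul_eq_mul]; ring
    obtain ⟨a, ha, b, hb, e⟩ := h2 _ h1
    rw [← map_mul] at e
    have := generize_injective h e
    refine ((isPrime_span_primeOf hfs hreg h).mem_or_mem (this ▸ ha :
      f * b ∈ Ideal.span _)).resolve_right fun hb' => ?_
    exact hle hb' hb
  · intro he
    refine le_antisymm (Ideal.span_le.mpr fun f hf => hf.2) fun g hg => ?_
    have := hfrac g hg
    rwa [he, hmap] at this

theorem primeOf_le_charIdeal {x y : X} (h : y ⤳ x) (hy : y ∈ M.katoFan) :
    primeOf h ≤ M.charIdeal x := by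
  rw [(mem_katoFan_iff hfs hreg h).mp hy]
  exact Ideal.span_mono fun f hf => ⟨hf.1, fun hu => hf.2 (hu.map _)⟩

end KatoFan

end LogStructure

end LogSkel

namespace LogSkel

/-! ### Finiteness of the Kato fan -/

namespace LogStructure

variable {X : Scheme.{u}} {M : LogStructure X}

theorem primeIdealOf_injective {U : X.Opens} (hU : IsAffineOpen U) :
    Function.Injective hU.primeIdealOf := fun x y h => Subtype.ext (by
  rw [← hU.fromSpec_primeIdealOf x, ← hU.fromSpec_primeIdealOf y, h])

theorem mem_primeIdealOf_iff {U : X.Opens} (hU : IsAffineOpen U) (y : U) (f : Γ(X, U)) :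
    f ∈ (hU.primeIdealOf y).asIdeal ↔ ¬ IsUnit (X.presheaf.germ U y y.2 f) := by
  let := X.presheaf.algebra_section_stalk y
  have := hU.isLocalization_stalk y
  have h := IsLocalization.AtPrime.isUnit_to_map_iff (X.presheaf.stalk (y : X))
    (hU.primeIdealOf y).asIdeal f
  rw [← not_iff_not, not_not]
  exact h.symm

/-- A point of an affine open whose maximal ideal is generated by sections is minimal among the
points where these sections vanish. -/
theorem primeIdealOf_mem_minimalPrimes {U : X.Opens} (hU : IsAffineOpen U) (y : U)
    (T : Set Γ(X, U)) (hT : Ideal.span (X.presheaf.germ U y y.2 '' T) =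
      IsLocalRing.maximalIdeal (X.presheaf.stalk (y : X))) :
    (hU.primeIdealOf y).asIdeal ∈ (Ideal.span T).minimalPrimes := by
  let := X.presheaf.algebra_section_stalk y
  have := hU.isLocalization_stalk y
  have hgerm : algebraMap Γ(X, U) (X.presheaf.stalk (y : X)) = (X.presheaf.germ U y y.2).hom := rfl
  refine ⟨⟨(hU.primeIdealOf y).isPrime, Ideal.span_le.mpr fun f hf => ?_⟩, fun q hq hqy f hf => ?_⟩
  · rw [SetLike.mem_coe, mem_primeIdealOf_iff]
    have h1 : X.presheaf.germ U y y.2 f ∈ IsLocalRing.maximalIdeal (X.presheaf.stalk (y : X)) :=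
      hT ▸ Ideal.subset_span ⟨f, hf, rfl⟩
    exact h1
  · have h1 : algebraMap Γ(X, U) (X.presheaf.stalk (y : X)) f ∈
        (Ideal.span T).map (algebraMap Γ(X, U) (X.presheaf.stalk (y : X))) := by
      rw [Ideal.map_span, hgerm]
      refine hT ▸ (mem_primeIdealOf_iff hU y f).mp hf
    rw [IsLocalization.algebraMap_mem_map_algebraMap_iff
      (hU.primeIdealOf y).asIdeal.primeCompl] at h1
    obtain ⟨s, hs, hsf⟩ := h1
    exact (hq.1.mem_or_mem (hq.2 hsf)).resolve_left fun h => hs (hqy h)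

/-- The Kato fan of a noetherian fine log scheme is locally finite. -/
theorem exists_finite_katoFan_inter [IsLocallyNoetherian X] (hfs : M.IsFineSaturated) (x : X) :
    ∃ V : X.Opens, x ∈ V ∧ (M.katoFan ∩ V).Finite := by
  classical
  obtain ⟨U, hxU, P, _, φ, hP, hφ⟩ := hfs x
  obtain ⟨_, ⟨V, hV, rfl⟩, hxV, hVU⟩ := X.isBasis_affineOpens.exists_subset_of_mem_open hxU U.isOpen
  refine ⟨V, hxV, ?_⟩
  obtain ⟨S, hS⟩ := hP.fg.fg_top
  let ψ : P →* Γ(X, V) := ((X.presheaf.map (homOfLE hVU).op).hom : _ →* _).comp φ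
  have hψ : ∀ (y : X) (hy : y ∈ V) p, X.presheaf.germ V y hy (ψ p) =
      X.presheaf.germ U y (hVU hy) (φ p) := fun y hy p =>
    TopCat.Presheaf.germ_res_apply X.presheaf (homOfLE hVU) y hy (φ p)
  have : IsNoetherianRing Γ(X, V) := IsLocallyNoetherian.component_noetherian ⟨V, hV⟩
  -- A point of the fan is a minimal prime over those chart generators that vanish there, so
  -- finitely many subsets of generators, each with finitely many minimal primes, account for all of
  -- them.
  let Z : Set (PrimeSpectrum Γ(X, V)) :=
    ⋃ T ∈ S.powerset, {q | q.asIdeal ∈ (Ideal.span (ψ '' (T : Set P))).minimalPrimes}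
  have hZ : Z.Finite := S.powerset.finite_toSet.biUnion fun T _ =>
    (Ideal.finite_minimalPrimes_of_isNoetherianRing _ _).preimage
      (f := PrimeSpectrum.asIdeal) fun q _ q' _ h => PrimeSpectrum.ext h
  have key : ∀ y : V, (y : X) ∈ M.katoFan → hV.primeIdealOf y ∈ Z := by
    intro y hy
    let g : P →* X.presheaf.stalk (y : X) :=
      ((X.presheaf.germ V (y : X) y.2).hom : _ →* _).comp ψ
    have hg : ∀ p, g p = X.presheaf.germ U y (hVU y.2) (φ p) := hψ y y.2
    let T := S.filter fun p => ¬ IsUnit (g p)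
    refine Set.mem_biUnion (Finset.mem_coe.mpr (Finset.mem_powerset.mpr (S.filter_subset _)))
      (primeIdealOf_mem_minimalPrimes hV y (ψ '' (T : Set P)) ?_)
    rw [Set.image_image]
    refine le_antisymm (Ideal.span_le.mpr ?_) ?_
    · rintro _ ⟨p, hp, rfl⟩
      exact (Finset.mem_filter.mp (Finset.mem_coe.mp hp)).2
    · rw [← show M.charIdeal (y : X) = _ from hy]
      refine Ideal.span_le.mpr ?_
      rintro f ⟨hf, hfu⟩
      obtain ⟨p, v, hv, rfl⟩ := hφ.surj y (hVU y.2) f hf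
      refine Ideal.mul_mem_right _ _ ?_
      rw [← hg]
      have hgp : ¬ IsUnit (g p) := fun h => hfu (by rw [← hg]; exact h.mul hv)
      have hp : p ∈ Submonoid.closure (S : Set P) := hS ▸ Submonoid.mem_top p
      clear hf hfu
      have : IsUnit (g p) ∨ g p ∈ Ideal.span (g '' (T : Set P)) := by
        induction hp using Submonoid.closure_induction with
        | mem p hp =>
          by_cases h : IsUnit (g p)
          · exact Or.inl h
          · exact Or.inr (Ideal.subset_span ⟨p, Finset.mem_filter.mpr ⟨hp, h⟩, rfl⟩)
        | one => exact Or.inl (by simp)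
        | mul p q _ _ hp hq =>
          rw [map_mul]
          by_cases h1 : IsUnit (g p)
          · by_cases h2 : IsUnit (g q)
            · exact Or.inl (h1.mul h2)
            · exact Or.inr (Ideal.mul_mem_left _ _ ((hq h2).resolve_left h2))
          · exact Or.inr (Ideal.mul_mem_right _ _ ((hp h1).resolve_left h1))
      exact this.resolve_left hgp
  have hfin := (hZ.preimage (primeIdealOf_injective hV).injOn).image (Subtype.val : V → X)
  exact hfin.subset fun y hy => ⟨⟨y, hy.2⟩, key ⟨y, hy.2⟩ hy.1, rfl⟩

theorem finite_katoFan [IsLocallyNoetherian X] [CompactSpace X] (hfs : M.IsFineSaturated) :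
    M.katoFan.Finite := by
  have h := isCompact_univ.induction_on (X := X) (p := fun s => (M.katoFan ∩ s).Finite)
    (by simp) (fun s t hst ht => ht.subset (Set.inter_subset_inter_right _ hst))
    (fun s t hs ht => by rw [Set.inter_union_distrib_left]; exact hs.union ht)
    (fun x _ => by
      obtain ⟨V, hx, hV⟩ := exists_finite_katoFan_inter hfs x
      exact ⟨V, mem_nhdsWithin_of_mem_nhds (V.isOpen.mem_nhds hx), hV⟩)
  rwa [Set.inter_univ] at h

end LogStructure

end LogSkel

namespace LogSkel

open Filter Topology

section Specializations

variable {X : Scheme.{u}}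

theorem exists_primeOf_eq (x : X) (q : Ideal (X.presheaf.stalk x)) [hq : q.IsPrime] :
    ∃ (z : X) (h : z ⤳ x), primeOf h = q := by
  have h : X.fromSpecStalk x ⟨q, hq⟩ ⤳ x := by
    have : X.fromSpecStalk x ⟨q, hq⟩ ∈ Set.range (X.fromSpecStalk x) := ⟨_, rfl⟩
    rwa [Scheme.range_fromSpecStalk] at this
  refine ⟨_, h, ?_⟩
  have := (X.fromSpecStalk x).isEmbedding.injective (fromSpecStalk_primeOf h)
  exact congrArg PrimeSpectrum.asIdeal this

theorem generize_refl {x : X} (f : X.presheaf.stalk x) : generize (specializes_refl x) f = f := by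
  obtain ⟨U, hU, s, rfl⟩ := X.presheaf.exists_germ_eq f
  rw [generize_germ]

end Specializations

/-! ### Berkovich points: centres, topology, closed subschemes -/

section Berkovich

variable {K : Type u} [NormedField K] [IsUltrametricDist K] {X : Scheme.{u}} {p : X ⟶ base K}

theorem generize_baseStalk {x y : X} (h : y ⤳ x) (a : valRing K) :
    generize h (baseStalk p x a) = baseStalk p y a :=
  generize_germ h ⊤ trivial _

namespace BerkovichPoint

variable (P : BerkovichPoint p) {x : X} (h : P.ker ⤳ x)

theorem abs_natCast_le_one (n : ℕ) : P.abs n ≤ 1 := by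
  have e : ((n : ℕ) : X.residueField P.ker) = X.residue P.ker (baseStalk p P.ker n) := by
    rw [map_natCast, map_natCast]
  rw [e, P.abs_base]
  exact (NormedField.valuation (K := K)).mem_valuationSubring_iff _ |>.mp (n : valRing K).2

/-- Integers come from `K°` and so have absolute value at most one, which forces the ultrametric
inequality. -/
theorem abs_add_le_max (a b : X.residueField P.ker) : P.abs (a + b) ≤ max (P.abs a) (P.abs b) := by
  let _ := P.abs.toNormedField
  have := IsUltrametricDist.isUltrametricDist_of_forall_norm_natCast_le_one
    (R := X.residueField P.ker) P.abs_natCast_le_one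
  exact IsUltrametricDist.norm_add_le_max a b

theorem stalkAbs_eq (f : X.presheaf.stalk x) :
    P.stalkAbs h f = P.abs (X.residue P.ker (generize h f)) := rfl

theorem stalkAbs_germ (U : X.Opens) (hU : x ∈ U) (s : Γ(X, U)) :
    P.stalkAbs h (X.presheaf.germ U x hU s) =
      P.abs (X.evaluation U P.ker (h.mem_open U.2 hU) s) := by
  rw [stalkAbs_eq, generize_germ]; rfl

theorem stalkAbs_mul (f g : X.presheaf.stalk x) :
    P.stalkAbs h (f * g) = P.stalkAbs h f * P.stalkAbs h g := by
  simp only [stalkAbs_eq, map_mul]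

theorem stalkAbs_one : P.stalkAbs h 1 = 1 := by
  simp only [stalkAbs_eq, map_one]

theorem stalkAbs_zero : P.stalkAbs h 0 = 0 := by
  simp only [stalkAbs_eq, map_zero]

theorem stalkAbs_neg (f : X.presheaf.stalk x) : P.stalkAbs h (-f) = P.stalkAbs h f := by
  simp only [stalkAbs_eq, map_neg, AbsoluteValue.map_neg]

theorem stalkAbs_nonneg (f : X.presheaf.stalk x) : 0 ≤ P.stalkAbs h f := P.abs.nonneg _

theorem stalkAbs_add_le (f g : X.presheaf.stalk x) :
    P.stalkAbs h (f + g) ≤ max (P.stalkAbs h f) (P.stalkAbs h g) := by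
  simp only [stalkAbs_eq, map_add]
  exact P.abs_add_le_max _ _

theorem stalkAbs_eq_zero {f : X.presheaf.stalk x} : P.stalkAbs h f = 0 ↔ f ∈ primeOf h := by
  rw [stalkAbs_eq, AbsoluteValue.eq_zero]
  exact IsLocalRing.residue_eq_zero_iff _

theorem stalkAbs_generize {z : X} (h' : z ⤳ x) (h : P.ker ⤳ z) (f : X.presheaf.stalk x) :
    P.stalkAbs h (generize h' f) = P.stalkAbs (h.trans h') f := by
  rw [stalkAbs_eq, stalkAbs_eq, generize_generize]

theorem stalkAbs_baseStalk (a : valRing K) : P.stalkAbs h (baseStalk p x a) = ‖(a : K)‖ := by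
  rw [stalkAbs_eq, generize_baseStalk, P.abs_base]

/-- A point that is bounded by one on a local ring has a centre. -/
theorem exists_hasCentre (H : ∀ f : X.presheaf.stalk x, P.stalkAbs h f ≤ 1) :
    ∃ z, P.HasCentre z := by
  -- The elements of absolute value less than one form a prime ideal; the corresponding generization
  -- of `x` is the centre.
  let q : Ideal (X.presheaf.stalk x) :=
    { carrier := {f | P.stalkAbs h f < 1}
      add_mem' := fun hf hg => (P.stalkAbs_add_le h _ _).trans_lt (max_lt hf hg)
      zero_mem' := (P.stalkAbs_zero h).trans_lt one_pos
      smul_mem' := fun c f hf => by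
        refine (P.stalkAbs_mul h c f).trans_lt ?_
        exact (mul_le_of_le_one_left (P.stalkAbs_nonneg h f) (H c)).trans_lt hf }
  have hmem : ∀ f, f ∈ q ↔ P.stalkAbs h f < 1 := fun f => Iff.rfl
  have hq : q.IsPrime := by
    refine ⟨fun e => ?_, fun {f g} hfg => ?_⟩
    · have := (hmem 1).mp (e ▸ Submodule.mem_top)
      rw [stalkAbs_one] at this
      exact lt_irrefl _ this
    · by_contra! hc
      simp only [hmem, not_lt, stalkAbs_mul] at hfg hc
      rw [(H f).antisymm hc.1, (H g).antisymm hc.2, one_mul] at hfg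
      exact lt_irrefl _ hfg
  obtain ⟨z, hz, e⟩ := exists_primeOf_eq x q
  have hPz : P.ker ⤳ z := specializes_of_primeOf_le h hz fun f hf => by
    rw [e, hmem, (P.stalkAbs_eq_zero h).mpr hf]
    exact one_pos
  refine ⟨z, hPz, fun g => ?_⟩
  obtain ⟨a, b, hb, hab⟩ := exists_generize_mul_eq hz g
  have hb1 : P.stalkAbs h b = 1 := by
    refine (H b).antisymm (not_lt.mp fun hlt => ?_)
    rw [← hmem, ← e] at hlt
    exact hlt hb
  have e1 : P.stalkAbs hPz g = P.stalkAbs h a := by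
    have := congrArg (P.stalkAbs hPz) hab
    rwa [stalkAbs_mul, stalkAbs_generize, stalkAbs_generize, hb1, mul_one] at this
  refine ⟨e1 ▸ H a, fun hg => ?_⟩
  rw [e1, ← hmem, ← e]
  change generize hz a ∈ IsLocalRing.maximalIdeal (X.presheaf.stalk z)
  rw [← hab]
  exact Ideal.mul_mem_right _ _ hg

end BerkovichPoint

/-! ### The topology -/

/-- Functions near `P.ker` are quotients `a / b` of germs at `x` with `b` nonzero at `P`, so
convergence on `O_x` suffices; continuity of the kernel is automatic as the kernels generize
`P.ker`. -/
theorem BerkovichPoint.tendsto_of_stalkAbs {ι : Type*} {l : Filter ι} {Q : ι → BerkovichPoint p}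
    {P : BerkovichPoint p} {x : X} (hP : P.ker ⤳ x) (hQ : ∀ i, (Q i).ker ⤳ P.ker)
    (H : ∀ f, Tendsto (fun i => (Q i).stalkAbs ((hQ i).trans hP) f) l (𝓝 (P.stalkAbs hP f))) :
    Tendsto Q l (𝓝 P) := by
  refine tendsto_nhds_generateFrom_iff.mpr ?_
  rintro _ (⟨U, rfl⟩ | ⟨U, f, V, hV, rfl⟩) hmem
  · exact Eventually.of_forall fun i => (hQ i).mem_open U.2 hmem
  · obtain ⟨hU, hPV⟩ := hmem
    obtain ⟨a, b, hb, hab⟩ := exists_generize_mul_eq hP (X.presheaf.germ U P.ker hU f)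
    have hb0 : P.stalkAbs hP b ≠ 0 := fun h0 => (P.stalkAbs_eq_zero hP).mp h0 hb
    have key : ∀ (R : BerkovichPoint p) (hR : R.ker ⤳ P.ker), R.stalkAbs (hR.trans hP) b ≠ 0 →
        R.stalkAbs hR (X.presheaf.germ U P.ker hU f) =
          R.stalkAbs (hR.trans hP) a / R.stalkAbs (hR.trans hP) b := by
      intro R hR h0
      rw [eq_div_iff h0, ← stalkAbs_generize R hP hR, ← stalkAbs_generize R hP hR, ← stalkAbs_mul,
        hab]
    have hP' : P.stalkAbs (specializes_refl _) (X.presheaf.germ U P.ker hU f) ∈ V := by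
      rw [stalkAbs_eq, generize_refl]; exact hPV
    rw [key P (specializes_refl _) hb0] at hP'
    have T : Tendsto (fun i => (Q i).stalkAbs ((hQ i).trans hP) a /
        (Q i).stalkAbs ((hQ i).trans hP) b) l _ := (H a).div (H b) hb0
    filter_upwards [T.eventually_mem (hV.mem_nhds hP'), (H b).eventually_ne hb0] with i hi hi0
    rw [← key (Q i) (hQ i) hi0, stalkAbs_germ] at hi
    exact ⟨_, hi⟩

theorem AnSpace.tendsto_stalkAbs {ι : Type*} {l : Filter ι} {Q : ι → AnSpace p} {P : AnSpace p}
    (H : Tendsto Q l (𝓝 P)) {z : X} (hP : P.ker ⤳ z) (hQ : ∀ i, (Q i).ker ⤳ z)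
    (f : X.presheaf.stalk z) :
    Tendsto (fun i => (Q i).1.stalkAbs (hQ i) f) l (𝓝 (P.1.stalkAbs hP f)) := by
  obtain ⟨U, hU, s, rfl⟩ := X.presheaf.exists_germ_eq f
  have H' : Tendsto (fun i => (Q i).1) l (𝓝 P.1) :=
    (continuous_subtype_val.tendsto (X := {P : BerkovichPoint p // ∃ z, P.HasCentre z}) P).comp H
  refine tendsto_nhds.mpr fun V hV hPV => ?_
  have hW : IsOpen {R : BerkovichPoint p | ∃ h : R.ker ∈ U, R.abs (X.evaluation U R.ker h s) ∈ V} :=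
    isOpen_generateFrom_of_mem (Or.inr ⟨U, s, V, hV, rfl⟩)
  have hmem : P.1 ∈ {R : BerkovichPoint p | ∃ h : R.ker ∈ U,
      R.abs (X.evaluation U R.ker h s) ∈ V} :=
    ⟨_, (congrArg (· ∈ V) (P.1.stalkAbs_germ hP U hU s)).mp hPV⟩
  filter_upwards [H'.eventually (hW.mem_nhds hmem)] with i hi
  obtain ⟨h, hi⟩ := hi
  exact (congrArg (· ∈ V) ((Q i).1.stalkAbs_germ (hQ i) U hU s)).mpr hi

/-! ### Closed subschemes -/

section ClosedImmersion

variable {Y : Scheme.{u}} (g : Y ⟶ X) [IsClosedImmersion g]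

theorem residueFieldMap_bijective (y : Y) : Function.Bijective (g.residueFieldMap y).hom := by
  refine ⟨RingHom.injective _, fun a => ?_⟩
  obtain ⟨a, rfl⟩ := IsLocalRing.residue_surjective a
  obtain ⟨f, rfl⟩ := g.stalkMap_surjective y a
  exact ⟨X.residue (g y) f, congrArg (fun t => t.hom f) (Scheme.residue_residueFieldMap g y)⟩

namespace BerkovichPoint

theorem map_injective : Function.Injective (map (p := p) g) := by
  rintro ⟨y, v, hv⟩ ⟨y', v', hv'⟩ h
  simp only [map, mk.injEq] at h
  obtain ⟨h1, h2⟩ := h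
  obtain rfl := g.isClosedEmbedding.injective h1
  congr
  ext a
  obtain ⟨a, rfl⟩ := (residueFieldMap_bijective g y).2 a
  exact DFunLike.congr_fun (eq_of_heq h2) a

theorem exists_map_eq (P : BerkovichPoint p) (y : Y) (hy : g y = P.ker) :
    ∃ Q : BerkovichPoint (g ≫ p), Q.map g = P := by
  obtain ⟨x, v, hv⟩ := P
  obtain rfl : g y = x := hy
  let e := RingEquiv.ofBijective _ (residueFieldMap_bijective g y)
  refine ⟨⟨y, v.comp (f := (e.symm : _ →+* _)) e.symm.injective, fun a => ?_⟩, ?_⟩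
  · rw [← hv a, baseStalk_comp]
    have h1 : (Y.residue y) (g.stalkMap y (baseStalk p (g y) a)) =
      e (X.residue (g y) (baseStalk p (g y) a)) :=
      (congrArg (fun t => t.hom (baseStalk p (g y) a)) (Scheme.residue_residueFieldMap g y)).symm
    rw [h1]
    exact congrArg v (e.symm_apply_apply _)
  · simp only [map]
    congr
    ext a
    exact congrArg v (e.symm_apply_apply a)

theorem hasCentre_of_map {Q : BerkovichPoint (g ≫ p)} {y : Y} (h : (Q.map g).HasCentre (g y)) :
    Q.HasCentre y := by
  obtain ⟨h1, h2⟩ := h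
  have h3 : Q.ker ⤳ y := g.isClosedEmbedding.isInducing.specializes_iff.mp h1
  refine ⟨h3, fun f => ?_⟩
  obtain ⟨f, rfl⟩ := g.stalkMap_surjective y f
  have e := stalkAbs_map g Q h3 h1 f
  refine ⟨e ▸ (h2 f).1, fun hf => e ▸ (h2 f).2 ?_⟩
  rw [IsLocalRing.mem_maximalIdeal, mem_nonunits_iff] at hf ⊢
  exact fun hu => hf (hu.map (g.stalkMap y).hom)

end BerkovichPoint

end ClosedImmersion

theorem range_stratumι (y : X) : Set.range (stratumι y) = closure {y} :=
  (Scheme.IdealSheafData.range_subschemeι _).trans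
    (Scheme.IdealSheafData.coe_support_vanishingIdeal _)

theorem exists_stratumι_eq {x y : X} (h : y ⤳ x) : ∃ z, stratumι y z = x := by
  rw [specializes_iff_mem_closure, ← range_stratumι] at h
  exact h

theorem stratumInclusion_injective (y : X) : Function.Injective (stratumInclusion p y) :=
  fun _ _ h => Subtype.ext (BerkovichPoint.map_injective _ (congrArg Subtype.val h))

/-- The centre of `P` specializes its kernel, so it lies in `D_y` together with the kernel. -/
theorem exists_stratumInclusion_eq {y : X} (P : AnSpace p) (h : y ⤳ P.ker) :
    ∃ Q, stratumInclusion p y Q = P := by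
  obtain ⟨y', hy'⟩ := exists_stratumι_eq h
  obtain ⟨z, hz⟩ := P.2
  obtain ⟨z', rfl⟩ := exists_stratumι_eq (h.trans hz.1)
  obtain ⟨Q, hQ⟩ := BerkovichPoint.exists_map_eq (stratumι y) P.1 y' hy'
  exact ⟨⟨Q, z', BerkovichPoint.hasCentre_of_map (stratumι y) (hQ ▸ hz)⟩, Subtype.ext hQ⟩

end Berkovich

end LogSkel

namespace LogSkel

open Filter Topology

/-! ### From valuations to absolute values -/

section ExpNeg

theorem expNeg_eq (t : ℝ≥0∞) : expNeg t = (EReal.exp (-(t : EReal))).toReal := by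
  induction t with
  | top => simp [expNeg]
  | coe t =>
    have : -(((t : ℝ≥0) : ℝ≥0∞) : EReal) = ((-(t : ℝ) : ℝ) : EReal) := by norm_cast
    rw [this, EReal.exp_coe, ENNReal.toReal_ofReal (Real.exp_pos _).le]
    simp [expNeg]

theorem continuous_expNeg : Continuous expNeg := by
  have h1 : Continuous fun t : ℝ≥0∞ => EReal.exp (-(t : EReal)) :=
    ENNReal.continuous_exp.comp (continuous_neg.comp continuous_coe_ennreal_ereal)
  refine continuous_iff_continuousAt.mpr fun t => ?_
  simp only [funext expNeg_eq]
  refine (ENNReal.tendsto_toReal ?_).comp h1.continuousAt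
  rw [Ne, EReal.exp_eq_top_iff]
  induction t <;> simp

theorem expNeg_top : expNeg ⊤ = 0 := by simp [expNeg]

theorem expNeg_zero : expNeg 0 = 1 := by simp [expNeg]

theorem expNeg_coe (t : ℝ≥0) : expNeg t = Real.exp (-t) := by simp [expNeg]

theorem expNeg_add (s t : ℝ≥0∞) : expNeg (s + t) = expNeg s * expNeg t := by
  induction s with
  | top => simp [expNeg_top]
  | coe s =>
    induction t with
    | top => simp [expNeg_top]
    | coe t =>
      rw [← ENNReal.coe_add, expNeg_coe, expNeg_coe, expNeg_coe, ← Real.exp_add, NNReal.coe_add]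
      ring_nf

theorem expNeg_strictAnti : StrictAnti expNeg := by
  intro s t h
  induction s with
  | top => simp at h
  | coe s =>
    induction t with
    | top => rw [expNeg_top, expNeg_coe]; exact Real.exp_pos _
    | coe t =>
      rw [expNeg_coe, expNeg_coe]
      exact Real.exp_lt_exp.mpr (neg_lt_neg (by exact_mod_cast h))

theorem expNeg_injective : Function.Injective expNeg := expNeg_strictAnti.injective

theorem expNeg_nonneg (t : ℝ≥0∞) : 0 ≤ expNeg t := by
  rw [← expNeg_top]; exact expNeg_strictAnti.antitone le_top

theorem expNeg_le_one (t : ℝ≥0∞) : expNeg t ≤ 1 := by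
  rw [← expNeg_zero]; exact expNeg_strictAnti.antitone zero_le

theorem expNeg_eq_zero {t : ℝ≥0∞} : expNeg t = 0 ↔ t = ⊤ := by
  rw [← expNeg_top, expNeg_injective.eq_iff]

end ExpNeg

/-! ### Points and skeleton faces from valuations -/

section Existence

variable {K : Type u} [NormedField K] [IsUltrametricDist K] {X : Scheme.{u}}
  [AlgebraicGeometry.IsIntegral X] {p : X ⟶ base K}

/-- A valuation of a local ring with trivial support extends to a point over the generic point. -/
theorem exists_anSpace (x : X) (w : AddValuation (X.presheaf.stalk x) ℝ≥0∞)
    (hw : ∀ f, w f = ⊤ → f = 0) (hbase : ∀ a : valRing K, expNeg (w (baseStalk p x a)) = ‖(a : K)‖) :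
    ∃ (P : AnSpace p) (h : P.ker ⤳ x), P.ker = genericPoint X ∧
      ∀ f, P.1.stalkAbs h f = expNeg (w f) := by
  let v : Valuation (X.presheaf.stalk x) ℝ≥0 :=
    { toFun := fun f => ⟨expNeg (w f), expNeg_nonneg _⟩
      map_zero' := Subtype.ext (by simp [expNeg_top])
      map_one' := Subtype.ext (by simp [expNeg_zero])
      map_mul' := fun f g => NNReal.eq
        ((congrArg expNeg (w.map_mul f g)).trans (expNeg_add (w f) (w g)))
      map_add_le_max' := fun f g => by
        have h : expNeg (w (f + g)) ≤ max (expNeg (w f)) (expNeg (w g)) :=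
          (expNeg_strictAnti.antitone (w.map_add f g)).trans expNeg_strictAnti.antitone.map_min.le
        exact le_max_iff.mpr (le_max_iff.mp h) }
  have hv : ∀ f, (v f : ℝ) = expNeg (w f) := fun f => rfl
  have hS : nonZeroDivisors (X.presheaf.stalk x) ≤ v.supp.primeCompl := by
    intro f hf h0
    refine nonZeroDivisors.ne_zero hf (hw f (expNeg_eq_zero.mp ?_))
    rw [← hv, (v.mem_supp_iff f).mp h0, NNReal.coe_zero]
  let v' := v.extendToLocalization hS X.functionField
  have hv' : ∀ f, v' (generize (genericPoint_specializes x) f) = v f := fun f =>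
    v.extendToLocalization_apply_map_apply hS X.functionField f
  -- The stalk at the generic point is already a field.
  have hres : Function.Bijective (X.residue (genericPoint X)).hom :=
    ⟨RingHom.injective (R := X.functionField) _, IsLocalRing.residue_surjective⟩
  let e := RingEquiv.ofBijective _ hres
  let va : AbsoluteValue (X.presheaf.stalk (genericPoint X)) ℝ :=
    { toFun := fun g => v' g
      map_mul' := fun f g => by rw [map_mul, NNReal.coe_mul]
      nonneg' := fun g => NNReal.coe_nonneg _
      eq_zero' := fun g => by
        rw [NNReal.coe_eq_zero]
        exact v'.zero_iff (K := X.functionField)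
      add_le' := fun f g => by
        rw [← NNReal.coe_add, NNReal.coe_le_coe]
        exact (v'.map_add f g).trans (max_le_add_of_nonneg zero_le zero_le) }
  let P : BerkovichPoint p :=
    { ker := genericPoint X
      abs := va.comp (f := (e.symm : _ →+* _)) e.symm.injective
      abs_base := fun a => by
        rw [← hbase a, ← generize_baseStalk (genericPoint_specializes x), ← hv, ← hv']
        exact congrArg (fun g => (v' g : ℝ)) (e.symm_apply_apply _) }
  have hP : ∀ f, P.stalkAbs (genericPoint_specializes x) f = expNeg (w f) := by
    intro f
    rw [← hv, ← hv']
    exact congrArg (fun g => (v' g : ℝ)) (e.symm_apply_apply _)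
  exact ⟨⟨P, P.exists_hasCentre (genericPoint_specializes x) fun f =>
    (hP f).trans_le (expNeg_le_one _)⟩, genericPoint_specializes x, rfl, hP⟩

end Existence

section Weight

variable {A : Type*} [CommRing A] [IsLocalRing A]

theorem AddValuation.eq_zero_of_isUnit (v : AddValuation A ℝ≥0∞) {f : A} (hf : IsUnit f) :
    v f = 0 := by
  obtain ⟨g, hg⟩ := hf.exists_right_inv
  have := congrArg v hg
  rw [v.map_mul, v.map_one] at this
  exact (add_eq_zero.mp this).1

/-- The weight on the characteristic monoid defined by a valuation. -/
noncomputable def weight (M : Submonoid A) (v : AddValuation A ℝ≥0∞) :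
    Additive (Associates M) →+ ℝ≥0∞ where
  toFun q := Quotient.liftOn q.toMul (fun m => v m) fun a b h => by
    obtain ⟨u, rfl⟩ := h
    change v a = v ((a * u : M) : A)
    have hu : v ((u : M) : A) = 0 := AddValuation.eq_zero_of_isUnit v (u.isUnit.map M.subtype)
    rw [Submonoid.coe_mul, v.map_mul, hu, add_zero]
  map_zero' := v.map_one
  map_add' q r := by
    obtain ⟨m, rfl⟩ := exists_exponent_eq q
    obtain ⟨n, rfl⟩ := exists_exponent_eq r
    exact v.map_mul m n

theorem weight_exponent (M : Submonoid A) (v : AddValuation A ℝ≥0∞) (m : M) :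
    weight M v (exponent m) = v m := rfl

/-- Descent of a valuation along a surjection. -/
theorem exists_descent {B : Type*} [CommRing B] (π : A →+* B) (hπ : Function.Surjective π)
    (v : AddValuation A ℝ≥0∞) (hv : ∀ f, π f = 0 → v f = ⊤) :
    ∃ w : AddValuation B ℝ≥0∞, ∀ f, w (π f) = v f := by
  have hJ : RingHom.ker π ≤ v.supp := fun f hf => (v.mem_supp_iff f).mpr (hv f hf)
  let e := RingHom.quotientKerEquivOfSurjective hπ
  refine ⟨(v.onQuot hJ).comap (e.symm : B →+* _), fun f => ?_⟩
  have : e.symm (π f) = Ideal.Quotient.mk _ f := by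
    rw [RingEquiv.symm_apply_eq]; rfl
  exact congrArg (v.onQuot hJ) this

end Weight

section Face

variable {K : Type u} [NormedField K] [IsUltrametricDist K] {Y : Scheme.{u}} {q : Y ⟶ base K}
  {N : LogStructure Y} {z : Y} {A : Type*} [CommRing A] [IsLocalRing A] [IsDomain A]
  [IsNoetherianRing A] {M : Submonoid A} (hM : IsLogRegularSubmonoid M)
  (π : A →+* Y.presheaf.stalk z) (hπ : Function.Surjective π)
  (hbase : ∀ a : valRing K, a ≠ 0 → ∃ m : M, π m = baseStalk q z a)
  (hN : ∀ n, n ∈ N.stalk z ↔ ∃ m : M, π m = n ∧ n ≠ 0)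
  (hker : ∀ f, π f = 0 → f ∈ Ideal.span {x | ∃ m : M, π m = 0 ∧ (m : A) = x})
include hM hπ hbase hN hker

/-- The face of the skeleton at a point whose log structure is induced from a log-regular one. -/
theorem mem_skeletonFace_iff (P : AnSpace q) : P ∈ skeletonFace q N z ↔
    ∃ α : Additive (Associates M) →+ ℝ≥0∞, (∀ m : M, α (exponent m) = ⊤ ↔ π m = 0) ∧
      ∃ h : P.ker ⤳ z, ∀ f, P.1.stalkAbs h (π f) = expNeg (logVal M α f) := by
  -- By `hker` the kernel of `π` lies in the support of the monomial valuation, which therefore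
  -- descends to the quotient.
  have hdesc : ∀ α : Additive (Associates M) →+ ℝ≥0∞, (∀ m : M, α (exponent m) = ⊤ ↔ π m = 0) →
      ∃ w : AddValuation (Y.presheaf.stalk z) ℝ≥0∞, ∀ f, w (π f) = logVal M α f := by
    intro α hα
    refine exists_descent π hπ (hM.valuation α) fun f hf => ?_
    rw [hM.valuation_apply, hM.logVal_eq_top_iff]
    simpa only [hα] using hker f hf
  constructor
  · rintro ⟨β, v, h, hv, hP⟩
    have hα : ∀ m : M, weight M (v.comap π) (exponent m) = ⊤ ↔ π m = 0 := by
      intro m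
      rw [weight_exponent]
      refine ⟨fun h1 => ?_, fun h0 => ?_⟩
      · by_contra h0
        have := hv.compatible.eq_on_log ⟨π m, (hN _).mpr ⟨m, rfl, h0⟩⟩
        exact ENNReal.coe_ne_top (this.symm.trans h1)
      · change v (π m) = ⊤
        rw [h0, v.map_zero]
    obtain ⟨w, hw⟩ := hdesc _ hα
    have hwm : ∀ m : M, w (π m) = v (π m) := fun m => by
      rw [hw, hM.logVal_exponent, weight_exponent]; rfl
    -- The descended monomial valuation is itself compatible with `β`, so minimality of `v` bounds
    -- `v` by it; the reverse inequality is `logVal_le`.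
    have hle : ∀ f, v f ≤ w f := by
      refine hv.minimal w ⟨fun a => ?_, fun n => ?_⟩
      · rw [← hv.compatible.extends_base a]
        by_cases ha : a = 0
        · rw [ha, map_zero, w.map_zero, v.map_zero]
        · obtain ⟨m, hm⟩ := hbase a ha
          rw [← hm, hwm]
      · rw [← hv.compatible.eq_on_log]
        obtain ⟨m, hm, -⟩ := (hN n).mp n.2
        rw [← hm, hwm]
    refine ⟨_, hα, h, fun f => ?_⟩
    rw [hP, ← hw]
    refine congrArg expNeg ((hle _).antisymm ?_)
    rw [hw]
    exact logVal_le _ (v.comap π).map_zero (v.comap π).map_add (v.comap π).map_mul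
      (fun m => le_rfl) f
  · rintro ⟨α, hα, h, hP⟩
    obtain ⟨w, hw⟩ := hdesc α hα
    have hwm : ∀ m : M, w (π m) = α (exponent m) := fun m => by rw [hw, hM.logVal_exponent]
    have hfin : ∀ c, weight (N.stalk z) w c ≠ ⊤ := by
      intro c
      obtain ⟨n, rfl⟩ := exists_exponent_eq c
      obtain ⟨m, hm, h0⟩ := (hN n).mp n.2
      rw [weight_exponent, ← hm, hwm, Ne, hα, hm]
      exact h0
    -- The log structure `N` sees only elements with nonzero image under `π`, on which the weights
    -- are finite.
    let β : Additive (N.charMonoid z) →+ ℝ≥0 :=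
      { toFun := fun c => (weight (N.stalk z) w c).toNNReal
        map_zero' := by rw [map_zero]; rfl
        map_add' := fun c d => by rw [map_add, ENNReal.toNNReal_add (hfin c) (hfin d)] }
    have hβ : ∀ n : N.stalk z, (β (exponent n) : ℝ≥0∞) = w n := fun n =>
      ENNReal.coe_toNNReal (hfin (exponent n))
    refine ⟨AddMonoidHom.toMultiplicativeRight β, w, h, ⟨⟨fun a => ?_, fun n => (hβ n).symm⟩,
      fun w' hw' f => ?_⟩, fun f => ?_⟩
    · obtain ⟨f, hf⟩ := hπ (baseStalk q z a)
      rw [← hf, hw, ← hP, hf]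
      exact P.1.stalkAbs_baseStalk h a
    · obtain ⟨f, rfl⟩ := hπ f
      rw [hw]
      refine logVal_le α (w'.comap π).map_zero (w'.comap π).map_add (w'.comap π).map_mul
        (fun m => ?_) f
      change _ ≤ w' (π m)
      by_cases h0 : π m = 0
      · rw [h0, w'.map_zero]; exact le_top
      · have := hw'.eq_on_log ⟨π m, (hN _).mpr ⟨m, rfl, h0⟩⟩
        rw [← hwm]
        exact ((hβ ⟨π m, (hN _).mpr ⟨m, rfl, h0⟩⟩).symm.trans this.symm).le
    · obtain ⟨f, rfl⟩ := hπ f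
      rw [hP, hw]

end Face

/-! ### Strata and their trace log structures -/

section Trace

variable {X : Scheme.{u}}

theorem stalkMap_generize {Y : Scheme.{u}} (g : Y ⟶ X) {y z : Y} (h : y ⤳ z)
    (f : X.presheaf.stalk (g z)) :
    generize h (g.stalkMap z f) = g.stalkMap y (generize (h.map g.continuous) f) :=
  congrArg (fun t => t.hom f) (Scheme.Hom.stalkSpecializes_stalkMap g y z h).symm

/-- In one direction, a germ invertible at `y` cannot vanish at the generic point of `D_y`. In the
other, a section that vanishes at `y` vanishes on the closure of `y`, so it lies in the vanishing
ideal that defines the reduced structure. -/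
theorem stalkMap_stratumι_eq_zero_iff (y : X) (x : stratum y) (f : X.presheaf.stalk (stratumι y x)) :
    (stratumι y).stalkMap x f = 0 ↔ f ∈ primeOf (specializes_stratumι y x) := by
  constructor
  · intro hf hu
    obtain ⟨η, hη⟩ := exists_stratumι_eq (specializes_refl y)
    have hηx : η ⤳ x := (stratumι y).isClosedEmbedding.isInducing.specializes_iff.mp
      (by rw [hη]; exact specializes_stratumι y x)
    have h1 := stalkMap_generize (stratumι y) hηx f
    rw [hf, map_zero] at h1
    have h2 : IsUnit (generize (hηx.map (stratumι y).continuous) f) := by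
      -- The image of `η` equals `y` only propositionally; generalizing over the point permits
      -- substitution in the stalk.
      have key : ∀ {y' : X} (_ : y' = y) (h' : y' ⤳ stratumι y x), IsUnit (generize h' f) := by
        rintro _ rfl h'; exact hu
      exact key hη _
    exact not_isUnit_zero (h1 ▸ h2.map ((stratumι y).stalkMap η).hom)
  · intro hf
    obtain ⟨V, hV, s, rfl⟩ := X.presheaf.exists_germ_eq f
    obtain ⟨_, ⟨U, hU, rfl⟩, hxU, hUV⟩ := X.isBasis_affineOpens.exists_subset_of_mem_open hV V.2
    have hUV' : U ≤ V := hUV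
    have e := TopCat.Presheaf.germ_res_apply X.presheaf (homOfLE hUV' : U ⟶ V) _ hxU s
    rw [← e] at hf ⊢
    set t := X.presheaf.map (homOfLE hUV').op s
    have ht : t ∈ RingHom.ker ((stratumι y).app U).hom := by
      refine (Scheme.IdealSheafData.ker_subschemeι_app _ ⟨U, hU⟩).ge ?_
      rw [Scheme.IdealSheafData.vanishingIdeal_ideal, PrimeSpectrum.mem_vanishingIdeal]
      intro q hq
      by_contra hqt
      have h1 : hU.fromSpec q ∈ X.basicOpen t := by
        have : q ∈ hU.fromSpec ⁻¹ᵁ X.basicOpen t := by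
          rw [hU.fromSpec_preimage_basicOpen]; exact hqt
        exact this
      have h2 : y ⤳ hU.fromSpec q := specializes_iff_mem_closure.mpr hq
      have h3 := (X.mem_basicOpen t y ((specializes_stratumι y x).mem_open U.2 hxU)).mp
        (h2.mem_open (X.basicOpen t).2 h1)
      rw [mem_primeOf, generize_germ] at hf
      exact hf h3
    have h4 := Scheme.Hom.germ_stalkMap_apply (stratumι y) U x hxU t
    refine h4.trans ?_
    exact (congrArg _ ht).trans (map_zero _)

namespace LogStructure

variable (M : LogStructure X)

theorem stalk_trace_subset (y : X) (x : stratum y) : (M.trace y).stalk x ≤ M.traceStalk y x := by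
  rintro _ ⟨U, hU, s, hs, rfl⟩
  exact hs x hU

/-- Nonvanishing at `y` is one and the same condition at all points of `D_y` near `x`, so a germ of
`M_x` with nonzero image spreads out to a section of the trace. -/
theorem mem_stalk_trace_iff (y : X) (x : stratum y) (n : (stratum y).presheaf.stalk x) :
    n ∈ (M.trace y).stalk x ↔
      ∃ m : M.stalk (stratumι y x), (stratumι y).stalkMap x m = n ∧ n ≠ 0 := by
  constructor
  · intro hn
    obtain ⟨m, hm, rfl⟩ := M.stalk_trace_subset y x hn
    refine ⟨⟨m, hm.1⟩, rfl, fun h0 => ?_⟩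
    exact (stalkMap_stratumι_eq_zero_iff y x m).mp h0 hm.2
  · rintro ⟨⟨m, hm⟩, rfl, h0⟩
    have hm0 : IsUnit (generize (specializes_stratumι y x) m) := by
      by_contra hc
      exact h0 ((stalkMap_stratumι_eq_zero_iff y x m).mpr hc)
    obtain ⟨U, hU, s, hs, rfl⟩ := hm
    have e := Scheme.Hom.germ_stalkMap_apply (stratumι y) U x hU s
    change (stratumι y).stalkMap x (X.presheaf.germ U _ hU s) ∈ _
    rw [e]
    refine (M.trace y).germ_mem_stalk hU fun z (hz : stratumι y z ∈ U) => ?_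
    rw [← Scheme.Hom.germ_stalkMap_apply (stratumι y) U z hz s]
    refine ⟨_, ⟨M.germ_mem_stalk hz hs, ?_⟩, rfl⟩
    rw [generize_germ] at hm0
    change IsUnit (generize (specializes_stratumι y z) (X.presheaf.germ U _ hz s))
    rwa [generize_germ]

theorem map_charIdeal (y : X) (x : stratum y) :
    (M.charIdeal (stratumι y x)).map ((stratumι y).stalkMap x).hom = (M.trace y).charIdeal x := by
  refine le_antisymm (Ideal.map_le_iff_le_comap.mpr (Ideal.span_le.mpr ?_)) (Ideal.span_le.mpr ?_)
  · rintro f ⟨hf, hfu⟩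
    by_cases h0 : (stratumι y).stalkMap x f = 0
    · exact Ideal.mem_comap.mpr (h0 ▸ zero_mem _)
    · refine Ideal.subset_span ⟨(M.mem_stalk_trace_iff y x _).mpr ⟨⟨f, hf⟩, rfl, h0⟩, fun hu => ?_⟩
      exact hfu ((isUnit_map_iff ((stratumι y).stalkMap x).hom f).mp hu)
  · rintro n ⟨hn, hnu⟩
    obtain ⟨m, rfl, -⟩ := (M.mem_stalk_trace_iff y x n).mp hn
    exact Ideal.mem_map_of_mem _ (Ideal.subset_span ⟨m.2, fun hu => hnu (hu.map _)⟩)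

/-- The kernel of the surjection of stalks lies in the characteristic ideal at the point because `y`
is in the fan, so passing to `D_y` loses nothing. -/
theorem mem_katoFan_trace_iff [AlgebraicGeometry.IsIntegral X] [IsLocallyNoetherian X]
    (hfs : M.IsFineSaturated) (hreg : M.IsLogRegular) {y : X} (hy : y ∈ M.katoFan)
    (x : stratum y) : x ∈ (M.trace y).katoFan ↔ stratumι y x ∈ M.katoFan := by
  have hsurj : Function.Surjective ((stratumι y).stalkMap x).hom :=
    (stratumι y).stalkMap_surjective x
  have hmax : (IsLocalRing.maximalIdeal ((stratum y).presheaf.stalk x)).comap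
      ((stratumι y).stalkMap x).hom = IsLocalRing.maximalIdeal _ :=
    IsLocalRing.eq_maximalIdeal (Ideal.comap_isMaximal_of_surjective _ hsurj)
  change (M.trace y).charIdeal x = _ ↔ M.charIdeal _ = _
  rw [← map_charIdeal]
  constructor
  · intro h
    rw [← hmax, ← h, Ideal.comap_map_of_surjective _ hsurj, eq_comm, sup_eq_left]
    intro f hf
    exact primeOf_le_charIdeal hfs hreg (specializes_stratumι y x) hy
      ((stalkMap_stratumι_eq_zero_iff y x f).mp hf)
  · intro h
    rw [h, ← hmax, Ideal.map_comap_of_surjective _ hsurj]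

end LogStructure

end Trace

end LogSkel

namespace LogSkel

open Filter Topology

/-! ### The valuation ring is noetherian -/

section Noetherian

variable {K : Type u} [NormedField K] [IsUltrametricDist K]

/-- A nonzero ideal is generated by any of its elements of largest norm, which exists because
nonzero norms are natural powers of `r`. -/
theorem isNoetherianRing_valRing (hK : IsTriviallyValued K ∨ IsDiscretelyValued K) :
    IsNoetherianRing (valRing K) := by
  obtain ⟨r, hr0, hr1, hr⟩ : ∃ r : ℝ, 0 < r ∧ r < 1 ∧
      ∀ a : valRing K, a ≠ 0 → ∃ n : ℕ, ‖(a : K)‖ = r ^ n := by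
    rcases hK with h | ⟨r, hr0, hr1, hr⟩
    -- In the trivially valued case any `r` in `(0, 1)` serves, as only `r ^ 0` occurs.
    · refine ⟨1 / 2, by norm_num, by norm_num, fun a ha => ⟨0, ?_⟩⟩
      rw [h a (fun h0 => ha (Subtype.ext h0)), pow_zero]
    · refine ⟨r, hr0, hr1, fun a ha => ?_⟩
      have h1 : ‖(a : K)‖ ∈ Set.range (fun n : ℤ => r ^ n) := by
        rw [← hr]
        exact ⟨Units.mk0 (a : K) (fun h0 => ha (Subtype.ext h0)), rfl⟩
      obtain ⟨n, hn⟩ := h1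
      have h2 : ‖(a : K)‖ ≤ 1 :=
        ((NormedField.valuation (K := K)).mem_valuationSubring_iff _).mp a.2
      have h3 : 0 ≤ n := by
        by_contra! hneg
        exact absurd (hn.trans_le h2) (not_le.mpr (one_lt_zpow_of_neg₀ hr0 hr1 hneg))
      obtain ⟨n, rfl⟩ := Int.eq_ofNat_of_zero_le h3
      exact ⟨n, by rw [← hn]; simp⟩
  have : IsPrincipalIdealRing (valRing K) := by
    refine ⟨fun I => ?_⟩
    by_cases hI : ∃ a ∈ I, a ≠ 0
    · classical
      have hex : ∃ n : ℕ, ∃ a ∈ I, a ≠ 0 ∧ ‖(a : K)‖ = r ^ n := by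
        obtain ⟨a, ha, ha0⟩ := hI
        obtain ⟨n, hn⟩ := hr a ha0
        exact ⟨n, a, ha, ha0, hn⟩
      obtain ⟨a, ha, ha0, hn⟩ := Nat.find_spec hex
      have haK : (a : K) ≠ 0 := fun h0 => ha0 (Subtype.ext h0)
      refine ⟨a, le_antisymm (fun b hb => ?_)
        ((Submodule.span_singleton_le_iff_mem _ _).mpr ha)⟩
      by_cases hb0 : b = 0
      · rw [hb0]; exact zero_mem _
      obtain ⟨m, hm⟩ := hr b hb0
      have hle : ‖(b : K)‖ ≤ ‖(a : K)‖ := by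
        rw [hn, hm]
        exact pow_le_pow_of_le_one hr0.le hr1.le (Nat.find_min' hex ⟨b, hb, hb0, hm⟩)
      have hmem : (b : K) / a ∈ valRing K := by
        refine ((NormedField.valuation (K := K)).mem_valuationSubring_iff _).mpr ?_
        have : ‖(b : K) / a‖ ≤ 1 := by
          rw [norm_div]; exact div_le_one_of_le₀ hle (norm_nonneg _)
        exact this
      refine Submodule.mem_span_singleton.mpr ⟨⟨_, hmem⟩, Subtype.ext ?_⟩
      exact div_mul_cancel₀ _ haK
    · push Not at hI
      exact ⟨0, by
        rw [Submodule.span_zero_singleton]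
        exact (Submodule.eq_bot_iff _).mpr hI⟩
  infer_instance

end Noetherian

/-! ### The valuative criterion and centres of limits -/

section Separated

variable {X : Scheme.{u}} [AlgebraicGeometry.IsIntegral X] [X.IsSeparated]

/-- The uniqueness part of the valuative criterion. -/
theorem specializes_of_valuationSubring (B : ValuationSubring X.functionField) {x z : X}
    (hx : ∀ f, generize (genericPoint_specializes x) f ∈ B)
    (hz : ∀ f, generize (genericPoint_specializes z) f ∈ B)
    (hz' : ∀ f ∈ IsLocalRing.maximalIdeal (X.presheaf.stalk z), ∀ g ∈ B,
      generize (genericPoint_specializes z) f * g ≠ 1) : z ⤳ x := by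
  -- The two maps from `Spec B`, through `O_x` and through `O_z`, agree on the generic point and
  -- hence everywhere. The closed point goes to `z` by the second, and into the generizations of `x`
  -- by the first.
  have key : ∀ (w : X) (hw : ∀ f, generize (genericPoint_specializes w) f ∈ B),
      Spec.map (CommRingCat.ofHom B.subtype) ≫
        Spec.map (CommRingCat.ofHom ((generize (genericPoint_specializes w)).codRestrict B hw)) ≫
          X.fromSpecStalk w = X.fromSpecStalk (genericPoint X) := by
    intro w hw
    rw [← Scheme.SpecMap_stalkSpecializes_fromSpecStalk (genericPoint_specializes w),
      ← Spec.map_comp_assoc]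
    rfl
  have hdom : IsDominant (Spec.map (CommRingCat.ofHom B.subtype)) := by
    refine ⟨?_⟩
    refine (PrimeSpectrum.denseRange_comap_iff_ker_le_nilRadical _).mpr ?_
    have : RingHom.ker B.subtype = ⊥ := (RingHom.injective_iff_ker_eq_bot _).mp B.subtype_injective
    exact this.le.trans bot_le
  have e := ext_of_isDominant (Spec.map (CommRingCat.ofHom B.subtype))
    ((key x hx).trans (key z hz).symm)
  have hloc : IsLocalHom ((generize (genericPoint_specializes z)).codRestrict B hz) := by
    refine ⟨fun f hf => ?_⟩
    by_contra hfu
    obtain ⟨g, hg⟩ := hf.exists_right_inv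
    exact hz' f hfu g g.2 (congrArg Subtype.val hg)
  have h1 := congrArg (fun t => t (IsLocalRing.closedPoint B)) e
  have h2 : Spec.map (CommRingCat.ofHom ((generize (genericPoint_specializes z)).codRestrict B hz))
      (IsLocalRing.closedPoint B) = IsLocalRing.closedPoint (X.presheaf.stalk z) :=
    IsLocalRing.comap_closedPoint _
  have h3 : z ∈ Set.range (X.fromSpecStalk x) :=
    ⟨_, h1.trans ((congrArg (X.fromSpecStalk z) h2).trans Scheme.fromSpecStalk_closedPoint)⟩
  rwa [Scheme.range_fromSpecStalk] at h3

variable {K : Type u} [NormedField K] [IsUltrametricDist K] {p : X ⟶ base K}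

/-- A centre of a limit of points over the generic point that are bounded by one on `O_x` is a
generization of `x`. -/
theorem specializes_of_tendsto {ι : Type*} {U : Ultrafilter ι} {Q : ι → AnSpace p} {P : AnSpace p}
    (hQ : Tendsto Q U (𝓝 P)) (hgen : ∀ i, (Q i).ker ⤳ genericPoint X) {x z : X}
    (hx : ∀ i f, (Q i).1.stalkAbs ((hgen i).trans (genericPoint_specializes x)) f ≤ 1)
    (hz : P.1.HasCentre z) : z ⤳ x := by
  -- The functions asymptotically bounded by one. The ultrafilter makes `g` or `g⁻¹` qualify; the
  -- slack `c > 1` is needed because `|f(P)| ≤ 1` bounds the approximating values only up to such a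
  -- `c`.
  let B : ValuationSubring X.functionField :=
    { carrier := {g | ∀ c : ℝ, 1 < c → ∀ᶠ i in U, (Q i).1.stalkAbs (hgen i) g ≤ c}
      mul_mem' := fun {f g} hf hg c hc => by
        have hs : 1 < √c := Real.lt_sqrt_of_sq_lt (by simpa using hc)
        filter_upwards [hf _ hs, hg _ hs] with i h1 h2
        refine ((Q i).1.stalkAbs_mul (hgen i) f g).trans_le ?_
        rw [← Real.mul_self_sqrt (zero_le_one.trans hc.le)]
        exact mul_le_mul h1 h2 ((Q i).1.stalkAbs_nonneg _ _) (Real.sqrt_nonneg c)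
      one_mem' := fun c hc => Eventually.of_forall fun i =>
        ((Q i).1.stalkAbs_one (hgen i)).trans_le hc.le
      add_mem' := fun {f g} hf hg c hc => by
        filter_upwards [hf c hc, hg c hc] with i h1 h2
        exact ((Q i).1.stalkAbs_add_le (hgen i) f g).trans (max_le h1 h2)
      zero_mem' := fun c hc => Eventually.of_forall fun i =>
        ((Q i).1.stalkAbs_zero (hgen i)).trans_le (zero_le_one.trans hc.le)
      neg_mem' := fun {f} hf c hc => by
        filter_upwards [hf c hc] with i h1
        exact ((Q i).1.stalkAbs_neg (hgen i) f).trans_le h1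
      mem_or_inv_mem' := fun g => by
        by_cases hg : ∀ c : ℝ, 1 < c → ∀ᶠ i in U, (Q i).1.stalkAbs (hgen i) g ≤ c
        · exact Or.inl hg
        · refine Or.inr fun c hc => ?_
          push Not at hg
          obtain ⟨d, hd, hg⟩ := hg
          filter_upwards [hg] with i hi
          have hg0 : g ≠ 0 := by
            rintro rfl
            have := hi.trans_eq ((Q i).1.stalkAbs_zero (hgen i))
            linarith
          have h1 := ((Q i).1.stalkAbs_one (hgen i)).symm.trans
            ((congrArg _ (mul_inv_cancel₀ hg0).symm).trans
              ((Q i).1.stalkAbs_mul (hgen i) g g⁻¹))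
          have h2 := (Q i).1.stalkAbs_nonneg (hgen i) g⁻¹
          by_contra! hc'
          nlinarith [mul_pos (sub_pos.mpr hi) (sub_pos.mpr hc')] }
  obtain ⟨hPz, hc⟩ := hz
  have hlim := fun f => AnSpace.tendsto_stalkAbs hQ hPz
    (fun i => (hgen i).trans (genericPoint_specializes z)) f
  have hgz : ∀ i f, (Q i).1.stalkAbs (hgen i) (generize (genericPoint_specializes z) f) =
      (Q i).1.stalkAbs ((hgen i).trans (genericPoint_specializes z)) f := fun i f =>
    (Q i).1.stalkAbs_generize _ _ f
  refine specializes_of_valuationSubring B (fun f c hc' => Eventually.of_forall fun i => ?_)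
    (fun f c hc' => ?_) (fun f hf g hg h1 => ?_)
  · exact (((Q i).1.stalkAbs_generize _ (hgen i) f).trans_le (hx i f)).trans hc'.le
  · filter_upwards [(hlim f).eventually_lt_const ((hc f).1.trans_lt hc')] with i hi
    exact (hgz i f).trans_le hi.le
  · set t := P.1.stalkAbs hPz f
    have ht1 : t < 1 := (hc f).2 hf
    have ht0 : 0 ≤ t := P.1.stalkAbs_nonneg hPz f
    -- With `s = (t + 1) / 2 < 1`, the bound `2 / (1 + s)` for `g` exceeds one while `s * (2 / (1 +
    -- s))` is less than one, contradicting `|f g| = 1`.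
    have hd : 1 < 2 / (1 + (t + 1) / 2) := by
      rw [one_lt_div (by linarith)]; linarith
    obtain ⟨i, hi1, hi2⟩ := ((hg _ hd).and ((hlim f).eventually_lt_const
      (show t < (t + 1) / 2 by linarith))).exists
    have h2 := ((Q i).1.stalkAbs_mul (hgen i) _ g).symm.trans
      ((congrArg ((Q i).1.stalkAbs (hgen i)) h1).trans ((Q i).1.stalkAbs_one (hgen i)))
    have h2' := (congrArg (· * (Q i).1.stalkAbs (hgen i) g) (hgz i f)).symm.trans h2
    have h3 : (t + 1) / 2 * (2 / (1 + (t + 1) / 2)) < 1 := by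
      rw [← mul_div_assoc, div_lt_one (by linarith)]; linarith
    have h4 := mul_le_mul hi2.le hi1 ((Q i).1.stalkAbs_nonneg (hgen i) g) (by linarith)
    exact lt_irrefl _ ((h2'.symm.trans_le h4).trans_lt h3)

end Separated

end LogSkel

namespace LogSkel

open Filter Topology

/-! ### The closure of the skeleton -/

section Skeleton

variable {K : Type u} [NormedField K] [IsUltrametricDist K] {X : Scheme.{u}} {p : X ⟶ base K}
  [AlgebraicGeometry.IsIntegral X] [IsLocallyNoetherian X] {M : LogStructure X}
  (hfs : M.IsFineSaturated) (hreg : M.IsLogRegular) (hover : M.IsOver p)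
include hfs hreg hover

/-- The case of the identity of `O_x`: no element of `M_x` is zero, so all weights are finite. -/
theorem mem_skeletonFace_iff_logVal {x : X} (P : AnSpace p) : P ∈ skeletonFace p M x ↔
    ∃ α : Additive (M.charMonoid x) →+ ℝ≥0∞, (∀ c, α c ≠ ⊤) ∧
      ∃ h : P.ker ⤳ x, ∀ f, P.1.stalkAbs h f = expNeg (logVal (M.stalk x) α f) := by
  have hM := LogStructure.isLogRegularSubmonoid hfs hreg x
  have h0 : ∀ m : M.stalk x, (m : X.presheaf.stalk x) ≠ 0 := fun m hm =>
    hM.zero_notMem (hm ▸ m.2)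
  rw [mem_skeletonFace_iff hM (RingHom.id (X.presheaf.stalk x)) Function.surjective_id
    (fun a ha => ⟨⟨_, hover a ha x⟩, rfl⟩)
    (fun n => ⟨fun hn => ⟨⟨n, hn⟩, rfl, h0 ⟨n, hn⟩⟩, fun ⟨m, hm, _⟩ => hm ▸ m.2⟩)
    (fun f hf => by rw [show f = 0 from hf]; exact zero_mem _)]
  refine exists_congr fun α => and_congr_left fun _ => ⟨fun H c => ?_, fun H m => ?_⟩
  · obtain ⟨m, rfl⟩ := exists_exponent_eq c
    exact fun hc => h0 m ((H m).mp hc)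
  · exact ⟨fun hc => absurd hc (H _), fun hc => absurd hc (h0 m)⟩

/-- The case of the surjection onto the stalk of `D_y`, whose kernel is generated by elements of
`M_x` because `y` is in the fan. -/
theorem mem_skeletonFace_trace_iff {y : X} (hy : y ∈ M.katoFan) (x : stratum y)
    (Q : AnSpace (stratumι y ≫ p)) : Q ∈ skeletonFace (stratumι y ≫ p) (M.trace y) x ↔
      ∃ α : Additive (M.charMonoid (stratumι y x)) →+ ℝ≥0∞,
        (∀ m : M.stalk (stratumι y x), α (exponent m) = ⊤ ↔
          (m : X.presheaf.stalk (stratumι y x)) ∈ primeOf (specializes_stratumι y x)) ∧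
        ∃ h : (stratumInclusion p y Q).ker ⤳ stratumι y x, ∀ f,
          (stratumInclusion p y Q).1.stalkAbs h f =
            expNeg (logVal (M.stalk (stratumι y x)) α f) := by
  have hM := LogStructure.isLogRegularSubmonoid hfs hreg (stratumι y x)
  rw [mem_skeletonFace_iff hM ((stratumι y).stalkMap x).hom ((stratumι y).stalkMap_surjective x)
    (fun a ha => ⟨⟨_, hover a ha _⟩, (BerkovichPoint.baseStalk_comp (stratumι y) x a).symm⟩)
    (M.mem_stalk_trace_iff y x) (fun f hf => ?_)]
  · refine exists_congr fun α => and_congr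
      (forall_congr' fun m => by
        exact iff_congr Iff.rfl (stalkMap_stratumι_eq_zero_iff y x m)) ⟨?_, ?_⟩
    · rintro ⟨h, H⟩
      exact ⟨h.map (stratumι y).continuous, fun f =>
        (BerkovichPoint.stalkAbs_map (stratumι y) Q.1 h _ f).trans (H f)⟩
    · rintro ⟨h, H⟩
      have h' : Q.ker ⤳ x := (stratumι y).isClosedEmbedding.isInducing.specializes_iff.mp h
      exact ⟨h', fun f => (BerkovichPoint.stalkAbs_map (stratumι y) Q.1 h' h f).symm.trans (H f)⟩
  · have h1 := (stalkMap_stratumι_eq_zero_iff y x f).mp hf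
    rw [(LogStructure.mem_katoFan_iff hfs hreg _).mp hy] at h1
    refine Ideal.span_mono ?_ h1
    rintro m ⟨hm, hm'⟩
    exact ⟨⟨m, hm⟩, (stalkMap_stratumι_eq_zero_iff y x m).mpr hm', rfl⟩

/-- The kernel and the set of infinite weights determine each other: the kernel is the support,
which is generated by the elements of infinite weight. So the condition on `α` can be traded for one
on the kernel. -/
theorem mem_stratumSkeleton_iff {y : X} (hy : y ∈ M.katoFan) (P : AnSpace p) :
    P ∈ stratumSkeleton p M y ↔ P.ker = y ∧ ∃ x ∈ M.katoFan,
      ∃ (h : P.ker ⤳ x) (α : Additive (M.charMonoid x) →+ ℝ≥0∞),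
        ∀ f, P.1.stalkAbs h f = expNeg (logVal (M.stalk x) α f) := by
  constructor
  · rintro ⟨Q, hQ, rfl⟩
    obtain ⟨x, hx, hQ⟩ := Set.mem_iUnion₂.mp hQ
    obtain ⟨α, hα, h, H⟩ := (mem_skeletonFace_trace_iff hfs hreg hover hy x Q).mp hQ
    have hM := LogStructure.isLogRegularSubmonoid hfs hreg (stratumι y x)
    refine ⟨eq_of_primeOf_eq h (specializes_stratumι y x) ?_, _,
      (M.mem_katoFan_trace_iff hfs hreg hy x).mp hx, h, α, H⟩
    rw [(LogStructure.mem_katoFan_iff hfs hreg (specializes_stratumι y x)).mp hy]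
    ext f
    have h1 : f ∈ primeOf h ↔ logVal _ α f = ⊤ :=
      ((stratumInclusion p y Q).1.stalkAbs_eq_zero h).symm.trans
        (by rw [← expNeg_eq_zero]; exact (congrArg (· = 0) (H f)).to_iff)
    rw [h1, hM.logVal_eq_top_iff]
    simp only [hα]
    have hset : {x_1 | ∃ m : M.stalk (stratumι y x),
        (m : X.presheaf.stalk (stratumι y x)) ∈ primeOf (specializes_stratumι y x) ∧
          (m : X.presheaf.stalk (stratumι y x)) = x_1} =
        {f | f ∈ M.stalk (stratumι y x) ∧ f ∈ primeOf (specializes_stratumι y x)} := by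
      ext m
      refine ⟨?_, fun hm => ⟨⟨m, hm.1⟩, hm.2, rfl⟩⟩
      rintro ⟨m, hm, rfl⟩
      exact ⟨m.2, hm⟩
    rw [hset]
  · rintro ⟨hPy, x, hx, h, α, H⟩
    have hyx : y ⤳ x := hPy ▸ h
    obtain ⟨Q, rfl⟩ := exists_stratumInclusion_eq (y := y) P (by rw [hPy])
    obtain ⟨x, rfl⟩ := exists_stratumι_eq hyx
    refine ⟨Q, Set.mem_iUnion₂.mpr ⟨x, (M.mem_katoFan_trace_iff hfs hreg hy x).mpr hx,
      (mem_skeletonFace_trace_iff hfs hreg hover hy x Q).mpr ⟨α, fun m => ?_, h, H⟩⟩, rfl⟩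
    have hM := LogStructure.isLogRegularSubmonoid hfs hreg (stratumι y x)
    rw [← hM.logVal_exponent α m, ← expNeg_eq_zero, ← H]
    refine ((stratumInclusion p y Q).1.stalkAbs_eq_zero h).trans ?_
    have key : ∀ {y' : X} (_ : y' = y) (h' : y' ⤳ stratumι y x),
        primeOf h' = primeOf (specializes_stratumι y x) := by
      rintro _ rfl _; rfl
    exact iff_of_eq (congrArg ((m : X.presheaf.stalk (stratumι y x)) ∈ ·) (key hPy h))

/-- With finite weights the support is the zero ideal. -/
theorem ker_eq_genericPoint {x : X} {P : AnSpace p} (hP : P ∈ skeletonFace p M x) :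
    P.ker = genericPoint X := by
  obtain ⟨α, hα, h, H⟩ := (mem_skeletonFace_iff_logVal hfs hreg hover P).mp hP
  refine eq_of_primeOf_eq h (genericPoint_specializes x) ?_
  have hM := LogStructure.isLogRegularSubmonoid hfs hreg x
  ext f
  have h1 : f ∈ primeOf h ↔ logVal _ α f = ⊤ :=
    (P.1.stalkAbs_eq_zero h).symm.trans
      (by rw [← expNeg_eq_zero]; exact (congrArg (· = 0) (H f)).to_iff)
  rw [h1, hM.logVal_eq_top_iff]
  have hset : {x_1 | ∃ m : M.stalk x, α (exponent m) = ⊤ ∧ (m : X.presheaf.stalk x) = x_1} = ∅ :=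
    Set.eq_empty_of_forall_notMem fun _ ⟨m, hm, _⟩ => hα _ hm
  rw [hset, Ideal.span_empty, Ideal.mem_bot, mem_primeOf]
  have hf : IsUnit (generize (genericPoint_specializes x) f) ↔
      generize (genericPoint_specializes x) f ≠ 0 :=
    isUnit_iff_ne_zero (G₀ := X.functionField)
  rw [hf, not_not, map_eq_zero_iff _ (generize_injective _)]

/-- The points of the strata skeletons are limits of points of the skeleton. -/
theorem mem_closure_of_logVal {x : X} {P : AnSpace p} (h : P.ker ⤳ x)
    (α : Additive (M.charMonoid x) →+ ℝ≥0∞)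
    (H : ∀ f, P.1.stalkAbs h f = expNeg (logVal (M.stalk x) α f)) :
    P ∈ closure (skeletonFace p M x) := by
  have hM := LogStructure.isLogRegularSubmonoid hfs hreg x
  obtain ⟨b, hb, hlim⟩ := hM.exists_finite_approximation α
  let a : ℕ → Additive (M.charMonoid x) →+ ℝ≥0∞ := fun n =>
    ENNReal.ofNNRealHom.toAddMonoidHom.comp (b n)
  have ha : ∀ n c, a n c = (b n c : ℝ≥0∞) := fun n c => rfl
  have hex : ∀ n, ∃ (Q : AnSpace p) (hQ : Q.ker ⤳ x), Q.ker = genericPoint X ∧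
      ∀ f, Q.1.stalkAbs hQ f = expNeg (hM.valuation (a n) f) := by
    refine fun n => exists_anSpace x (hM.valuation (a n)) (fun f hf => ?_) fun c => ?_
    · rw [hM.valuation_apply, hM.logVal_eq_top_iff] at hf
      have hset : {x_1 | ∃ m : M.stalk x, a n (exponent m) = ⊤ ∧
          (m : X.presheaf.stalk x) = x_1} = ∅ :=
        Set.eq_empty_of_forall_notMem fun _ ⟨m, hm, _⟩ => ENNReal.coe_ne_top hm
      rwa [hset, Ideal.span_empty, Ideal.mem_bot] at hf
    · by_cases hc : c = 0
      · rw [hc, map_zero, (hM.valuation (a n)).map_zero, expNeg_top]; simp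
      -- Nonzero constants have finite weight, where the approximants agree with `α`, so these still
      -- extend the valuation of `K`.
      · have h1 : α (exponent ⟨_, hover c hc x⟩) ≠ ⊤ := by
          rw [← hM.logVal_exponent, Ne, ← expNeg_eq_zero, ← H]
          refine (P.1.stalkAbs_baseStalk h c).trans_ne ?_
          rw [norm_ne_zero_iff]
          exact fun h0 => hc (Subtype.ext h0)
        rw [hM.valuation_apply, hM.logVal_exponent (a n) ⟨_, hover c hc x⟩, ha, hb n _ h1,
          ← hM.logVal_exponent, ← H]
        exact P.1.stalkAbs_baseStalk h c
  choose Q hQ hgen HQ using hex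
  refine mem_closure_of_tendsto (f := Q) (b := atTop) ?_ (Eventually.of_forall fun n =>
    (mem_skeletonFace_iff_logVal hfs hreg hover (Q n)).mpr
      ⟨a n, fun c => ENNReal.coe_ne_top, hQ n, HQ n⟩)
  refine Topology.IsInducing.subtypeVal.tendsto_nhds_iff.mpr ?_
  refine BerkovichPoint.tendsto_of_stalkAbs (P := P.1) h
    (fun n => (specializes_of_eq (hgen n)).trans (genericPoint_specializes P.ker)) fun f => ?_
  have h1 := (continuous_expNeg.tendsto _).comp (hM.tendsto_logVal (a := a) α hlim f)
  rw [← H] at h1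
  exact h1.congr fun n => (HQ n f).symm

/-- Limits of points of a face of the skeleton. -/
theorem exists_logVal_of_mem_closure [X.IsSeparated] {x : X} {P : AnSpace p}
    (hP : P ∈ closure (skeletonFace p M x)) :
    ∃ (h : P.ker ⤳ x) (α : Additive (M.charMonoid x) →+ ℝ≥0∞),
      ∀ f, P.1.stalkAbs h f = expNeg (logVal (M.stalk x) α f) := by
  have hM := LogStructure.isLogRegularSubmonoid hfs hreg x
  have hne := mem_closure_iff_comap_neBot.mp hP
  -- Along an ultrafilter all weights converge at once, `[0, ∞]` being compact.
  let U : Ultrafilter (skeletonFace p M x) := Ultrafilter.of (comap Subtype.val (𝓝 P))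
  let Q : skeletonFace p M x → AnSpace p := Subtype.val
  have hQ : Tendsto Q U (𝓝 P) := tendsto_comap.mono_left (Ultrafilter.of_le _)
  choose a ha hx H using fun i : skeletonFace p M x =>
    (mem_skeletonFace_iff_logVal hfs hreg hover i.1).mp i.2
  have hgen : ∀ i, (Q i).ker ⤳ genericPoint X := fun i =>
    specializes_of_eq (ker_eq_genericPoint hfs hreg hover i.2)
  have hlim : ∀ c, ∃ t, Tendsto (fun i => a i c) U (𝓝 t) := fun c =>
    ⟨_, (U.map fun i => a i c).le_nhds_lim⟩
  choose t ht using hlim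
  let α : Additive (M.charMonoid x) →+ ℝ≥0∞ :=
    { toFun := t
      map_zero' := tendsto_nhds_unique (ht 0) (by simp only [map_zero]; exact tendsto_const_nhds)
      map_add' := fun c d => tendsto_nhds_unique (ht (c + d))
        (by simp only [map_add]; exact (ht c).add (ht d)) }
  obtain ⟨z, hz⟩ := P.2
  -- Without this the limit could have its kernel outside `Spec O_x`, and the limiting weights would
  -- not describe it.
  have hzx : z ⤳ x := specializes_of_tendsto hQ hgen
    (fun i f => (H i f).trans_le (expNeg_le_one _)) hz
  refine ⟨hz.1.trans hzx, α, fun f => ?_⟩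
  have h1 := AnSpace.tendsto_stalkAbs hQ (hz.1.trans hzx) hx f
  have h2 := (continuous_expNeg.tendsto _).comp (hM.tendsto_logVal (a := a) α ht f)
  exact tendsto_nhds_unique h1 (h2.congr fun i => (H i f).symm)

/-- The prime of the kernel is the support, which is generated by elements of `M_x`. -/
theorem ker_mem_katoFan {x : X} {P : AnSpace p} (h : P.ker ⤳ x)
    (α : Additive (M.charMonoid x) →+ ℝ≥0∞)
    (H : ∀ f, P.1.stalkAbs h f = expNeg (logVal (M.stalk x) α f)) : P.ker ∈ M.katoFan := by
  have hM := LogStructure.isLogRegularSubmonoid hfs hreg x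
  have hf : ∀ f, f ∈ primeOf h ↔ logVal (M.stalk x) α f = ⊤ := fun f =>
    (P.1.stalkAbs_eq_zero h).symm.trans
      (by rw [← expNeg_eq_zero]; exact (congrArg (· = 0) (H f)).to_iff)
  rw [LogStructure.mem_katoFan_iff hfs hreg h]
  refine le_antisymm (fun f hfp => ?_) (Ideal.span_le.mpr fun f hfp => hfp.2)
  rw [hf, hM.logVal_eq_top_iff] at hfp
  refine Ideal.span_mono ?_ hfp
  rintro _ ⟨m, hm, rfl⟩
  exact ⟨m.2, (hf _).mpr (by rw [hM.logVal_exponent, hm])⟩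

/-- Finiteness of the fan reduces the closure to closures of single faces, where limits of finite
weights are exactly weights in `[0, ∞]`. -/
theorem mem_closure_skeleton_iff [X.IsSeparated] [CompactSpace X] {P : AnSpace p} :
    P ∈ closure (skeleton p M) ↔ P.ker ∈ M.katoFan ∧ P ∈ stratumSkeleton p M P.ker := by
  rw [skeleton, (LogStructure.finite_katoFan hfs).closure_biUnion, Set.mem_iUnion₂]
  constructor
  · rintro ⟨x, hx, hP⟩
    obtain ⟨h, α, H⟩ := exists_logVal_of_mem_closure hfs hreg hover hP
    have hy := ker_mem_katoFan hfs hreg hover h α H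
    exact ⟨hy, (mem_stratumSkeleton_iff hfs hreg hover hy P).mpr ⟨rfl, x, hx, h, α, H⟩⟩
  · rintro ⟨hy, hP⟩
    obtain ⟨-, x, hx, h, α, H⟩ := (mem_stratumSkeleton_iff hfs hreg hover hy P).mp hP
    exact ⟨x, hx, mem_closure_of_logVal hfs hreg hover h α H⟩

end Skeleton

end LogSkel

/-! ### The decomposition of the closed skeleton -/

theorem mainTheorem5 (K : Type u) [NormedField K] [IsUltrametricDist K] [CompleteSpace K]
    (hK : LogSkel.IsTriviallyValued K ∨ LogSkel.IsDiscretelyValued K)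
    (X : Scheme.{u}) (p : X ⟶ LogSkel.base K)
    [AlgebraicGeometry.IsIntegral X] [IsSeparated p] [LocallyOfFiniteType p] [QuasiCompact p]
    (M : LogSkel.LogStructure X) (hfs : M.IsFineSaturated) (hreg : M.IsLogRegular)
    (hover : M.IsOver p) :
    closure (LogSkel.skeleton p M) = ⋃ y ∈ M.katoFan, LogSkel.stratumSkeleton p M y ∧
    M.katoFan.PairwiseDisjoint (LogSkel.stratumSkeleton p M) ∧
    (∀ y ∈ M.katoFan, Function.Injective (LogSkel.stratumInclusion p y)) ∧
    ∀ y ∈ M.katoFan,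
      LogSkel.stratumSkeleton p M y = closure (LogSkel.skeleton p M) ∩ {P | P.ker = y} := by
  have := LogSkel.isNoetherianRing_valRing hK
  have : IsLocallyNoetherian X := LocallyOfFiniteType.isLocallyNoetherian p
  have : CompactSpace X := QuasiCompact.compactSpace_of_compactSpace p
  -- Separatedness over the affine base gives absolute separatedness.
  have : X.IsSeparated := by
    rw [Scheme.isSeparated_iff, ← Limits.terminal.comp_from p]
    infer_instance
  have hcl : ∀ P, P ∈ closure (LogSkel.skeleton p M) ↔
      P.ker ∈ M.katoFan ∧ P ∈ LogSkel.stratumSkeleton p M P.ker := fun P =>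
    LogSkel.mem_closure_skeleton_iff hfs hreg hover
  have hker : ∀ y ∈ M.katoFan, ∀ P ∈ LogSkel.stratumSkeleton p M y, P.ker = y := fun y hy P hP =>
    ((LogSkel.mem_stratumSkeleton_iff hfs hreg hover hy P).mp hP).1
  refine ⟨?_, ?_, fun y _ => LogSkel.stratumInclusion_injective y, fun y hy => ?_⟩
  · ext P
    rw [hcl, Set.mem_iUnion₂]
    refine ⟨fun h => ⟨_, h.1, h.2⟩, fun ⟨y, hy, hP⟩ => ?_⟩
    obtain rfl := hker y hy P hP
    exact ⟨hy, hP⟩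
  · intro y hy y' hy' hne
    refine Set.disjoint_left.mpr fun P hP hP' => hne ?_
    rw [← hker y hy P hP, hker y' hy' P hP']
  · ext P
    refine ⟨fun hP => ?_, fun ⟨hP, e⟩ => ?_⟩
    · obtain rfl := hker y hy P hP
      exact ⟨(hcl P).mpr ⟨hy, hP⟩, rfl⟩
    · obtain rfl : P.ker = y := e
      exact ((hcl P).mp hP).2
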